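/- Let $F(\psi)=\psi(\psi+1)(\psi+2)$, $W_0(\rho)=\frac{1-\rho^2}{1+\frac35\rho^2}$, and let $V(\rho)=\frac{3F'(W_0(\rho)-1)-6}{\rho^2}=-144\,\frac{5-\rho^2}{(5+3\rho^2)^2}$. For functions on $[0,1]$ write $Df(\rho)=\frac1\rho f'(\rho)$ and $Kf(\rho)=\int_0^\rho s f(s)\,ds$. All function spaces are complex valued. Let $\mathcal H$ be the Hilbert space obtained as the completion of $$\{(u_1,u_2)\in C^4[0,1]\times C^1[0,1]:\ u_1^{(k)}(0)=u_2(0)=0,\ k=0,1,2,3\}$$ with respect to the inner product $$(\mathbf u|\mathbf v)=\int_0^1 D^2u_1\,\overline{D^2v_1}\,d\rho+\int_0^1 u_2'\,\overline{v_2'}\,d\rho .$$ Its elements are identified with pairs of functions $(u_1,u_2)\in C^1[0,1]\times C[0,1]$. Let $\mathbf L_0$ be the closure in $\mathcal H$ of the operator $$\tilde{\mathbf L}_0\mathbf u=\bigl(-\rho u_1'+2u_1+\rho^2u_2-3Ku_2,\ \ D^2u_1-\rho u_2'-u_2\bigr)$$ with domain $$\{(u_1,u_2)\in C^\infty[0,1]\times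 C^\infty[0,1]:\ u_1^{(k)}(0)=u_2(0)=0,\ k=0,1,2,3,4\},$$ let $\mathbf L'\mathbf u=(-VK^2u_2,\,0)$ on $\mathcal H$, and let $\mathbf L=\mathbf L_0+\mathbf L'$ with the domain of $\mathbf L_0$. If $\lambda\in\mathbb C$ belongs to the spectrum of $\mathbf L$ and $\mathrm{Re}\,\lambda>-\frac32$, then $\lambda$ is an eigenvalue of $\mathbf L$, and there exists a function $u\in C^\infty[0,1]$, not identically zero, such that $$-(1-\rho^2)\Bigl[u''+\tfrac2\rho u'\Bigr]+2\lambda\rho u'+\lambda(\lambda+1)u+\frac{3F'(W_0(\rho)-1)}{\rho^2}u=0 \qquad\text{for all }\rho\in(0,1].$$ -/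

import Mathlib

open Set MeasureTheory
open scoped ContDiff ComplexConjugate

namespace YangMills

noncomputable section

/-! ### The nonlinearity, the self-similar profile and the potential -/

/-- The nonlinearity `F(ψ) = ψ (ψ + 1) (ψ + 2)`. -/
def F (ψ : ℝ) : ℝ := ψ * (ψ + 1) * (ψ + 2)

/-- The self-similar profile `W₀(ρ) = (1 - ρ²) / (1 + 3ρ²/5)`. -/
def W₀ (ρ : ℝ) : ℝ := (1 - ρ ^ 2) / (1 + 3 / 5 * ρ ^ 2)

/-- The potential `V(ρ) = (3 F'(W₀(ρ) - 1) - 6) / ρ²`, in the closed form that is smooth at `0`;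
see `V_eq`. -/
def V (ρ : ℝ) : ℝ := -144 * (5 - ρ ^ 2) / (5 + 3 * ρ ^ 2) ^ 2

theorem deriv_F (ψ : ℝ) : deriv F ψ = 3 * ψ ^ 2 + 6 * ψ + 2 := by
  have h : HasDerivAt F ((1 * (ψ + 1) + ψ * 1) * (ψ + 2) + ψ * (ψ + 1) * 1) ψ :=
    ((hasDerivAt_id ψ).mul ((hasDerivAt_id ψ).add_const 1)).mul ((hasDerivAt_id ψ).add_const 2)
  rw [h.deriv]; ring

theorem V_eq {ρ : ℝ} (hρ : ρ ≠ 0) : V ρ = (3 * deriv F (W₀ ρ - 1) - 6) / ρ ^ 2 := by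
  have h1 : 5 + 3 * ρ ^ 2 ≠ 0 := by positivity
  have h2 : 1 + 3 / 5 * ρ ^ 2 ≠ 0 := by positivity
  rw [deriv_F, V, W₀]
  field_simp
  ring

/-! ### Function spaces

Functions on `[0,1]` are represented by functions `ℝ → ℂ`, of which only the values on `[0,1]`
matter; derivatives are taken within `[0,1]`. -/

/-- The interval `[0,1]`. -/
abbrev I : Set ℝ := Icc 0 1

/-- `D f (ρ) = f'(ρ) / ρ`. -/
def D (f : ℝ → ℂ) (ρ : ℝ) : ℂ := derivWithin f I ρ / ρ

/-- `K f (ρ) = ∫₀^ρ s f(s) ds`. -/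
def K (f : ℝ → ℂ) (ρ : ℝ) : ℂ := ∫ s in (0 : ℝ)..ρ, (s : ℂ) * f s

/-- `J f (ρ) = ∫₀^ρ f(s) ds`. -/
def J (f : ℝ → ℂ) (ρ : ℝ) : ℂ := ∫ s in (0 : ℝ)..ρ, f s

/-- The space of pairs `(u₁, u₂) ∈ C⁴[0,1] × C¹[0,1]` with `u₁⁽ᵏ⁾(0) = 0` for `k ≤ 3` and
`u₂(0) = 0`. -/
def HTilde : Set ((ℝ → ℂ) × (ℝ → ℂ)) :=
  {u | ContDiffOn ℝ 4 u.1 I ∧ ContDiffOn ℝ 1 u.2 I ∧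
    (∀ k ≤ 3, iteratedDerivWithin k u.1 I 0 = 0) ∧ u.2 0 = 0}

/-- The inner product on `HTilde`. -/
def form (u v : (ℝ → ℂ) × (ℝ → ℂ)) : ℂ :=
  (∫ ρ in (0 : ℝ)..1, D (D u.1) ρ * conj (D (D v.1) ρ)) +
    ∫ ρ in (0 : ℝ)..1, derivWithin u.2 I ρ * conj (derivWithin v.2 I ρ)

/-- Lebesgue measure on `(0,1)`. -/
abbrev μ : Measure ℝ := volume.restrict (Ioo (0 : ℝ) 1)

/-- `L²(0,1)`. -/
abbrev L2 : Type := Lp ℂ 2 μ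

/-- The completion `𝓗` of `HTilde`. An element is stored as `(D² u₁, u₂') ∈ L²(0,1) × L²(0,1)`.
The theorems `existsUnique_funcs`, `inner_eq_form_of_mem` and `dense_HTilde` below say that this is a
Hilbert space that contains `HTilde` isometrically as a dense subspace. -/
abbrev H : Type := WithLp 2 (L2 × L2)

/-- The pair of functions `(u₁, u₂)` on `[0,1]` that an element of `𝓗` stands for:
`u₁ = K² (D² u₁)`, and `u₂` is the primitive of `u₂'` that vanishes at `0`. -/
def funcs (x : H) : (ℝ → ℂ) × (ℝ → ℂ) := (K (K x.fst), J x.snd)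

/-- Equality of pairs of functions on `[0,1]`. -/
def EqI (u v : (ℝ → ℂ) × (ℝ → ℂ)) : Prop := EqOn u.1 v.1 I ∧ EqOn u.2 v.2 I

/-! ### The free operator, the perturbation and the generator -/

/-- The domain of the operator `freeOp`, as a set of pairs of functions: pairs in
`C^∞[0,1] × C^∞[0,1]` with `u₁⁽ᵏ⁾(0) = 0` for `k ≤ 4` and `u₂(0) = 0`. -/
def smoothDomain : Set ((ℝ → ℂ) × (ℝ → ℂ)) :=
  {u | ContDiffOn ℝ ∞ u.1 I ∧ ContDiffOn ℝ ∞ u.2 I ∧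
    (∀ k ≤ 4, iteratedDerivWithin k u.1 I 0 = 0) ∧ u.2 0 = 0}

/-- The differential expression of the free operator,
`(-ρ u₁' + 2 u₁ + ρ² u₂ - 3 K u₂, D² u₁ - ρ u₂' - u₂)`. -/
def freeOp (u : (ℝ → ℂ) × (ℝ → ℂ)) : (ℝ → ℂ) × (ℝ → ℂ) :=
  (fun ρ => -(ρ : ℂ) * derivWithin u.1 I ρ + 2 * u.1 ρ + (ρ : ℂ) ^ 2 * u.2 ρ - 3 * K u.2 ρ,
   fun ρ => D (D u.1) ρ - (ρ : ℂ) * derivWithin u.2 I ρ - u.2 ρ)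

/-- The expression of the perturbation, `(-V K² u₂, 0)`. -/
def potOp (u : (ℝ → ℂ) × (ℝ → ℂ)) : (ℝ → ℂ) × (ℝ → ℂ) :=
  (fun ρ => -(V ρ : ℂ) * K (K u.2) ρ, fun _ => 0)

/-! Facts that justify the definitions. -/

theorem L2.integrableOn (f : L2) : IntegrableOn f (Ioo (0 : ℝ) 1) := by
  have := (Lp.memLp f).integrable (by norm_num)
  exact this

theorem L2.intervalIntegrable (f : L2) : IntervalIntegrable f volume 0 1 := by
  rw [intervalIntegrable_iff_integrableOn_Ioo_of_le zero_le_one]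
  exact L2.integrableOn f

theorem intervalIntegrable_sub {f : ℝ → ℂ} (hf : IntervalIntegrable f volume 0 1) {ρ : ℝ}
    (hρ : ρ ∈ I) : IntervalIntegrable f volume 0 ρ := by
  refine hf.mono_set ?_
  rw [uIcc_of_le hρ.1, uIcc_of_le zero_le_one]
  exact Icc_subset_Icc_right hρ.2

theorem intervalIntegrable_mul {f : ℝ → ℂ} (hf : IntervalIntegrable f volume 0 1) :
    IntervalIntegrable (fun s => (s : ℂ) * f s) volume 0 1 :=
  hf.continuousOn_mul (by fun_prop)

theorem continuousOn_J {f : ℝ → ℂ} (hf : IntervalIntegrable f volume 0 1) :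
    ContinuousOn (J f) I := by
  have := intervalIntegral.continuousOn_primitive_interval' hf (a := 0) left_mem_uIcc
  rwa [uIcc_of_le zero_le_one] at this

theorem continuousOn_K {f : ℝ → ℂ} (hf : IntervalIntegrable f volume 0 1) :
    ContinuousOn (K f) I := continuousOn_J (intervalIntegrable_mul hf)

theorem ContinuousOn.ii {f : ℝ → ℂ} (hf : ContinuousOn f I) : IntervalIntegrable f volume 0 1 :=
  ContinuousOn.intervalIntegrable (by rwa [uIcc_of_le zero_le_one])

@[simp] theorem J_zero (f : ℝ → ℂ) : J f 0 = 0 := by simp [J]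
@[simp] theorem K_zero (f : ℝ → ℂ) : K f 0 = 0 := by simp [K]

theorem hasDerivAt_J {f : ℝ → ℂ} (hf : ContinuousOn f I) {ρ : ℝ} (hρ : ρ ∈ Ioo (0 : ℝ) 1) :
    HasDerivAt (J f) (f ρ) ρ := by
  have hn : I ∈ nhds ρ := Icc_mem_nhds hρ.1 hρ.2
  refine intervalIntegral.integral_hasDerivAt_right
    (intervalIntegrable_sub (ContinuousOn.ii hf) ⟨hρ.1.le, hρ.2.le⟩) ?_ (hf.continuousAt hn)
  exact ⟨I, hn, hf.aestronglyMeasurable measurableSet_Icc⟩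

theorem hasDerivAt_K {f : ℝ → ℂ} (hf : ContinuousOn f I) {ρ : ℝ} (hρ : ρ ∈ Ioo (0 : ℝ) 1) :
    HasDerivAt (K f) (ρ * f ρ) ρ :=
  hasDerivAt_J (f := fun s => (s : ℂ) * f s) (by fun_prop) hρ

theorem J_congr {f g : ℝ → ℂ} (h : f =ᵐ[μ] g) : EqOn (J f) (J g) I := by
  intro ρ hρ
  have h' : ∀ᵐ x, x ∈ Ioo (0 : ℝ) 1 → f x = g x := (ae_restrict_iff' measurableSet_Ioo).1 h
  have h1 : ∀ᵐ x : ℝ, x ≠ 1 := by simp [ae_iff, measure_singleton]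
  refine intervalIntegral.integral_congr_ae ?_
  filter_upwards [h', h1] with x hx hx1 hxm
  rw [uIoc_of_le hρ.1] at hxm
  exact hx ⟨hxm.1, lt_of_le_of_ne (hxm.2.trans hρ.2) hx1⟩

theorem K_congr {f g : ℝ → ℂ} (h : f =ᵐ[μ] g) : EqOn (K f) (K g) I :=
  J_congr (by filter_upwards [h] with x hx; rw [hx])

theorem ae_of_eqOn {f g : ℝ → ℂ} (h : EqOn f g I) : f =ᵐ[μ] g := by
  filter_upwards [ae_restrict_mem measurableSet_Ioo] with x hx
  exact h ⟨hx.1.le, hx.2.le⟩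

theorem ae_of_eqOn_Ioo {f g : ℝ → ℂ} (h : EqOn f g (Ioo 0 1)) : f =ᵐ[μ] g := by
  filter_upwards [ae_restrict_mem measurableSet_Ioo] with x hx
  exact h hx

theorem KK_congr {f g : ℝ → ℂ} (h : f =ᵐ[μ] g) : EqOn (K (K f)) (K (K g)) I :=
  K_congr (ae_of_eqOn (K_congr h))

theorem J_eq_of_hasDerivAt {G w : ℝ → ℂ} (hG : ContinuousOn G I) (h0 : G 0 = 0)
    (hd : ∀ ρ ∈ Ioo (0 : ℝ) 1, HasDerivAt G (w ρ) ρ) (hw : IntervalIntegrable w volume 0 1) :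
    EqOn (J w) G I := by
  intro ρ hρ
  have := intervalIntegral.integral_eq_sub_of_hasDerivAt_of_le hρ.1
    (hG.mono (Icc_subset_Icc_right hρ.2)) (fun x hx => hd x ⟨hx.1, hx.2.trans_le hρ.2⟩)
    (intervalIntegrable_sub hw hρ)
  simpa [J, h0] using this

theorem ae_eq_of_J {f g : ℝ → ℂ} (hf : IntervalIntegrable f volume 0 1)
    (hg : IntervalIntegrable g volume 0 1) (h : EqOn (J f) (J g) I) : f =ᵐ[μ] g := by
  have hI : uIcc (0 : ℝ) 1 = Icc 0 1 := uIcc_of_le zero_le_one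
  rw [Filter.EventuallyEq, ae_restrict_iff' measurableSet_Ioo]
  filter_upwards [hf.ae_hasDerivAt_integral, hg.ae_hasDerivAt_integral] with x h1 h2 hx
  rw [hI] at h1 h2
  have hxI : x ∈ I := ⟨hx.1.le, hx.2.le⟩
  have a := h1 hxI 0 (by simp)
  have b := h2 hxI 0 (by simp)
  have hn : I ∈ nhds x := Icc_mem_nhds hx.1 hx.2
  refine a.unique (b.congr_of_eventuallyEq ?_)
  filter_upwards [hn] with y hy using h hy

theorem ae_eq_of_K {f g : ℝ → ℂ} (hf : IntervalIntegrable f volume 0 1)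
    (hg : IntervalIntegrable g volume 0 1) (h : EqOn (K f) (K g) I) : f =ᵐ[μ] g := by
  filter_upwards [ae_eq_of_J (intervalIntegrable_mul hf) (intervalIntegrable_mul hg) h,
    ae_restrict_mem measurableSet_Ioo] with x hx hm
  have : (x : ℂ) ≠ 0 := by exact_mod_cast hm.1.ne'
  exact mul_left_cancel₀ this hx

theorem eqOn_of_ae {f g : ℝ → ℂ} (hf : ContinuousOn f I) (hg : ContinuousOn g I)
    (h : f =ᵐ[μ] g) : EqOn f g I := by
  have h1 : EqOn f g (Ioo 0 1) :=
    Measure.eqOn_Ioo_of_ae_eq _ h (hf.mono Ioo_subset_Icc_self) (hg.mono Ioo_subset_Icc_self)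
  refine h1.of_subset_closure hf hg Ioo_subset_Icc_self ?_
  rw [closure_Ioo zero_ne_one]

theorem ae_eq_of_KK {f g : ℝ → ℂ} (hf : IntervalIntegrable f volume 0 1)
    (hg : IntervalIntegrable g volume 0 1) (h : EqOn (K (K f)) (K (K g)) I) : f =ᵐ[μ] g := by
  have cf := continuousOn_K hf
  have cg := continuousOn_K hg
  exact ae_eq_of_K hf hg (eqOn_of_ae cf cg
    (ae_eq_of_K (ContinuousOn.ii cf) (ContinuousOn.ii cg) h))

/-- An element of `𝓗` is determined by its functions. -/
theorem funcs_injective {x y : H} (h : EqI (funcs x) (funcs y)) : x = y := by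
  have h1 : x.fst = y.fst :=
    Lp.ext (ae_eq_of_KK (L2.intervalIntegrable _) (L2.intervalIntegrable _) h.1)
  have h2 : x.snd = y.snd :=
    Lp.ext (ae_eq_of_J (L2.intervalIntegrable _) (L2.intervalIntegrable _) h.2)
  exact WithLp.ofLp_injective 2 (Prod.ext h1 h2)

theorem exists_L2 {w : ℝ → ℂ} (hw : ContinuousOn w (Ioo 0 1)) {C : ℝ}
    (hC : ∀ ρ ∈ Ioo (0 : ℝ) 1, ‖w ρ‖ ≤ C) : ∃ y : L2, y =ᵐ[μ] w := by
  have hm : MemLp w 2 μ := by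
    refine MemLp.of_bound (hw.aestronglyMeasurable measurableSet_Ioo) C ?_
    filter_upwards [ae_restrict_mem measurableSet_Ioo] with x hx using hC x hx
  exact ⟨hm.toLp, hm.coeFn_toLp⟩

theorem exists_J {G w : ℝ → ℂ} (hG : ContinuousOn G I) (h0 : G 0 = 0)
    (hd : ∀ ρ ∈ Ioo (0 : ℝ) 1, HasDerivAt G (w ρ) ρ)
    (hw : ContinuousOn w (Ioo 0 1)) {C : ℝ} (hC : ∀ ρ ∈ Ioo (0 : ℝ) 1, ‖w ρ‖ ≤ C) :
    ∃ y : L2, EqOn (J y) G I ∧ y =ᵐ[μ] w := by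
  obtain ⟨y, hy⟩ := exists_L2 hw hC
  refine ⟨y, ?_, hy⟩
  have hi : IntervalIntegrable w volume 0 1 := by
    rw [intervalIntegrable_iff_integrableOn_Ioo_of_le zero_le_one]
    exact (L2.integrableOn y).congr hy
  exact (J_congr hy).trans (J_eq_of_hasDerivAt hG h0 hd hi)

theorem exists_KK {A G w : ℝ → ℂ} (hA : ContinuousOn A I) (hA0 : A 0 = 0)
    (hG : ContinuousOn G I) (hG0 : G 0 = 0)
    (hAd : ∀ ρ ∈ Ioo (0 : ℝ) 1, HasDerivAt A (ρ * G ρ) ρ)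
    (hGd : ∀ ρ ∈ Ioo (0 : ℝ) 1, HasDerivAt G (ρ * w ρ) ρ)
    (hw : ContinuousOn w (Ioo 0 1)) {C : ℝ} (hC : ∀ ρ ∈ Ioo (0 : ℝ) 1, ‖w ρ‖ ≤ C) :
    ∃ y : L2, EqOn (K (K y)) A I ∧ y =ᵐ[μ] w := by
  obtain ⟨y, hy⟩ := exists_L2 hw hC
  refine ⟨y, ?_, hy⟩
  have hi : IntervalIntegrable w volume 0 1 := by
    rw [intervalIntegrable_iff_integrableOn_Ioo_of_le zero_le_one]
    exact (L2.integrableOn y).congr hy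
  have e1 : EqOn (K w) G I := J_eq_of_hasDerivAt hG hG0 hGd (intervalIntegrable_mul hi)
  have e2 : EqOn (K G) A I :=
    J_eq_of_hasDerivAt hA hA0 hAd (intervalIntegrable_mul (ContinuousOn.ii hG))
  exact (KK_congr hy).trans ((K_congr (ae_of_eqOn e1)).trans e2)

theorem uniqueDiffOn_I : UniqueDiffOn ℝ I := uniqueDiffOn_Icc zero_lt_one

theorem taylor_bound (n : ℕ) {f : ℝ → ℂ} (hf : ContDiffOn ℝ (n + 1) f I)
    (h0 : ∀ k ≤ n, iteratedDerivWithin k f I 0 = 0) :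
    ∃ C : ℝ, ∀ ρ ∈ I, ‖f ρ‖ ≤ C * ρ ^ (n + 1) := by
  obtain ⟨C, hC⟩ := exists_taylor_mean_remainder_bound (n := n) zero_le_one hf
  refine ⟨C, fun ρ hρ => ?_⟩
  have : taylorWithinEval f n I 0 ρ = 0 := by
    rw [taylor_within_apply]
    refine Finset.sum_eq_zero fun k hk => ?_
    rw [h0 k (by simpa [Nat.lt_succ_iff] using hk), smul_zero]
  simpa [this] using hC ρ hρ

theorem hasDerivAt_of_contDiffOn {f : ℝ → ℂ} (hf : ContDiffOn ℝ 1 f I) {ρ : ℝ}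
    (hρ : ρ ∈ Ioo (0 : ℝ) 1) : HasDerivAt f (derivWithin f I ρ) ρ := by
  have h := (hf.differentiableOn one_ne_zero ρ ⟨hρ.1.le, hρ.2.le⟩).hasDerivWithinAt
  exact h.hasDerivAt (Icc_mem_nhds hρ.1 hρ.2)

theorem contDiffOn_derivWithin {f : ℝ → ℂ} {n : ℕ} (hf : ContDiffOn ℝ (n + 1) f I) :
    ContDiffOn ℝ n (derivWithin f I) I :=
  hf.derivWithin uniqueDiffOn_I le_rfl

/-- `D² f` in terms of `f'` and `f''`, away from `0`. -/
def E (f : ℝ → ℂ) (ρ : ℝ) : ℂ :=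
  derivWithin (derivWithin f I) I ρ / (ρ : ℂ) ^ 2 - derivWithin f I ρ / (ρ : ℂ) ^ 3

theorem hasDerivAt_ofReal (ρ : ℝ) : HasDerivAt (fun s : ℝ => (s : ℂ)) 1 ρ :=
  Complex.ofRealCLM.hasDerivAt

theorem hasDerivWithinAt_D {f : ℝ → ℂ} (hf : ContDiffOn ℝ 2 f I) {ρ : ℝ}
    (hρ : ρ ∈ Ioc (0 : ℝ) 1) : HasDerivWithinAt (D f) (ρ * E f ρ) I ρ := by
  have h0 : (ρ : ℂ) ≠ 0 := by exact_mod_cast hρ.1.ne'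
  have hf1 : ContDiffOn ℝ (1 : ℕ) (derivWithin f I) I :=
    contDiffOn_derivWithin (n := 1) (by exact_mod_cast hf)
  have h := (hf1.differentiableOn (by simp) ρ ⟨hρ.1.le, hρ.2⟩).hasDerivWithinAt
  have h2 := h.fun_div (hasDerivAt_ofReal ρ).hasDerivWithinAt h0
  refine h2.congr_deriv ?_
  rw [E]
  field_simp

theorem D_D_eq {f : ℝ → ℂ} (hf : ContDiffOn ℝ 2 f I) {ρ : ℝ} (hρ : ρ ∈ Ioc (0 : ℝ) 1) :
    D (D f) ρ = E f ρ := by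
  have h0 : (ρ : ℂ) ≠ 0 := by exact_mod_cast hρ.1.ne'
  have h := (hasDerivWithinAt_D hf hρ).derivWithin (uniqueDiffOn_I ρ ⟨hρ.1.le, hρ.2⟩)
  rw [D, h]
  field_simp

theorem continuousOn_I_of_bound {g : ℝ → ℂ} (hg : ContinuousOn g (Ioc 0 1)) (h0 : g 0 = 0)
    {C : ℝ} (hC : ∀ ρ ∈ I, ‖g ρ‖ ≤ C * ρ) : ContinuousOn g I := by
  intro ρ hρ
  rcases eq_or_lt_of_le hρ.1 with h | h
  · subst h
    rw [ContinuousWithinAt, h0]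
    refine squeeze_zero_norm' (a := fun r => C * r)
      (by filter_upwards [self_mem_nhdsWithin] with r hr using hC r hr) ?_
    have : ContinuousWithinAt (fun r : ℝ => C * r) I 0 := by fun_prop
    simpa [ContinuousWithinAt] using this
  · have h1 : ContinuousWithinAt g (Ioc 0 1) ρ := hg ρ ⟨h, hρ.2⟩
    refine h1.mono_of_mem_nhdsWithin ?_
    have : Ioi (0 : ℝ) ∈ nhds ρ := Ioi_mem_nhds h
    filter_upwards [self_mem_nhdsWithin, mem_nhdsWithin_of_mem_nhds this] with y hy hy2
    exact ⟨hy2, hy.2⟩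

theorem ofReal_ne_zero_of_mem {ρ : ℝ} (hρ : ρ ∈ Ioc (0 : ℝ) 1) : (ρ : ℂ) ≠ 0 := by
  exact_mod_cast hρ.1.ne'

theorem continuousOn_D {f : ℝ → ℂ} (hf : ContDiffOn ℝ 1 f I) : ContinuousOn (D f) (Ioc 0 1) := by
  have h1 : ContinuousOn (derivWithin f I) (Ioc 0 1) :=
    (hf.continuousOn_derivWithin uniqueDiffOn_I le_rfl).mono Ioc_subset_Icc_self
  exact h1.div (by fun_prop) fun ρ hρ => ofReal_ne_zero_of_mem hρ

theorem continuousOn_E {f : ℝ → ℂ} (hf : ContDiffOn ℝ 2 f I) : ContinuousOn (E f) (Ioc 0 1) := by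
  have hf1 : ContDiffOn ℝ (1 : ℕ) (derivWithin f I) I :=
    contDiffOn_derivWithin (n := 1) (by exact_mod_cast hf)
  have h1 : ContinuousOn (derivWithin f I) (Ioc 0 1) :=
    hf1.continuousOn.mono Ioc_subset_Icc_self
  have h2 : ContinuousOn (derivWithin (derivWithin f I) I) (Ioc 0 1) :=
    (hf1.continuousOn_derivWithin uniqueDiffOn_I (by simp)).mono Ioc_subset_Icc_self
  exact (h2.div (by fun_prop) fun ρ hρ => pow_ne_zero 2 (ofReal_ne_zero_of_mem hρ)).sub
    (h1.div (by fun_prop) fun ρ hρ => pow_ne_zero 3 (ofReal_ne_zero_of_mem hρ))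

theorem norm_div_pow_le {z : ℂ} {C ρ : ℝ} {m n : ℕ} (h : ‖z‖ ≤ C * ρ ^ (m + n))
    (hρ : 0 < ρ) : ‖z / (ρ : ℂ) ^ n‖ ≤ C * ρ ^ m := by
  rw [norm_div, norm_pow, Complex.norm_real, Real.norm_of_nonneg hρ.le,
    div_le_iff₀ (by positivity)]
  rwa [mul_assoc, ← pow_add]

theorem hasDerivAt_of_D {f : ℝ → ℂ} (hf : ContDiffOn ℝ 1 f I) {ρ : ℝ}
    (hρ : ρ ∈ Ioo (0 : ℝ) 1) : HasDerivAt f (ρ * D f ρ) ρ := by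
  have h0 : (ρ : ℂ) ≠ 0 := ofReal_ne_zero_of_mem ⟨hρ.1, hρ.2.le⟩
  refine (hasDerivAt_of_contDiffOn hf hρ).congr_deriv ?_
  rw [D]; field_simp

/-- Every pair in `HTilde` is represented by exactly one element of `𝓗`. -/
theorem existsUnique_funcs {u : (ℝ → ℂ) × (ℝ → ℂ)} (hu : u ∈ HTilde) :
    ∃! x : H, EqI (funcs x) u := by
  obtain ⟨h1, h2, h3, h4⟩ := hu
  have hd1 : ContDiffOn ℝ (3 : ℕ) (derivWithin u.1 I) I :=
    contDiffOn_derivWithin (n := 3) (by norm_cast)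
  have hd2 : ContDiffOn ℝ (2 : ℕ) (derivWithin (derivWithin u.1 I) I) I :=
    contDiffOn_derivWithin (n := 2) (by norm_cast)
  obtain ⟨C1, hC1⟩ := taylor_bound 2 (f := derivWithin u.1 I) (by norm_cast)
    (fun k hk => by rw [← iteratedDerivWithin_succ']; exact h3 _ (by omega))
  obtain ⟨C2, hC2⟩ := taylor_bound 1 (f := derivWithin (derivWithin u.1 I) I) (by norm_cast)
    (fun k hk => by
      rw [← iteratedDerivWithin_succ', ← iteratedDerivWithin_succ']; exact h3 _ (by omega))
  have hf2 : ContDiffOn ℝ 2 u.1 I := h1.of_le (by norm_cast)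
  have hf1 : ContDiffOn ℝ 1 u.1 I := h1.of_le (by norm_cast)
  have hE : ∀ ρ ∈ Ioc (0 : ℝ) 1, ‖E u.1 ρ‖ ≤ C2 + C1 := fun ρ hρ => by
    have a := norm_div_pow_le (m := 0) (n := 2) (hC2 ρ ⟨hρ.1.le, hρ.2⟩) hρ.1
    have b := norm_div_pow_le (m := 0) (n := 3) (hC1 ρ ⟨hρ.1.le, hρ.2⟩) hρ.1
    rw [pow_zero, mul_one] at a b
    exact (norm_sub_le _ _).trans (add_le_add a b)
  have hD0 : D u.1 0 = 0 := by simp [D]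
  have hC1' : 0 ≤ C1 := by simpa using (norm_nonneg _).trans (hC1 1 (by simp))
  have hDc : ContinuousOn (D u.1) I := by
    refine continuousOn_I_of_bound (continuousOn_D hf1) hD0 (C := C1) fun ρ hρ => ?_
    rcases eq_or_lt_of_le hρ.1 with h | h
    · simp [← h, hD0]
    · have a := norm_div_pow_le (m := 2) (n := 1) (hC1 ρ hρ) h
      rw [pow_one] at a
      refine a.trans (mul_le_mul_of_nonneg_left ?_ hC1')
      nlinarith [hρ.2]
  obtain ⟨y1, hy1, -⟩ := exists_KK h1.continuousOn
    (by simpa using h3 0 (by norm_num)) hDc hD0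
    (fun ρ hρ => hasDerivAt_of_D hf1 hρ)
    (fun ρ hρ => (hasDerivWithinAt_D hf2 ⟨hρ.1, hρ.2.le⟩).hasDerivAt (Icc_mem_nhds hρ.1 hρ.2))
    ((continuousOn_E hf2).mono Ioo_subset_Ioc_self) (fun ρ hρ => hE ρ ⟨hρ.1, hρ.2.le⟩)
  have hc2 := h2.continuousOn_derivWithin uniqueDiffOn_I le_rfl
  obtain ⟨C3, hC3⟩ := isCompact_Icc.exists_bound_of_continuousOn hc2
  obtain ⟨y2, hy2, -⟩ := exists_J h2.continuousOn h4
    (fun ρ hρ => hasDerivAt_of_contDiffOn h2 hρ) (hc2.mono Ioo_subset_Icc_self)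
    (fun ρ hρ => hC3 ρ ⟨hρ.1.le, hρ.2.le⟩)
  refine ⟨WithLp.toLp 2 (y1, y2), ⟨hy1, hy2⟩, fun y hy => funcs_injective ?_⟩
  exact ⟨hy.1.trans hy1.symm, hy.2.trans hy2.symm⟩

theorem derivWithin_J_ae {f : ℝ → ℂ} (hf : IntervalIntegrable f volume 0 1) :
    derivWithin (J f) I =ᵐ[μ] f := by
  have hI : uIcc (0 : ℝ) 1 = Icc 0 1 := uIcc_of_le zero_le_one
  rw [Filter.EventuallyEq, ae_restrict_iff' measurableSet_Ioo]
  filter_upwards [hf.ae_hasDerivAt_integral] with x h1 hx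
  rw [hI] at h1
  have hxI : x ∈ I := ⟨hx.1.le, hx.2.le⟩
  exact (h1 hxI 0 (by simp)).hasDerivWithinAt.derivWithin (uniqueDiffOn_I x hxI)

theorem D_K_ae {f : ℝ → ℂ} (hf : IntervalIntegrable f volume 0 1) : D (K f) =ᵐ[μ] f := by
  filter_upwards [derivWithin_J_ae (intervalIntegrable_mul hf),
    ae_restrict_mem measurableSet_Ioo] with x hx hm
  have h0 : (x : ℂ) ≠ 0 := by exact_mod_cast hm.1.ne'
  have hx' : derivWithin (K f) I x = (x : ℂ) * f x := hx
  rw [D, hx']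
  field_simp

theorem D_K_eqOn {f : ℝ → ℂ} (hf : ContinuousOn f I) : EqOn (D (K f)) f (Ioo 0 1) := by
  intro ρ hρ
  have h0 : (ρ : ℂ) ≠ 0 := by exact_mod_cast hρ.1.ne'
  rw [D, (hasDerivAt_K hf hρ).hasDerivWithinAt.derivWithin
    (uniqueDiffOn_I ρ ⟨hρ.1.le, hρ.2.le⟩)]
  field_simp

theorem D_congr_Ioo {f g : ℝ → ℂ} (h : EqOn f g (Ioo 0 1)) : EqOn (D f) (D g) (Ioo 0 1) := by
  intro ρ hρ
  have hn : Ioo (0 : ℝ) 1 ∈ nhdsWithin ρ I := mem_nhdsWithin_of_mem_nhds (Ioo_mem_nhds hρ.1 hρ.2)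
  have : f =ᶠ[nhdsWithin ρ I] g := by filter_upwards [hn] with y hy using h hy
  rw [D, D, this.derivWithin_eq (h hρ)]

theorem D_D_funcs (x : H) : D (D (funcs x).1) =ᵐ[μ] x.fst := by
  have h : EqOn (D (D (funcs x).1)) (D (K x.fst)) (Ioo 0 1) :=
    D_congr_Ioo (D_K_eqOn (continuousOn_K (L2.intervalIntegrable _)))
  exact (ae_of_eqOn_Ioo h).trans (D_K_ae (L2.intervalIntegrable _))

theorem derivWithin_funcs (x : H) : derivWithin (funcs x).2 I =ᵐ[μ] x.snd :=
  derivWithin_J_ae (L2.intervalIntegrable _)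

theorem integral_μ (f : ℝ → ℂ) : ∫ ρ, f ρ ∂μ = ∫ ρ in (0 : ℝ)..1, f ρ := by
  rw [intervalIntegral.integral_of_le zero_le_one, integral_Ioc_eq_integral_Ioo]

/-- The inner product of `𝓗` extends the inner product of `HTilde`. (Mathlib's `inner` is linear in
its second argument, the form `form` in its first.) -/
theorem inner_eq_form (x y : H) : inner ℂ y x = form (funcs x) (funcs y) := by
  have h1 : inner ℂ y.fst x.fst =
      ∫ ρ in (0 : ℝ)..1, D (D (funcs x).1) ρ * conj (D (D (funcs y).1) ρ) := by
    rw [L2.inner_def, ← integral_μ]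
    refine integral_congr_ae ?_
    filter_upwards [D_D_funcs x, D_D_funcs y] with ρ hx hy
    rw [hx, hy, RCLike.inner_apply]
  have h2 : inner ℂ y.snd x.snd =
      ∫ ρ in (0 : ℝ)..1, derivWithin (funcs x).2 I ρ * conj (derivWithin (funcs y).2 I ρ) := by
    rw [L2.inner_def, ← integral_μ]
    refine integral_congr_ae ?_
    filter_upwards [derivWithin_funcs x, derivWithin_funcs y] with ρ hx hy
    rw [hx, hy, RCLike.inner_apply]
  rw [form, ← h1, ← h2]
  rfl

theorem contDiff_J {f : ℝ → ℂ} (hf : ContDiff ℝ ∞ f) : ContDiff ℝ ∞ (J f) := by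
  have hd : ∀ x, HasDerivAt (J f) (f x) x := fun x =>
    intervalIntegral.integral_hasDerivAt_right (hf.continuous.intervalIntegrable _ _)
      hf.continuous.stronglyMeasurable.stronglyMeasurableAtFilter hf.continuous.continuousAt
  rw [contDiff_infty_iff_deriv]
  exact ⟨fun x => (hd x).differentiableAt, by rwa [show deriv (J f) = f from funext fun x => (hd x).deriv]⟩

theorem contDiff_mul {f : ℝ → ℂ} (hf : ContDiff ℝ ∞ f) :
    ContDiff ℝ ∞ (fun s : ℝ => (s : ℂ) * f s) :=
  Complex.ofRealCLM.contDiff.mul hf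

theorem derivWithin_K {f : ℝ → ℂ} (hf : ContDiff ℝ ∞ f) {x : ℝ} (hx : x ∈ I) :
    derivWithin (K f) I x = (x : ℂ) * f x := by
  have hc := (contDiff_mul hf).continuous
  have hd : HasDerivAt (K f) ((x : ℂ) * f x) x :=
    intervalIntegral.integral_hasDerivAt_right (hc.intervalIntegrable _ _)
      hc.stronglyMeasurable.stronglyMeasurableAtFilter hc.continuousAt
  exact hd.hasDerivWithinAt.derivWithin (uniqueDiffOn_I x hx)

theorem KK_J_mem {f g : ℝ → ℂ} (hf : ContDiff ℝ ∞ f) (hg : ContDiff ℝ ∞ g) :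
    (K (K f), J g) ∈ HTilde := by
  have hK : ContDiff ℝ ∞ (K f) := contDiff_J (contDiff_mul hf)
  have hKK : ContDiff ℝ ∞ (K (K f)) := contDiff_J (contDiff_mul hK)
  refine ⟨(hKK.of_le (by norm_cast)).contDiffOn,
    ((contDiff_J hg).of_le (by norm_cast)).contDiffOn, ?_, by simp⟩
  have e1 : EqOn (derivWithin (K (K f)) I) (fun x : ℝ => (x : ℂ) * K f x) I :=
    fun x hx => derivWithin_K hK hx
  have hdK : ∀ x ∈ I, HasDerivWithinAt (K f) ((x : ℂ) * f x) I x := fun x hx => by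
    have := (hK.differentiable (by simp) x).differentiableWithinAt (s := I) |>.hasDerivWithinAt
    rwa [derivWithin_K hf hx] at this
  have e2 : EqOn (derivWithin (fun x : ℝ => (x : ℂ) * K f x) I)
      (fun x : ℝ => K f x + (x : ℂ) ^ 2 * f x) I := fun x hx => by
    have := ((hasDerivAt_ofReal x).hasDerivWithinAt (s := I)).fun_mul (hdK x hx)
    rw [this.derivWithin (uniqueDiffOn_I x hx)]
    ring
  have e3 : derivWithin (fun x : ℝ => K f x + (x : ℂ) ^ 2 * f x) I 0 = 0 := by
    have h0 : (0 : ℝ) ∈ I := by simp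
    have hf0 := (hf.differentiable (by simp) 0).differentiableWithinAt (s := I) |>.hasDerivWithinAt
    have := (hdK 0 h0).fun_add ((((hasDerivAt_ofReal 0).hasDerivWithinAt (s := I)).fun_pow 2).fun_mul hf0)
    rw [this.derivWithin (uniqueDiffOn_I 0 h0)]
    simp
  have h0 : (0 : ℝ) ∈ I := by simp
  intro k hk
  interval_cases k
  · simp
  · rw [iteratedDerivWithin_one, e1 h0]; simp
  · rw [iteratedDerivWithin_succ', iteratedDerivWithin_one, derivWithin_congr e1 (e1 h0), e2 h0]
    simp
  · rw [iteratedDerivWithin_succ', iteratedDerivWithin_succ', iteratedDerivWithin_one]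
    have e12 : EqOn (derivWithin (derivWithin (K (K f)) I) I)
        (fun x : ℝ => K f x + (x : ℂ) ^ 2 * f x) I := fun x hx => by
      rw [derivWithin_congr e1 (e1 hx), e2 hx]
    rw [derivWithin_congr e12 (e12 h0), e3]

theorem mem_HTilde_congr {u v : (ℝ → ℂ) × (ℝ → ℂ)} (h : EqI u v) (hv : v ∈ HTilde) :
    u ∈ HTilde :=
  ⟨hv.1.congr h.1, hv.2.1.congr h.2, fun k hk => by
    rw [iteratedDerivWithin_congr h.1 (by simp), hv.2.2.1 k hk], by
    rw [h.2 (by simp), hv.2.2.2]⟩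

/-- `HTilde` is dense in `𝓗`. -/
theorem dense_HTilde : Dense {x : H | funcs x ∈ HTilde} := by
  have hd := Lp.dense_hasCompactSupport_contDiff (E := ℝ) (F := ℂ) (μ := μ) (p := 2)
    (by norm_num)
  have hp := (hd.prod hd).preimage
    (WithLp.homeomorphProd 2 L2 L2).isOpenMap
  refine hp.mono ?_
  rintro x ⟨⟨f, hf, -, hf2⟩, ⟨g, hg, -, hg2⟩⟩
  have hf' : x.fst =ᵐ[μ] f := hf
  have hg' : x.snd =ᵐ[μ] g := hg
  exact mem_HTilde_congr (u := funcs x) (v := (K (K f), J g)) ⟨KK_congr hf', J_congr hg'⟩ (KK_J_mem hf2 hg2)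

/-! Linearity. -/

theorem EqI.refl (u : (ℝ → ℂ) × (ℝ → ℂ)) : EqI u u := ⟨fun _ _ => rfl, fun _ _ => rfl⟩

theorem EqI.symm {u v : (ℝ → ℂ) × (ℝ → ℂ)} (h : EqI u v) : EqI v u := ⟨h.1.symm, h.2.symm⟩

theorem EqI.trans {u v w : (ℝ → ℂ) × (ℝ → ℂ)} (h : EqI u v) (h' : EqI v w) : EqI u w :=
  ⟨h.1.trans h'.1, h.2.trans h'.2⟩

theorem EqI.add {u v u' v' : (ℝ → ℂ) × (ℝ → ℂ)} (h : EqI u v) (h' : EqI u' v') :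
    EqI (u + u') (v + v') :=
  ⟨fun _ hρ => congrArg₂ (· + ·) (h.1 hρ) (h'.1 hρ),
    fun _ hρ => congrArg₂ (· + ·) (h.2 hρ) (h'.2 hρ)⟩

theorem EqI.smul (c : ℂ) {u v : (ℝ → ℂ) × (ℝ → ℂ)} (h : EqI u v) : EqI (c • u) (c • v) :=
  ⟨fun _ hρ => congrArg (c • ·) (h.1 hρ), fun _ hρ => congrArg (c • ·) (h.2 hρ)⟩

theorem J_add {f g : ℝ → ℂ} (hf : IntervalIntegrable f volume 0 1)
    (hg : IntervalIntegrable g volume 0 1) : EqOn (J (f + g)) (J f + J g) I := fun _ hρ =>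
  intervalIntegral.integral_add (intervalIntegrable_sub hf hρ) (intervalIntegrable_sub hg hρ)

theorem J_smul (c : ℂ) (f : ℝ → ℂ) : J (c • f) = c • J f := by
  funext ρ; exact intervalIntegral.integral_smul c f

theorem K_add {f g : ℝ → ℂ} (hf : IntervalIntegrable f volume 0 1)
    (hg : IntervalIntegrable g volume 0 1) : EqOn (K (f + g)) (K f + K g) I := by
  intro ρ hρ
  have := J_add (intervalIntegrable_mul hf) (intervalIntegrable_mul hg) hρ
  refine Eq.trans ?_ this
  simp [K, J, mul_add]

theorem K_smul (c : ℂ) (f : ℝ → ℂ) : K (c • f) = c • K f := by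
  funext ρ
  have := congrFun (J_smul c (fun s => (s : ℂ) * f s)) ρ
  refine Eq.trans ?_ this
  simp [K, J, mul_left_comm]

theorem KK_add {f g : ℝ → ℂ} (hf : IntervalIntegrable f volume 0 1)
    (hg : IntervalIntegrable g volume 0 1) : EqOn (K (K (f + g))) (K (K f) + K (K g)) I :=
  (K_congr (ae_of_eqOn (K_add hf hg))).trans
    (K_add (ContinuousOn.ii (continuousOn_K hf)) (ContinuousOn.ii (continuousOn_K hg)))

theorem funcs_add (x y : H) : EqI (funcs (x + y)) (funcs x + funcs y) :=
  ⟨(KK_congr (Lp.coeFn_add x.fst y.fst)).trans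
      (KK_add (L2.intervalIntegrable _) (L2.intervalIntegrable _)),
    (J_congr (Lp.coeFn_add x.snd y.snd)).trans
      (J_add (L2.intervalIntegrable _) (L2.intervalIntegrable _))⟩

theorem funcs_smul (c : ℂ) (x : H) : EqI (funcs (c • x)) (c • funcs x) := by
  refine ⟨(KK_congr (Lp.coeFn_smul c x.fst)).trans ?_,
    (J_congr (Lp.coeFn_smul c x.snd)).trans ?_⟩
  · rw [K_smul, K_smul]; exact fun _ _ => rfl
  · rw [J_smul]; exact fun _ _ => rfl

theorem funcs_zero : EqI (funcs 0) 0 := by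
  have := funcs_smul 0 0
  rwa [zero_smul, zero_smul] at this

theorem smoothDomain_congr {u v : (ℝ → ℂ) × (ℝ → ℂ)} (h : EqI u v) (hv : v ∈ smoothDomain) :
    u ∈ smoothDomain :=
  ⟨hv.1.congr h.1, hv.2.1.congr h.2, fun k hk => by
    rw [iteratedDerivWithin_congr h.1 (by simp), hv.2.2.1 k hk], by
    rw [h.2 (by simp), hv.2.2.2]⟩

theorem smoothDomain_add {u v : (ℝ → ℂ) × (ℝ → ℂ)} (hu : u ∈ smoothDomain)
    (hv : v ∈ smoothDomain) : u + v ∈ smoothDomain := by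
  have h0 : (0 : ℝ) ∈ I := by simp
  refine ⟨hu.1.add hv.1, hu.2.1.add hv.2.1, fun k hk => ?_, ?_⟩
  · have a : ContDiffWithinAt ℝ k u.1 I 0 := (hu.1 0 h0).of_le (by norm_cast; exact le_top)
    have b : ContDiffWithinAt ℝ k v.1 I 0 := (hv.1 0 h0).of_le (by norm_cast; exact le_top)
    have := iteratedDerivWithin_add h0 uniqueDiffOn_I a b
    rw [hu.2.2.1 k hk, hv.2.2.1 k hk, add_zero] at this
    exact this
  · change u.2 0 + v.2 0 = 0
    rw [hu.2.2.2, hv.2.2.2, add_zero]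

theorem smoothDomain_smul (c : ℂ) {u : (ℝ → ℂ) × (ℝ → ℂ)} (hu : u ∈ smoothDomain) :
    c • u ∈ smoothDomain := by
  have h0 : (0 : ℝ) ∈ I := by simp
  refine ⟨hu.1.const_smul c, hu.2.1.const_smul c, fun k hk => ?_, ?_⟩
  · have a : ContDiffWithinAt ℝ k u.1 I 0 := (hu.1 0 h0).of_le (by norm_cast; exact le_top)
    have := iteratedDerivWithin_const_smul h0 uniqueDiffOn_I c a
    rw [hu.2.2.1 k hk, smul_zero] at this
    exact this
  · change c • u.2 0 = 0
    rw [hu.2.2.2, smul_zero]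

theorem zero_mem_smoothDomain : (0 : (ℝ → ℂ) × (ℝ → ℂ)) ∈ smoothDomain := by
  refine ⟨contDiffOn_const, contDiffOn_const, fun k _ => ?_, rfl⟩
  change iteratedDerivWithin k (fun _ : ℝ => (0 : ℂ)) I 0 = 0
  simp

theorem D_congr {f g : ℝ → ℂ} (h : EqOn f g I) : EqOn (D f) (D g) I := by
  intro ρ hρ
  rw [D, D, derivWithin_congr h (h hρ)]

theorem form_congr {u u' v v' : (ℝ → ℂ) × (ℝ → ℂ)} (h : EqI u u') (h' : EqI v v') :
    form u v = form u' v' := by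
  have e : uIcc (0 : ℝ) 1 = I := uIcc_of_le zero_le_one
  unfold form
  congr 1
  · refine intervalIntegral.integral_congr fun ρ hρ => ?_
    rw [e] at hρ
    simp only [D_congr (D_congr h.1) hρ, D_congr (D_congr h'.1) hρ]
  · refine intervalIntegral.integral_congr fun ρ hρ => ?_
    rw [e] at hρ
    simp only [derivWithin_congr h.2 (h.2 hρ), derivWithin_congr h'.2 (h'.2 hρ)]

/-- The embedding of `HTilde` into `𝓗` preserves the inner product. -/
theorem inner_eq_form_of_mem {x y : H} {u v : (ℝ → ℂ) × (ℝ → ℂ)} (hx : EqI (funcs x) u)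
    (hy : EqI (funcs y) v) : inner ℂ y x = form u v :=
  (inner_eq_form x y).trans (form_congr hx hy)

theorem freeOp_congr {u v : (ℝ → ℂ) × (ℝ → ℂ)} (h : EqI u v) : EqI (freeOp u) (freeOp v) := by
  refine ⟨fun ρ hρ => ?_, fun ρ hρ => ?_⟩
  · simp only [freeOp]
    rw [derivWithin_congr h.1 (h.1 hρ), h.1 hρ, h.2 hρ, K_congr (ae_of_eqOn h.2) hρ]
  · simp only [freeOp]
    rw [D_congr (D_congr h.1) hρ, derivWithin_congr h.2 (h.2 hρ), h.2 hρ]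

theorem D_D_zero (f : ℝ → ℂ) : D (D f) 0 = 0 := by simp [D]

theorem E_add {f g : ℝ → ℂ} (hf : ContDiffOn ℝ 2 f I) (hg : ContDiffOn ℝ 2 g I) {ρ : ℝ}
    (hρ : ρ ∈ I) : E (f + g) ρ = E f ρ + E g ρ := by
  have a : ∀ h : ℝ → ℂ, ContDiffOn ℝ 2 h I → ContDiffOn ℝ (1 : ℕ) (derivWithin h I) I :=
    fun h hh => contDiffOn_derivWithin (n := 1) (by exact_mod_cast hh)
  have e : EqOn (derivWithin (f + g) I) (derivWithin f I + derivWithin g I) I := fun x hx =>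
    derivWithin_add (hf.differentiableOn two_ne_zero x hx) (hg.differentiableOn two_ne_zero x hx)
  have e2 : derivWithin (derivWithin f I + derivWithin g I) I ρ =
      derivWithin (derivWithin f I) I ρ + derivWithin (derivWithin g I) I ρ :=
    derivWithin_add ((a f hf).differentiableOn (by simp) ρ hρ)
      ((a g hg).differentiableOn (by simp) ρ hρ)
  rw [E, derivWithin_congr e (e hρ), e hρ, e2, E, E, Pi.add_apply]
  ring

theorem E_smul (c : ℂ) (f : ℝ → ℂ) (ρ : ℝ) : E (c • f) ρ = c * E f ρ := by
  have e : ∀ h : ℝ → ℂ, derivWithin (c • h) I = c • derivWithin h I := fun h => by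
    funext x; exact derivWithin_const_smul_field c h
  rw [E, e, e, E, Pi.smul_apply, Pi.smul_apply, smul_eq_mul, smul_eq_mul]
  ring

theorem smooth_two {f : ℝ → ℂ} (hf : ContDiffOn ℝ ∞ f I) : ContDiffOn ℝ 2 f I :=
  hf.of_le (by norm_cast)

theorem smooth_one {f : ℝ → ℂ} (hf : ContDiffOn ℝ ∞ f I) : ContDiffOn ℝ 1 f I :=
  hf.of_le (by norm_cast)

theorem D_D_add {f g : ℝ → ℂ} (hf : ContDiffOn ℝ 2 f I) (hg : ContDiffOn ℝ 2 g I) {ρ : ℝ}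
    (hρ : ρ ∈ I) : D (D (f + g)) ρ = D (D f) ρ + D (D g) ρ := by
  rcases eq_or_lt_of_le hρ.1 with h | h
  · subst h; simp only [D_D_zero, add_zero]
  · have h' : ρ ∈ Ioc (0 : ℝ) 1 := ⟨h, hρ.2⟩
    have hs : ContDiffOn ℝ 2 (f + g) I := hf.add hg
    rw [D_D_eq hs h', D_D_eq hf h', D_D_eq hg h', E_add hf hg hρ]

theorem D_D_smul (c : ℂ) {f : ℝ → ℂ} (hf : ContDiffOn ℝ 2 f I) {ρ : ℝ}
    (hρ : ρ ∈ I) : D (D (c • f)) ρ = c * D (D f) ρ := by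
  rcases eq_or_lt_of_le hρ.1 with h | h
  · subst h; simp only [D_D_zero, mul_zero]
  · have h' : ρ ∈ Ioc (0 : ℝ) 1 := ⟨h, hρ.2⟩
    have hs : ContDiffOn ℝ 2 (c • f) I := hf.const_smul c
    rw [D_D_eq hs h', D_D_eq hf h', E_smul]

theorem freeOp_add {u v : (ℝ → ℂ) × (ℝ → ℂ)} (hu : u ∈ smoothDomain) (hv : v ∈ smoothDomain) :
    EqI (freeOp (u + v)) (freeOp u + freeOp v) := by
  have hd : ∀ {f g : ℝ → ℂ}, ContDiffOn ℝ ∞ f I → ContDiffOn ℝ ∞ g I → ∀ ρ ∈ I,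
      derivWithin (f + g) I ρ = derivWithin f I ρ + derivWithin g I ρ := fun hf hg ρ hρ =>
    derivWithin_add (hf.differentiableOn (by simp) ρ hρ) (hg.differentiableOn (by simp) ρ hρ)
  refine ⟨fun ρ hρ => ?_, fun ρ hρ => ?_⟩
  · simp only [freeOp, Prod.fst_add, Prod.snd_add, Pi.add_apply]
    rw [hd hu.1 hv.1 ρ hρ, K_add (ContinuousOn.ii hu.2.1.continuousOn)
      (ContinuousOn.ii hv.2.1.continuousOn) hρ, Pi.add_apply]
    ring
  · simp only [freeOp, Prod.fst_add, Prod.snd_add, Pi.add_apply]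
    rw [hd hu.2.1 hv.2.1 ρ hρ, D_D_add (smooth_two hu.1) (smooth_two hv.1) hρ]
    ring

theorem freeOp_smul (c : ℂ) {u : (ℝ → ℂ) × (ℝ → ℂ)} (hu : u ∈ smoothDomain) :
    EqI (freeOp (c • u)) (c • freeOp u) := by
  have e : ∀ h : ℝ → ℂ, derivWithin (c • h) I = c • derivWithin h I := fun h => by
    funext x; exact derivWithin_const_smul_field c h
  refine ⟨fun ρ hρ => ?_, fun ρ hρ => ?_⟩
  · simp only [freeOp, Prod.smul_fst, Prod.smul_snd, Pi.smul_apply, smul_eq_mul, e, K_smul]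
    ring
  · simp only [freeOp, Prod.smul_fst, Prod.smul_snd, Pi.smul_apply, smul_eq_mul, e]
    rw [D_D_smul c (smooth_two hu.1) hρ]
    ring

/-- The free operator maps its smooth domain into `𝓗`. -/
theorem exists_freeOp {u : (ℝ → ℂ) × (ℝ → ℂ)} (hu : u ∈ smoothDomain) :
    ∃ y : H, EqI (funcs y) (freeOp u) := by
  obtain ⟨h1, h2, h3, h4⟩ := hu
  set a1 := derivWithin u.1 I with ha1
  set a2 := derivWithin a1 I with ha2
  set a3 := derivWithin a2 I with ha3
  set b1 := derivWithin u.2 I with hb1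
  set b2 := derivWithin b1 I with hb2
  have sa1 : ContDiffOn ℝ ∞ a1 I := h1.derivWithin uniqueDiffOn_I (by simp)
  have sa2 : ContDiffOn ℝ ∞ a2 I := sa1.derivWithin uniqueDiffOn_I (by simp)
  have sa3 : ContDiffOn ℝ ∞ a3 I := sa2.derivWithin uniqueDiffOn_I (by simp)
  have sb1 : ContDiffOn ℝ ∞ b1 I := h2.derivWithin uniqueDiffOn_I (by simp)
  have sb2 : ContDiffOn ℝ ∞ b2 I := sb1.derivWithin uniqueDiffOn_I (by simp)
  have of_smooth : ∀ (n : ℕ) {f : ℝ → ℂ}, ContDiffOn ℝ ∞ f I → ContDiffOn ℝ (n + 1) f I :=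
    fun n f hf => hf.of_le (by norm_cast; exact le_top)
  obtain ⟨C1, hC1⟩ := taylor_bound 3 (of_smooth 3 sa1)
    (fun k hk => by rw [ha1, ← iteratedDerivWithin_succ']; exact h3 _ (by omega))
  obtain ⟨C2, hC2⟩ := taylor_bound 2 (of_smooth 2 sa2)
    (fun k hk => by
      rw [ha2, ha1, ← iteratedDerivWithin_succ', ← iteratedDerivWithin_succ']
      exact h3 _ (by omega))
  obtain ⟨C3, hC3⟩ := taylor_bound 1 (of_smooth 1 sa3)
    (fun k hk => by
      rw [ha3, ha2, ha1, ← iteratedDerivWithin_succ', ← iteratedDerivWithin_succ',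
        ← iteratedDerivWithin_succ']
      exact h3 _ (by omega))
  obtain ⟨B1, hB1⟩ := isCompact_Icc.exists_bound_of_continuousOn sb1.continuousOn
  obtain ⟨B2, hB2⟩ := isCompact_Icc.exists_bound_of_continuousOn sb2.continuousOn
  have mI : ∀ {ρ : ℝ}, ρ ∈ Ioo (0 : ℝ) 1 → ρ ∈ I := fun h => ⟨h.1.le, h.2.le⟩
  have mC : ∀ {ρ : ℝ}, ρ ∈ Ioo (0 : ℝ) 1 → ρ ∈ Ioc (0 : ℝ) 1 := fun h => ⟨h.1, h.2.le⟩
  have hd : ∀ {f : ℝ → ℂ}, ContDiffOn ℝ ∞ f I → ∀ {ρ : ℝ}, ρ ∈ Ioo (0 : ℝ) 1 →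
      HasDerivAt f (derivWithin f I ρ) ρ := fun hf ρ hρ =>
    hasDerivAt_of_contDiffOn (smooth_one hf) hρ
  -- the function `q = D² u₁` and its derivative
  set q := D (D u.1) with hq
  have q0 : q 0 = 0 := D_D_zero _
  have qE : ∀ {ρ : ℝ}, ρ ∈ Ioc (0 : ℝ) 1 → q ρ = a2 ρ / (ρ : ℂ) ^ 2 - a1 ρ / (ρ : ℂ) ^ 3 :=
    fun hρ => D_D_eq (smooth_two h1) hρ
  have qb : ∀ ρ ∈ I, ‖q ρ‖ ≤ (C2 + C1) * ρ := fun ρ hρ => by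
    rcases eq_or_lt_of_le hρ.1 with h | h
    · simp [← h, q0]
    · rw [qE ⟨h, hρ.2⟩]
      have a := norm_div_pow_le (m := 1) (n := 2) (hC2 ρ hρ) h
      have b := norm_div_pow_le (m := 1) (n := 3) (hC1 ρ hρ) h
      rw [pow_one] at a b
      exact (norm_sub_le _ _).trans (by linarith)
  have qcC : ContinuousOn q (Ioc 0 1) :=
    (continuousOn_E (smooth_two h1)).congr fun ρ hρ => D_D_eq (smooth_two h1) hρ
  have qc : ContinuousOn q I := continuousOn_I_of_bound qcC q0 qb
  set p : ℝ → ℂ := fun ρ =>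
    a3 ρ / (ρ : ℂ) ^ 2 - (2 * (a2 ρ / (ρ : ℂ) ^ 3) + a2 ρ / (ρ : ℂ) ^ 3)
      + 3 * (a1 ρ / (ρ : ℂ) ^ 4) with hp
  have qd : ∀ {ρ : ℝ}, ρ ∈ Ioo (0 : ℝ) 1 → HasDerivAt q (p ρ) ρ := fun {ρ} hρ => by
    have hne : (ρ : ℂ) ≠ 0 := ofReal_ne_zero_of_mem (mC hρ)
    have k1 := (hd sa2 hρ).fun_div ((hasDerivAt_ofReal ρ).fun_pow 2) (pow_ne_zero 2 hne)
    have k2 := (hd sa1 hρ).fun_div ((hasDerivAt_ofReal ρ).fun_pow 3) (pow_ne_zero 3 hne)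
    have k3 := k1.fun_sub k2
    have hn : Ioo (0 : ℝ) 1 ∈ nhds ρ := Ioo_mem_nhds hρ.1 hρ.2
    refine (k3.congr_of_eventuallyEq (f₁ := q) ?_).congr_deriv ?_
    · filter_upwards [hn] with y hy using qE (mC hy)
    · simp only [hp]
      rw [← ha2, ← ha3]
      field_simp
      push_cast
      ring
  have pb : ∀ ρ ∈ Ioo (0 : ℝ) 1, ‖p ρ‖ ≤ C3 + (2 * C2 + C2) + 3 * C1 := fun ρ hρ => by
    have a := norm_div_pow_le (m := 0) (n := 2) (hC3 ρ (mI hρ)) hρ.1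
    have b := norm_div_pow_le (m := 0) (n := 3) (hC2 ρ (mI hρ)) hρ.1
    have c := norm_div_pow_le (m := 0) (n := 4) (hC1 ρ (mI hρ)) hρ.1
    rw [pow_zero, mul_one] at a b c
    refine (norm_add_le _ _).trans (add_le_add ((norm_sub_le _ _).trans (add_le_add a
      ((norm_add_le _ _).trans (add_le_add ?_ b)))) ?_)
    · rw [norm_mul]; simpa using b
    · rw [norm_mul]; simpa using c
  have pc : ContinuousOn p (Ioo 0 1) := by
    have r : ∀ n : ℕ, ∀ f : ℝ → ℂ, ContDiffOn ℝ ∞ f I →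
        ContinuousOn (fun ρ : ℝ => f ρ / (ρ : ℂ) ^ n) (Ioo 0 1) := fun n f hf =>
      (hf.continuousOn.mono Ioo_subset_Icc_self).div (by fun_prop)
        fun ρ hρ => pow_ne_zero n (ofReal_ne_zero_of_mem (mC hρ))
    have r1 := r 2 a3 sa3
    have r2 := r 3 a2 sa2
    have r3 := r 4 a1 sa1
    simp only [hp]
    fun_prop
  have cu1 := h1.continuousOn
  have cu2 := h2.continuousOn
  have ca1 := sa1.continuousOn
  have cb1 := sb1.continuousOn
  have cb2 := sb2.continuousOn
  have cK := continuousOn_K (ContinuousOn.ii cu2)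
  have sub : Ioo (0 : ℝ) 1 ⊆ I := Ioo_subset_Icc_self
  have nle : ∀ {ρ : ℝ} (z : ℂ), ρ ∈ Ioo (0 : ℝ) 1 → ‖(ρ : ℂ) * z‖ ≤ ‖z‖ := fun {ρ} z hρ => by
    rw [norm_mul, Complex.norm_real, Real.norm_of_nonneg hρ.1.le]
    exact mul_le_of_le_one_left (norm_nonneg _) hρ.2.le
  have qb' : ∀ ρ ∈ Ioo (0 : ℝ) 1, ‖q ρ‖ ≤ |C2 + C1| := fun ρ hρ => by
    refine (qb ρ (mI hρ)).trans ((le_abs_self _).trans ?_)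
    rw [abs_mul, abs_of_pos hρ.1]
    exact mul_le_of_le_one_right (abs_nonneg _) hρ.2.le
  have u1z : u.1 0 = 0 := by simpa using h3 0 (by norm_num)
  have cbb : ContinuousOn b2 (Ioo 0 1) := cb2.mono sub
  have cbb1 : ContinuousOn b1 (Ioo 0 1) := cb1.mono sub
  have cqq : ContinuousOn q (Ioo 0 1) := qc.mono sub
  obtain ⟨y1, hy1, -⟩ := exists_KK (A := (freeOp u).1)
    (G := fun ρ => -(ρ : ℂ) ^ 2 * q ρ + ρ * b1 ρ - u.2 ρ)
    (w := fun ρ => -((ρ : ℂ) * p ρ) - 2 * q ρ + b2 ρ)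
    (C := C3 + (2 * C2 + C2) + 3 * C1 + 2 * |C2 + C1| + B2)
    (by simp only [freeOp, ← ha1]; fun_prop) (by simp [freeOp, u1z, h4])
    (by fun_prop) (by simp [h4])
    (fun ρ hρ => by
      have hne : (ρ : ℂ) ≠ 0 := ofReal_ne_zero_of_mem (mC hρ)
      have id := hasDerivAt_ofReal ρ
      have k := (((id.fun_neg.fun_mul (hd sa1 hρ)).fun_add ((hd h1 hρ).const_mul 2)).fun_add
        ((id.fun_pow 2).fun_mul (hd h2 hρ))).fun_sub ((hasDerivAt_K cu2 hρ).const_mul 3)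
      refine k.congr_deriv ?_
      simp only [← ha1, ← ha2, ← hb1]
      rw [qE (mC hρ)]
      field_simp
      push_cast
      ring)
    (fun ρ hρ => by
      have id := hasDerivAt_ofReal ρ
      have k := (((id.fun_pow 2).fun_neg.fun_mul (qd hρ)).fun_add
        (id.fun_mul (hd sb1 hρ))).fun_sub (hd h2 hρ)
      refine k.congr_deriv ?_
      simp only [← hb1, ← hb2]
      push_cast
      ring)
    (by fun_prop)
    (fun ρ hρ => by
      refine (norm_add_le _ _).trans (add_le_add ((norm_sub_le _ _).trans
        (add_le_add ?_ ?_)) (hB2 ρ (mI hρ)))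
      · rw [norm_neg]; exact (nle _ hρ).trans (pb ρ hρ)
      · rw [norm_mul]; simpa using qb' ρ hρ)
  obtain ⟨y2, hy2, -⟩ := exists_J (G := (freeOp u).2)
    (w := fun ρ => p ρ - ρ * b2 ρ - 2 * b1 ρ)
    (C := C3 + (2 * C2 + C2) + 3 * C1 + B2 + 2 * B1)
    (by simp only [freeOp, ← hq, ← hb1]; fun_prop) (by simp [freeOp, D_D_zero, h4])
    (fun ρ hρ => by
      have id := hasDerivAt_ofReal ρ
      have k := ((qd hρ).fun_sub (id.fun_mul (hd sb1 hρ))).fun_sub (hd h2 hρ)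
      refine k.congr_deriv ?_
      simp only [← hb1, ← hb2]
      ring)
    (by fun_prop)
    (fun ρ hρ => by
      refine (norm_sub_le _ _).trans (add_le_add ((norm_sub_le _ _).trans
        (add_le_add (pb ρ hρ) ((nle _ hρ).trans (hB2 ρ (mI hρ))))) ?_)
      rw [norm_mul]; simpa using hB1 ρ (mI hρ))
  exact ⟨WithLp.toLp 2 (y1, y2), hy1, hy2⟩

/-- The perturbation maps `𝓗` into `𝓗`. -/
theorem exists_potOp (x : H) : ∃ y : H, EqI (funcs y) (potOp (funcs x)) := by
  set g := (funcs x).2 with hg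
  have cg : ContinuousOn g I := continuousOn_J (L2.intervalIntegrable _)
  have c1 := continuousOn_K (ContinuousOn.ii cg)
  have c2 := continuousOn_K (ContinuousOn.ii c1)
  set d : ℝ → ℂ := fun ρ => 5 + 3 * (ρ : ℂ) ^ 2 with hd
  have d0 : ∀ ρ : ℝ, d ρ ≠ 0 := fun ρ => by
    have : (5 + 3 * ρ ^ 2 : ℝ) ≠ 0 := by positivity
    have e : d ρ = ((5 + 3 * ρ ^ 2 : ℝ) : ℂ) := by simp [hd]
    rw [e]; exact_mod_cast this
  have d' : ∀ ρ : ℝ, HasDerivAt d (6 * ρ) ρ := fun ρ => by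
    have := (((hasDerivAt_ofReal ρ).fun_pow 2).const_mul 3).const_add 5
    refine this.congr_deriv ?_
    push_cast; ring
  set V0 : ℝ → ℂ := fun ρ => -144 * (5 - (ρ : ℂ) ^ 2) / d ρ ^ 2 with hV0
  set V1 : ℝ → ℂ := fun ρ => 288 * (35 - 3 * (ρ : ℂ) ^ 2) / d ρ ^ 3 with hV1
  set V2 : ℝ → ℂ := fun ρ => 576 * (18 * (ρ : ℂ) ^ 2 - 330) / d ρ ^ 4 with hV2
  have hV : ∀ ρ : ℝ, (V ρ : ℂ) = V0 ρ := fun ρ => by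
    simp only [V, hV0, hd]; push_cast; ring
  have dV0 : ∀ ρ : ℝ, HasDerivAt V0 (ρ * V1 ρ) ρ := fun ρ => by
    have k := ((((hasDerivAt_ofReal ρ).fun_pow 2).const_sub 5).const_mul (-144)).fun_div
      ((d' ρ).fun_pow 2) (pow_ne_zero 2 (d0 ρ))
    refine k.congr_deriv ?_
    have := d0 ρ
    simp only [hV1]
    field_simp
    simp only [hd]
    push_cast; ring
  have dV1 : ∀ ρ : ℝ, HasDerivAt V1 (ρ * V2 ρ) ρ := fun ρ => by
    have k := (((((hasDerivAt_ofReal ρ).fun_pow 2).const_mul 3).const_sub 35).const_mul 288).fun_div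
      ((d' ρ).fun_pow 3) (pow_ne_zero 3 (d0 ρ))
    refine k.congr_deriv ?_
    have := d0 ρ
    simp only [hV2]
    field_simp
    simp only [hd]
    push_cast; ring
  have dc : Continuous d := by simp only [hd]; fun_prop
  have e0 : Continuous V0 := continuous_iff_continuousAt.2 fun ρ => (dV0 ρ).continuousAt
  have e1 : Continuous V1 := continuous_iff_continuousAt.2 fun ρ => (dV1 ρ).continuousAt
  have e2 : Continuous V2 := by
    simp only [hV2]
    exact Continuous.div (by fun_prop) (by fun_prop) fun ρ => pow_ne_zero 4 (d0 ρ)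
  have cw : ContinuousOn (fun ρ => -(V2 ρ * K (K g) ρ + 2 * (V1 ρ * K g ρ) + V0 ρ * g ρ)) I := by
    fun_prop
  obtain ⟨C, hC⟩ := isCompact_Icc.exists_bound_of_continuousOn cw
  obtain ⟨y1, hy1, -⟩ := exists_KK (A := fun ρ => -V0 ρ * K (K g) ρ)
    (G := fun ρ => -(V1 ρ * K (K g) ρ + V0 ρ * K g ρ))
    (by fun_prop) (by simp) (by fun_prop) (by simp)
    (fun ρ hρ => by
      refine ((dV0 ρ).fun_neg.fun_mul (hasDerivAt_K c1 hρ)).congr_deriv ?_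
      ring)
    (fun ρ hρ => by
      refine (((dV1 ρ).fun_mul (hasDerivAt_K c1 hρ)).fun_add
        ((dV0 ρ).fun_mul (hasDerivAt_K cg hρ))).fun_neg.congr_deriv (g' := ρ * (fun ρ : ℝ =>
          -(V2 ρ * K (K g) ρ + 2 * (V1 ρ * K g ρ) + V0 ρ * g ρ)) ρ) ?_
      ring)
    (cw.mono Ioo_subset_Icc_self) (fun ρ hρ => hC ρ ⟨hρ.1.le, hρ.2.le⟩)
  refine ⟨WithLp.toLp 2 (y1, 0), fun ρ hρ => ?_, ?_⟩
  · refine (hy1 hρ).trans ?_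
    simp only [potOp, hV, hg]
  · exact funcs_zero.2

theorem potOp_congr {u v : (ℝ → ℂ) × (ℝ → ℂ)} (h : EqI u v) : EqI (potOp u) (potOp v) :=
  ⟨fun ρ hρ => by simp only [potOp]; rw [KK_congr (ae_of_eqOn h.2) hρ], fun _ _ => rfl⟩

theorem potOp_add (x y : H) :
    EqI (potOp (funcs x + funcs y)) (potOp (funcs x) + potOp (funcs y)) := by
  refine ⟨fun ρ hρ => ?_, fun _ _ => by simp [potOp]⟩
  have c : ∀ z : H, IntervalIntegrable (funcs z).2 volume 0 1 := fun z =>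
    ContinuousOn.ii (continuousOn_J (L2.intervalIntegrable z.snd))
  simp only [potOp, Prod.snd_add, Prod.fst_add, Pi.add_apply]
  rw [KK_add (c x) (c y) hρ, Pi.add_apply]
  ring

theorem potOp_smul (c : ℂ) (x : H) : EqI (potOp (c • funcs x)) (c • potOp (funcs x)) := by
  refine ⟨fun ρ _ => ?_, fun _ _ => by simp [potOp]⟩
  simp only [potOp, Prod.smul_snd, Prod.smul_fst, Pi.smul_apply, K_smul, smul_eq_mul]
  ring

/-! The operators. -/

/-- The free operator on its smooth domain, as a densely defined operator on `𝓗`; it is pinned down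
by `freeTilde_spec`. -/
def freeTilde : H →ₗ.[ℂ] H where
  domain :=
    { carrier := {x | funcs x ∈ smoothDomain}
      add_mem' := fun {x y} hx hy =>
        smoothDomain_congr (funcs_add x y) (smoothDomain_add hx hy)
      zero_mem' := smoothDomain_congr funcs_zero zero_mem_smoothDomain
      smul_mem' := fun c x hx => smoothDomain_congr (funcs_smul c x) (smoothDomain_smul c hx) }
  toFun :=
    { toFun := fun x => (exists_freeOp (u := funcs x) x.2).choose
      map_add' := fun x y => funcs_injective <| by
        refine (exists_freeOp (u := funcs (x + y : H)) (x + y).2).choose_spec.trans ?_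
        refine (freeOp_congr (funcs_add x y)).trans ?_
        refine (freeOp_add x.2 y.2).trans ?_
        refine EqI.symm ((funcs_add _ _).trans (EqI.add ?_ ?_))
        · exact (exists_freeOp (u := funcs x) x.2).choose_spec
        · exact (exists_freeOp (u := funcs y) y.2).choose_spec
      map_smul' := fun c x => funcs_injective <| by
        refine (exists_freeOp (u := funcs (c • x : H)) (c • x).2).choose_spec.trans ?_
        refine (freeOp_congr (funcs_smul c x)).trans ?_
        refine (freeOp_smul c x.2).trans ?_
        refine EqI.symm ((funcs_smul _ _).trans (EqI.smul c ?_))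
        exact (exists_freeOp (u := funcs x) x.2).choose_spec }

theorem mem_freeTilde_domain (x : H) : x ∈ freeTilde.domain ↔ funcs x ∈ smoothDomain := Iff.rfl

theorem freeTilde_spec (x : freeTilde.domain) : EqI (funcs (freeTilde x)) (freeOp (funcs x)) :=
  (exists_freeOp (u := funcs x) x.2).choose_spec

/-- The free generator `L₀`, the closure of `freeTilde`. -/
def L₀ : H →ₗ.[ℂ] H := freeTilde.closure

/-- The perturbation `L'`, defined on all of `𝓗`; it is pinned down by `L'_spec`. -/
def L' : H →ₗ[ℂ] H where
  toFun x := (exists_potOp x).choose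
  map_add' x y := funcs_injective <| by
    refine (exists_potOp (x + y)).choose_spec.trans ?_
    refine (potOp_congr (funcs_add x y)).trans ((potOp_add x y).trans ?_)
    exact EqI.symm ((funcs_add _ _).trans
      (EqI.add (exists_potOp x).choose_spec (exists_potOp y).choose_spec))
  map_smul' c x := funcs_injective <| by
    refine (exists_potOp (c • x)).choose_spec.trans ?_
    refine (potOp_congr (funcs_smul c x)).trans ((potOp_smul c x).trans ?_)
    exact EqI.symm ((funcs_smul _ _).trans (EqI.smul c (exists_potOp x).choose_spec))

theorem L'_spec (x : H) : EqI (funcs (L' x)) (potOp (funcs x)) := (exists_potOp x).choose_spec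

/-- The generator `L = L₀ + L'`, with the domain of `L₀`. -/
def L : H →ₗ.[ℂ] H := L' +ᵥ L₀

/-! ### Spectrum of an unbounded operator -/

/-- The resolvent set of an unbounded operator `A`: all `lam` for which `lam - A`, defined on the
domain of `A`, has a bounded everywhere defined two-sided inverse. -/
def unboundedResolventSet (A : H →ₗ.[ℂ] H) : Set ℂ :=
  {lam | ∃ R : H →L[ℂ] H,
    (∀ f : H, ∃ h : R f ∈ A.domain, lam • R f - A ⟨R f, h⟩ = f) ∧
    ∀ x : A.domain, R (lam • (x : H) - A x) = x}

/-- The spectrum of an unbounded operator. -/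
def unboundedSpectrum (A : H →ₗ.[ℂ] H) : Set ℂ := (unboundedResolventSet A)ᶜ

/-- The point spectrum (the set of eigenvalues) of an unbounded operator. -/
def unboundedPointSpectrum (A : H →ₗ.[ℂ] H) : Set ℂ :=
  {lam | ∃ x : A.domain, (x : H) ≠ 0 ∧ A x = lam • (x : H)}

/-! ### The mode stability equation -/

/-- `u` solves the mode stability equation with spectral parameter `lam` on `(0,1]`:
`-(1-ρ²)(u'' + 2u'/ρ) + 2λρu' + λ(λ+1)u + 3F'(W₀(ρ)-1)u/ρ² = 0`. -/
def SolvesModeEq (lam : ℂ) (u : ℝ → ℂ) : Prop :=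
  ∀ ρ ∈ Ioc (0 : ℝ) 1,
    -(1 - (ρ : ℂ) ^ 2) *
        (derivWithin (derivWithin u I) I ρ + 2 / (ρ : ℂ) * derivWithin u I ρ) +
      2 * lam * (ρ : ℂ) * derivWithin u I ρ + lam * (lam + 1) * u ρ +
      3 * ((deriv F (W₀ ρ - 1) : ℝ) : ℂ) / (ρ : ℂ) ^ 2 * u ρ = 0

end

end YangMills

namespace YangMills

noncomputable section

/-! ### Calculus on `[0,1]` -/

/-! The half-plane `Re λ > -3/2` lies in the resolvent set of `L₀`, and `L'` is compact, so there
`L` can only have spectrum made of eigenvalues; the eigenfunctions are then smooth and reduce to the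
scalar equation.

Free part. In the coordinates `f = D² u₁`, `g = u₂'` the free operator is `(-ρ f' - 2 f + g', f' - ρ
g' - 2 g)` with the boundary condition `f(0) = 0` (`rep_freeTilde`). Integration by parts bounds its
numerical range by `-3/2` (`dissipative_freeTilde`). The combinations `a = f + g` and `b = f - g`
decouple the resolvent equation into two first order equations, which are solved explicitly: `a` by
regularity at `ρ = 1`, then `b` from `b(0) = -a(0)` (`exists_solution`). Hence `λ - freeTilde` has
dense range, and `Dissipative.exists_resolvent` yields the resolvent `R` of the closure.

Compactness. `L' u` depends only on `u₂`, which is the primitive of an `L²` function and so is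
Hölder continuous of order 1/2. Arzelà–Ascoli makes `L'` compact (`isCompactOperator_L'`). As `λ - L
= (1 - L' R)(λ - L₀)`, the Fredholm alternative for `L' R` gives an eigenvector whenever `λ` is in
the spectrum (`exists_eigenvector`).

Regularity. An eigenvector satisfies `x = R L' x`. The explicit formula for `R` extends to
continuous data (`resolvent_eq_sol`) and loses no derivatives, while recovering `u₂` from `u₂'`
gains one; iterating makes the eigenvector smooth (`exists_smooth_eigenfunction`).

Mode equation. With `v = u₂`, the second component of the eigenvalue equation expresses `u₁` through
`K v` and `K² v`. The first then becomes a second order equation for `K² v`, and `u = K² v / ρ³` is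
smooth and solves the mode equation. -/

theorem hasDerivWithinAt_J {f : ℝ → ℂ} (hf : ContinuousOn f I) {ρ : ℝ} (hρ : ρ ∈ I) :
    HasDerivWithinAt (J f) (f ρ) I ρ := by
  -- The `Fact` instance selects the version of the fundamental theorem for neighbourhoods within
  -- `[0,1]`, which covers both endpoints.
  have : Fact (ρ ∈ Icc (0 : ℝ) 1) := ⟨hρ⟩
  exact intervalIntegral.integral_hasDerivWithinAt_right
    (intervalIntegrable_sub (ContinuousOn.ii hf) hρ)
    ⟨I, self_mem_nhdsWithin, hf.aestronglyMeasurable measurableSet_Icc⟩ (hf ρ hρ)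

theorem hasDerivWithinAt_K {f : ℝ → ℂ} (hf : ContinuousOn f I) {ρ : ℝ} (hρ : ρ ∈ I) :
    HasDerivWithinAt (K f) (ρ * f ρ) I ρ :=
  hasDerivWithinAt_J (f := fun s => (s : ℂ) * f s) (by fun_prop) hρ

/-- A continuous function on `[0,1]` whose derivative on `(0,1)` extends continuously to `[0,1]` is
differentiable on `[0,1]`. -/
theorem hasDerivWithinAt_of_Ioo {G w : ℝ → ℂ} (hG : ContinuousOn G I) (hw : ContinuousOn w I)
    (hd : ∀ ρ ∈ Ioo (0 : ℝ) 1, HasDerivAt G (w ρ) ρ) {ρ : ℝ} (hρ : ρ ∈ I) :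
    HasDerivWithinAt G (w ρ) I ρ := by
  -- `G - G(0)` is the primitive of the continuous function `w`, and primitives are differentiable
  -- up to the endpoints.
  have h : EqOn (J w) (fun r => G r - G 0) I :=
    J_eq_of_hasDerivAt (by fun_prop) (by simp) (fun r hr => (hd r hr).sub_const _)
      (ContinuousOn.ii hw)
  have h2 : HasDerivWithinAt (fun r => J w r + G 0) (w ρ) I ρ :=
    (hasDerivWithinAt_J hw hρ).add_const _
  refine h2.congr (fun r hr => ?_) ?_
  · rw [h hr]; ring
  · rw [h hρ]; ring

theorem contDiffOn_succ_of_hasDerivWithinAt {n : ℕ} {f f' : ℝ → ℂ}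
    (h : ∀ ρ ∈ I, HasDerivWithinAt f (f' ρ) I ρ) (hf' : ContDiffOn ℝ n f' I) :
    ContDiffOn ℝ (n + 1 : ℕ) f I := by
  have := (contDiffOn_succ_iff_derivWithin (n := (n : WithTop ℕ∞)) (f := f) uniqueDiffOn_I).2
    ⟨fun ρ hρ => (h ρ hρ).differentiableWithinAt, by simp,
      hf'.congr fun ρ hρ => (h ρ hρ).derivWithin (uniqueDiffOn_I ρ hρ)⟩
  exact_mod_cast this

theorem contDiffOn_J {n : ℕ} {f : ℝ → ℂ} (hf : ContDiffOn ℝ n f I) :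
    ContDiffOn ℝ (n + 1 : ℕ) (J f) I :=
  contDiffOn_succ_of_hasDerivWithinAt (fun _ hρ => hasDerivWithinAt_J hf.continuousOn hρ) hf

theorem contDiff_coe {n : WithTop ℕ∞} : ContDiff ℝ n (fun s : ℝ => (s : ℂ)) :=
  Complex.ofRealCLM.contDiff

theorem contDiffOn_K {n : ℕ} {f : ℝ → ℂ} (hf : ContDiffOn ℝ n f I) :
    ContDiffOn ℝ (n + 1 : ℕ) (K f) I :=
  contDiffOn_J (f := fun s => (s : ℂ) * f s) (contDiff_coe.contDiffOn.mul hf)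

theorem contDiffOn_top_of_nat {f : ℝ → ℂ} (h : ∀ n : ℕ, ContDiffOn ℝ n f I) :
    ContDiffOn ℝ ∞ f I := contDiffOn_infty.2 h

theorem contDiffOn_nat {f : ℝ → ℂ} (h : ContDiffOn ℝ ∞ f I) (n : ℕ) : ContDiffOn ℝ n f I :=
  contDiffOn_infty.1 h n

theorem contDiffOn_J_infty {f : ℝ → ℂ} (hf : ContDiffOn ℝ ∞ f I) : ContDiffOn ℝ ∞ (J f) I :=
  contDiffOn_top_of_nat fun n => (contDiffOn_J (contDiffOn_nat hf n)).of_le (by norm_cast; omega)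

theorem contDiffOn_K_infty {f : ℝ → ℂ} (hf : ContDiffOn ℝ ∞ f I) : ContDiffOn ℝ ∞ (K f) I :=
  contDiffOn_top_of_nat fun n => (contDiffOn_K (contDiffOn_nat hf n)).of_le (by norm_cast; omega)

theorem contDiffOn_derivWithin_infty {f : ℝ → ℂ} (hf : ContDiffOn ℝ ∞ f I) :
    ContDiffOn ℝ ∞ (derivWithin f I) I := hf.derivWithin uniqueDiffOn_I (by simp)

theorem hasDerivWithinAt_of_contDiffOn {f : ℝ → ℂ} (hf : ContDiffOn ℝ 1 f I) {ρ : ℝ}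
    (hρ : ρ ∈ I) : HasDerivWithinAt f (derivWithin f I ρ) I ρ :=
  (hf.differentiableOn one_ne_zero ρ hρ).hasDerivWithinAt

/-! ### Weighted means -/

/-- The weighted mean `M ν h (ρ) = ∫₀¹ t^ν h(ρ t) dt`. -/
def M (ν : ℂ) (h : ℝ → ℂ) (ρ : ℝ) : ℂ := ∫ t in (0 : ℝ)..1, (t : ℂ) ^ ν * h (ρ * t)

theorem mul_mem_I {ρ t : ℝ} (hρ : ρ ∈ I) (ht : t ∈ I) : ρ * t ∈ I :=
  ⟨mul_nonneg hρ.1 ht.1, mul_le_one₀ hρ.2 ht.1 ht.2⟩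

theorem continuousOn_scale {h : ℝ → ℂ} (hh : ContinuousOn h I) {ρ : ℝ} (hρ : ρ ∈ I) :
    ContinuousOn (fun t => h (ρ * t)) I :=
  hh.comp (by fun_prop) fun _ ht => mul_mem_I hρ ht

theorem intervalIntegrable_cpow {ν : ℂ} (hν : -1 < ν.re) :
    IntervalIntegrable (fun t : ℝ => (t : ℂ) ^ ν) volume 0 1 :=
  intervalIntegral.intervalIntegrable_cpow' hν

theorem intervalIntegrable_M {ν : ℂ} (hν : -1 < ν.re) {h : ℝ → ℂ} (hh : ContinuousOn h I) {ρ : ℝ}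
    (hρ : ρ ∈ I) : IntervalIntegrable (fun t : ℝ => (t : ℂ) ^ ν * h (ρ * t)) volume 0 1 :=
  (intervalIntegrable_cpow hν).mul_continuousOn
    (by rw [uIcc_of_le zero_le_one]; exact continuousOn_scale hh hρ)

theorem aestronglyMeasurable_M {ν : ℂ} (hν : -1 < ν.re) {h : ℝ → ℂ} (hh : ContinuousOn h I)
    {ρ : ℝ} (hρ : ρ ∈ I) : AEStronglyMeasurable (fun t : ℝ => (t : ℂ) ^ ν * h (ρ * t))
      (volume.restrict (uIoc 0 1)) :=
  (intervalIntegrable_iff.1 (intervalIntegrable_M hν hh hρ)).aestronglyMeasurable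

theorem uIoc_subset_I : uIoc (0 : ℝ) 1 ⊆ I := by
  rw [uIoc_of_le zero_le_one]; exact Ioc_subset_Icc_self

/-- The integral of the weight `|t^ν|`. -/
def weight (ν : ℂ) : ℝ := ∫ t in (0 : ℝ)..1, ‖(t : ℂ) ^ ν‖

theorem weight_nonneg (ν : ℂ) : 0 ≤ weight ν :=
  intervalIntegral.integral_nonneg zero_le_one fun _ _ => norm_nonneg _

theorem norm_M_le {ν : ℂ} (hν : -1 < ν.re) {h : ℝ → ℂ} {C : ℝ} (hC : ∀ ρ ∈ I, ‖h ρ‖ ≤ C) {ρ : ℝ}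
    (hρ : ρ ∈ I) : ‖M ν h ρ‖ ≤ weight ν * C := by
  rw [weight, ← intervalIntegral.integral_mul_const]
  refine intervalIntegral.norm_integral_le_of_norm_le zero_le_one ?_
    ((intervalIntegrable_cpow hν).norm.mul_const C)
  refine Filter.Eventually.of_forall fun t ht => ?_
  rw [norm_mul]
  exact mul_le_mul_of_nonneg_left (hC _ (mul_mem_I hρ ⟨ht.1.le, ht.2⟩)) (norm_nonneg _)

theorem M_sub {ν : ℂ} (hν : -1 < ν.re) {h k : ℝ → ℂ} (hh : ContinuousOn h I)
    (hk : ContinuousOn k I) {ρ : ℝ} (hρ : ρ ∈ I) : M ν (h - k) ρ = M ν h ρ - M ν k ρ := by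
  rw [M, M, M, ← intervalIntegral.integral_sub (intervalIntegrable_M hν hh hρ)
    (intervalIntegrable_M hν hk hρ)]
  simp only [Pi.sub_apply, mul_sub]

theorem continuousOn_M {ν : ℂ} (hν : -1 < ν.re) {h : ℝ → ℂ} (hh : ContinuousOn h I) :
    ContinuousOn (M ν h) I := by
  obtain ⟨C, hC⟩ := isCompact_Icc.exists_bound_of_continuousOn hh
  intro ρ hρ
  refine intervalIntegral.continuousWithinAt_of_dominated_interval
    (bound := fun t => ‖(t : ℂ) ^ ν‖ * C) ?_ ?_ ((intervalIntegrable_cpow hν).norm.mul_const C) ?_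
  · filter_upwards [self_mem_nhdsWithin] with r hr
    exact aestronglyMeasurable_M hν hh hr
  · filter_upwards [self_mem_nhdsWithin] with r hr
    refine Filter.Eventually.of_forall fun t ht => ?_
    rw [norm_mul]
    exact mul_le_mul_of_nonneg_left (hC _ (mul_mem_I hr (uIoc_subset_I ht))) (norm_nonneg _)
  · refine Filter.Eventually.of_forall fun t ht => ?_
    refine continuousWithinAt_const.mul ?_
    have hc : ContinuousOn (fun r => h (r * t)) I :=
      hh.comp (by fun_prop) fun r hr => mul_mem_I hr (uIoc_subset_I ht)
    exact hc ρ hρ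

/-- Differentiation under the integral: the chain rule for `h(ρ t)` produces a factor `t`, which
raises the exponent of the weight by one. The singular weight itself is never differentiated. -/
theorem hasDerivAt_M {ν : ℂ} (hν : -1 < ν.re) {h : ℝ → ℂ} (hh : ContDiffOn ℝ 1 h I) {ρ : ℝ}
    (hρ : ρ ∈ Ioo (0 : ℝ) 1) : HasDerivAt (M ν h) (M (ν + 1) (derivWithin h I) ρ) ρ := by
  have hd : ContinuousOn (derivWithin h I) I :=
    hh.continuousOn_derivWithin uniqueDiffOn_I le_rfl
  obtain ⟨C, hC⟩ := isCompact_Icc.exists_bound_of_continuousOn hd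
  have hIoo : ∀ {r : ℝ}, r ∈ Ioo (0 : ℝ) 1 → r ∈ I := fun hr => ⟨hr.1.le, hr.2.le⟩
  have hν' : -1 < (ν + 1).re := by simp; linarith
  have hmul : ∀ {t : ℝ}, t ∈ uIoc (0 : ℝ) 1 → (t : ℂ) ^ (ν + 1) = (t : ℂ) ^ ν * t := fun {t} ht => by
    rw [uIoc_of_le zero_le_one] at ht
    rw [Complex.cpow_add _ _ (by exact_mod_cast ht.1.ne'), Complex.cpow_one]
  refine (intervalIntegral.hasDerivAt_integral_of_dominated_loc_of_deriv_le
    (F := fun r t => (t : ℂ) ^ ν * h (r * t))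
    (F' := fun r t => (t : ℂ) ^ (ν + 1) * derivWithin h I (r * t))
    (bound := fun t => ‖(t : ℂ) ^ (ν + 1)‖ * C) (Ioo_mem_nhds hρ.1 hρ.2) ?_
    (intervalIntegrable_M hν hh.continuousOn (hIoo hρ))
    (aestronglyMeasurable_M hν' hd (hIoo hρ)) ?_
    ((intervalIntegrable_cpow hν').norm.mul_const C) ?_).2
  · filter_upwards [Ioo_mem_nhds hρ.1 hρ.2] with r hr
    exact aestronglyMeasurable_M hν hh.continuousOn (hIoo hr)
  · refine Filter.Eventually.of_forall fun t ht r hr => ?_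
    rw [norm_mul]
    exact mul_le_mul_of_nonneg_left (hC _ (mul_mem_I (hIoo hr) (uIoc_subset_I ht)))
      (norm_nonneg _)
  · refine Filter.Eventually.of_forall fun t ht r hr => ?_
    have ht' := ht
    rw [uIoc_of_le zero_le_one] at ht'
    have hm : r * t ∈ Ioo (0 : ℝ) 1 :=
      ⟨mul_pos hr.1 ht'.1, by nlinarith [hr.1, hr.2, ht'.1, ht'.2]⟩
    have h1 : HasDerivAt (fun r : ℝ => r * t) t r := by
      simpa using (hasDerivAt_id r).mul_const t
    have h2 := (HasDerivAt.scomp r (hasDerivAt_of_contDiffOn hh hm) h1).const_mul ((t : ℂ) ^ ν)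
    refine h2.congr_deriv ?_
    rw [hmul ht, Complex.real_smul]
    ring

theorem hasDerivWithinAt_M {ν : ℂ} (hν : -1 < ν.re) {h : ℝ → ℂ} (hh : ContDiffOn ℝ 1 h I) {ρ : ℝ}
    (hρ : ρ ∈ I) : HasDerivWithinAt (M ν h) (M (ν + 1) (derivWithin h I) ρ) I ρ :=
  hasDerivWithinAt_of_Ioo (continuousOn_M hν hh.continuousOn)
    (continuousOn_M (by simp; linarith) (hh.continuousOn_derivWithin uniqueDiffOn_I le_rfl))
    (fun _ hr => hasDerivAt_M hν hh hr) hρ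

/-- Since the derivative of a mean with exponent `ν` is a mean with exponent `ν + 1`, the induction
runs over all exponents at once. -/
theorem contDiffOn_M (n : ℕ) : ∀ {ν : ℂ} (_ : -1 < ν.re) {h : ℝ → ℂ} (_ : ContDiffOn ℝ n h I),
    ContDiffOn ℝ n (M ν h) I := by
  induction n with
  | zero =>
    intro ν hν h hh
    have := continuousOn_M hν hh.continuousOn
    exact_mod_cast contDiffOn_zero.2 this
  | succ n ih =>
    intro ν hν h hh
    have h1 : ContDiffOn ℝ 1 h I := hh.of_le (by norm_cast; omega)
    exact contDiffOn_succ_of_hasDerivWithinAt (fun _ hρ => hasDerivWithinAt_M hν h1 hρ)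
      (ih (by simp; linarith) (contDiffOn_derivWithin (by exact_mod_cast hh)))

theorem contDiffOn_M_infty {ν : ℂ} (hν : -1 < ν.re) {h : ℝ → ℂ} (hh : ContDiffOn ℝ ∞ h I) :
    ContDiffOn ℝ ∞ (M ν h) I :=
  contDiffOn_top_of_nat fun n => contDiffOn_M n hν (contDiffOn_nat hh n)

/-- The differential equation of a weighted mean. -/
theorem M_ode {ν : ℂ} (hν : -1 < ν.re) {h : ℝ → ℂ} (hh : ContDiffOn ℝ 1 h I) {ρ : ℝ}
    (hρ : ρ ∈ I) : (ν + 1) * M ν h ρ + ρ * M (ν + 1) (derivWithin h I) ρ = h ρ := by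
  have hd : ContinuousOn (derivWithin h I) I :=
    hh.continuousOn_derivWithin uniqueDiffOn_I le_rfl
  have hν' : -1 < (ν + 1).re := by simp; linarith
  have hν0 : 0 < (ν + 1).re := by simp; linarith
  have hne : ν + 1 ≠ 0 := fun h0 => by rw [h0] at hν0; simp at hν0
  have hc : Continuous (fun t : ℝ => (t : ℂ) ^ (ν + 1)) :=
    Complex.continuous_ofReal_cpow_const hν0
  have i1 := (intervalIntegrable_M hν hh.continuousOn hρ).const_mul (ν + 1)
  have i2 := (intervalIntegrable_M hν' hd hρ).const_mul (ρ : ℂ)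
  -- Integrate the derivative of `t^(ν+1) h(ρ t)` over `[0,1]`; the boundary term at `t = 0`
  -- vanishes because `Re (ν + 1) > 0`.
  have key := intervalIntegral.integral_eq_sub_of_hasDerivAt_of_le zero_le_one
    (f := fun t : ℝ => (t : ℂ) ^ (ν + 1) * h (ρ * t))
    (f' := fun t : ℝ => (ν + 1) * ((t : ℂ) ^ ν * h (ρ * t)) +
      ρ * ((t : ℂ) ^ (ν + 1) * derivWithin h I (ρ * t)))
    (hc.continuousOn.mul (continuousOn_scale hh.continuousOn hρ))
    (fun t ht => ?_) (i1.add i2)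
  · rw [intervalIntegral.integral_add i1 i2, intervalIntegral.integral_const_mul,
      intervalIntegral.integral_const_mul] at key
    rw [M, M, key]
    simp [Complex.zero_cpow hne]
  · have h0 : HasDerivAt (fun t : ℝ => (t : ℂ) ^ (ν + 1)) ((ν + 1) * (t : ℂ) ^ ν) t := by
      simpa using hasDerivAt_ofReal_cpow_const ht.1.ne' hne
    -- For `ρ = 0` the argument `ρ t` stays at the endpoint `0`, where no two-sided derivative of
    -- `h` is available; but there `h(ρ t)` is constant.
    rcases eq_or_lt_of_le hρ.1 with hz | hz
    · subst hz
      simpa [mul_assoc] using h0.mul_const (h 0)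
    · have hm : ρ * t ∈ Ioo (0 : ℝ) 1 :=
        ⟨mul_pos hz ht.1, by nlinarith [hρ.1, hρ.2, ht.1, ht.2]⟩
      have h1 : HasDerivAt (fun r : ℝ => ρ * r) ρ t := by
        simpa using (hasDerivAt_id t).const_mul ρ
      have h2 := h0.mul (HasDerivAt.scomp t (hasDerivAt_of_contDiffOn hh hm) h1)
      refine h2.congr_deriv ?_
      simp only [Function.comp, Complex.real_smul]
      ring

/-- Hadamard's lemma. -/
theorem eq_mul_M_zero {h : ℝ → ℂ} (hh : ContDiffOn ℝ 1 h I) (h0 : h 0 = 0) {ρ : ℝ} (hρ : ρ ∈ I) :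
    h ρ = ρ * M 0 (derivWithin h I) ρ := by
  rcases eq_or_lt_of_le hρ.1 with hz | hz
  · subst hz; simp [h0]
  have key := intervalIntegral.integral_eq_sub_of_hasDerivAt_of_le zero_le_one
    (f := fun t : ℝ => h (ρ * t)) (f' := fun t : ℝ => ρ * derivWithin h I (ρ * t))
    (continuousOn_scale hh.continuousOn hρ)
    (fun t ht => ?_) ?_
  · rw [intervalIntegral.integral_const_mul] at key
    rw [M]
    simp only [Complex.cpow_zero, one_mul]
    rw [key]
    simp [h0]
  · have hm : ρ * t ∈ Ioo (0 : ℝ) 1 :=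
      ⟨mul_pos hz ht.1, by nlinarith [hρ.1, hρ.2, ht.1, ht.2]⟩
    have h1 : HasDerivAt (fun r : ℝ => ρ * r) ρ t := by
      simpa using (hasDerivAt_id t).const_mul ρ
    have h2 := HasDerivAt.scomp t (hasDerivAt_of_contDiffOn hh hm) h1
    refine h2.congr_deriv ?_
    simp only [Complex.real_smul]
  · have hd : ContinuousOn (derivWithin h I) I :=
      hh.continuousOn_derivWithin uniqueDiffOn_I le_rfl
    exact (ContinuousOn.ii (continuousOn_scale hd hρ)).const_mul _

/-- `∫₀^ρ s^(n+1) h(s) ds` as a multiple of `ρ^(n+2)`. -/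
theorem K_pow_mul (n : ℕ) (h : ℝ → ℂ) (ρ : ℝ) :
    K (fun s => (s : ℂ) ^ n * h s) ρ = (ρ : ℂ) ^ (n + 2) * M (n + 1) h ρ := by
  rcases eq_or_ne ρ 0 with hz | hz
  · subst hz; simp
  -- The substitution `s = ρ t` extracts one power of `ρ` from `ds` and `n + 1` from the integrand.
  have h1 := intervalIntegral.smul_integral_comp_mul_left
    (fun s : ℝ => (s : ℂ) * ((s : ℂ) ^ n * h s)) ρ (a := 0) (b := 1)
  rw [mul_zero, mul_one] at h1
  rw [K, ← h1, M, Complex.real_smul, ← intervalIntegral.integral_const_mul,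
    ← intervalIntegral.integral_const_mul]
  refine intervalIntegral.integral_congr fun t _ => ?_
  have e : (t : ℂ) ^ ((n : ℂ) + 1) = (t : ℂ) ^ (n + 1) := by
    rw [← Complex.cpow_natCast]; norm_cast
  rw [e]
  push_cast
  ring

/-- Together with `M_apply_zero_of_eq_zero` this transfers the vanishing of derivatives at `0` from
a function to its weighted means. -/
theorem iteratedDerivWithin_M (n : ℕ) : ∀ {ν : ℂ} (_ : -1 < ν.re) {h : ℝ → ℂ}
    (_ : ContDiffOn ℝ ∞ h I), EqOn (iteratedDerivWithin n (M ν h) I)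
      (M (ν + n) (iteratedDerivWithin n h I)) I := by
  induction n with
  | zero => intro ν _ h _ ρ hρ; simp
  | succ n ih =>
    intro ν hν h hh ρ hρ
    have e : EqOn (derivWithin (M ν h) I) (M (ν + 1) (derivWithin h I)) I := fun r hr =>
      (hasDerivWithinAt_M hν (smooth_one hh) hr).derivWithin (uniqueDiffOn_I r hr)
    rw [iteratedDerivWithin_succ', iteratedDerivWithin_congr e hρ,
      ih (by simp; linarith) (contDiffOn_derivWithin_infty hh) hρ, iteratedDerivWithin_succ']
    congr 1
    push_cast; ring

theorem M_apply_zero_of_eq_zero {ν : ℂ} {h : ℝ → ℂ} (h0 : h 0 = 0) : M ν h 0 = 0 := by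
  simp [M, h0]

/-! ### The free operator in the coordinates `(D² u₁, u₂')` -/

/-- The element `x` of `𝓗` is represented by the functions `f = D² u₁` and `g = u₂'`. -/
def Rep (x : H) (f g : ℝ → ℂ) : Prop := x.fst =ᵐ[μ] f ∧ x.snd =ᵐ[μ] g

theorem Rep.eqI {x : H} {f g : ℝ → ℂ} (h : Rep x f g) : EqI (funcs x) (K (K f), J g) :=
  ⟨KK_congr h.1, J_congr h.2⟩

theorem Rep.ext {x y : H} {f g : ℝ → ℂ} (hx : Rep x f g) (hy : Rep y f g) : x = y :=
  funcs_injective (hx.eqI.trans hy.eqI.symm)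

theorem Rep.congr {x : H} {f g f' g' : ℝ → ℂ} (h : Rep x f g) (hf : EqOn f f' (Ioo 0 1))
    (hg : EqOn g g' (Ioo 0 1)) : Rep x f' g' :=
  ⟨h.1.trans (ae_of_eqOn_Ioo hf), h.2.trans (ae_of_eqOn_Ioo hg)⟩

theorem Rep.sub {x y : H} {f g f' g' : ℝ → ℂ} (h : Rep x f g) (h' : Rep y f' g') :
    Rep (x - y) (f - f') (g - g') :=
  ⟨(Lp.coeFn_sub x.fst y.fst).trans (h.1.sub h'.1),
    (Lp.coeFn_sub x.snd y.snd).trans (h.2.sub h'.2)⟩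

theorem Rep.smul {x : H} {f g : ℝ → ℂ} (c : ℂ) (h : Rep x f g) :
    Rep (c • x) (c • f) (c • g) :=
  ⟨(Lp.coeFn_smul c x.fst).trans (h.1.const_smul c),
    (Lp.coeFn_smul c x.snd).trans (h.2.const_smul c)⟩

theorem exists_L2_of_continuousOn {w : ℝ → ℂ} (hw : ContinuousOn w I) : ∃ y : L2, y =ᵐ[μ] w := by
  obtain ⟨C, hC⟩ := isCompact_Icc.exists_bound_of_continuousOn hw
  exact exists_L2 (hw.mono Ioo_subset_Icc_self) fun ρ hρ => hC ρ (Ioo_subset_Icc_self hρ)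

theorem exists_rep {f g : ℝ → ℂ} (hf : ContinuousOn f I) (hg : ContinuousOn g I) :
    ∃ x : H, Rep x f g := by
  obtain ⟨y1, h1⟩ := exists_L2_of_continuousOn hf
  obtain ⟨y2, h2⟩ := exists_L2_of_continuousOn hg
  exact ⟨WithLp.toLp 2 (y1, y2), h1, h2⟩

theorem derivWithin_K_eq {f : ℝ → ℂ} (hf : ContinuousOn f I) {ρ : ℝ} (hρ : ρ ∈ I) :
    derivWithin (K f) I ρ = ρ * f ρ :=
  (hasDerivWithinAt_K hf hρ).derivWithin (uniqueDiffOn_I ρ hρ)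

theorem derivWithin_J_eq {f : ℝ → ℂ} (hf : ContinuousOn f I) {ρ : ℝ} (hρ : ρ ∈ I) :
    derivWithin (J f) I ρ = f ρ :=
  (hasDerivWithinAt_J hf hρ).derivWithin (uniqueDiffOn_I ρ hρ)

/-- Away from `0` the factor `ρ` cancels. At `0` the division in `D` returns the default value `0`,
which is why `f(0) = 0` is required. -/
theorem D_K_eq {f : ℝ → ℂ} (hf : ContinuousOn f I) (h0 : f 0 = 0) : EqOn (D (K f)) f I := by
  intro ρ hρ
  rw [D, derivWithin_K_eq hf hρ]
  rcases eq_or_lt_of_le hρ.1 with h | h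
  · subst h; simp [h0]
  · have : (ρ : ℂ) ≠ 0 := by exact_mod_cast h.ne'
    field_simp

theorem D_D_K_K_eq {f : ℝ → ℂ} (hf : ContinuousOn f I) (h0 : f 0 = 0) :
    EqOn (D (D (K (K f)))) f I :=
  (D_congr (D_K_eq (continuousOn_K (ContinuousOn.ii hf)) (K_zero f))).trans (D_K_eq hf h0)

/-- Each `K` raises the order of vanishing at `0` by two. The derivatives up to the third vanish for
every smooth `f`; the fourth equals `3 f(0)`, so the condition `f(0) = 0` is the only real
constraint. -/
theorem iteratedDerivWithin_K_K {f : ℝ → ℂ} (hf : ContDiffOn ℝ ∞ f I) (h0 : f 0 = 0) :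
    ∀ k ≤ 4, iteratedDerivWithin k (K (K f)) I 0 = 0 := by
  have z : (0 : ℝ) ∈ I := by simp
  have cf := hf.continuousOn
  have cK := continuousOn_K (ContinuousOn.ii cf)
  set f1 := derivWithin f I with hf1
  have sf1 : ContDiffOn ℝ ∞ f1 I := contDiffOn_derivWithin_infty hf
  have id : ∀ ρ : ℝ, HasDerivWithinAt (fun s : ℝ => (s : ℂ)) 1 I ρ := fun ρ =>
    (hasDerivAt_ofReal ρ).hasDerivWithinAt
  have df : ∀ ρ ∈ I, HasDerivWithinAt f (f1 ρ) I ρ := fun ρ hρ =>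
    hasDerivWithinAt_of_contDiffOn (smooth_one hf) hρ
  have df1 : ∀ ρ ∈ I, HasDerivWithinAt f1 (derivWithin f1 I ρ) I ρ := fun ρ hρ =>
    hasDerivWithinAt_of_contDiffOn (smooth_one sf1) hρ
  have e1 : EqOn (derivWithin (K (K f)) I) (fun ρ : ℝ => (ρ : ℂ) * K f ρ) I := fun ρ hρ =>
    derivWithin_K_eq cK hρ
  have e2 : EqOn (derivWithin (fun ρ : ℝ => (ρ : ℂ) * K f ρ) I)
      (fun ρ : ℝ => K f ρ + (ρ : ℂ) ^ 2 * f ρ) I := fun ρ hρ => by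
    rw [((id ρ).fun_mul (hasDerivWithinAt_K cf hρ)).derivWithin (uniqueDiffOn_I ρ hρ)]
    ring
  have e3 : EqOn (derivWithin (fun ρ : ℝ => K f ρ + (ρ : ℂ) ^ 2 * f ρ) I)
      (fun ρ : ℝ => 3 * (ρ * f ρ) + (ρ : ℂ) ^ 2 * f1 ρ) I := fun ρ hρ => by
    rw [((hasDerivWithinAt_K cf hρ).fun_add (((id ρ).fun_pow 2).fun_mul (df ρ hρ))).derivWithin
      (uniqueDiffOn_I ρ hρ)]
    simp; ring
  have e4 : derivWithin (fun ρ : ℝ => 3 * (ρ * f ρ) + (ρ : ℂ) ^ 2 * f1 ρ) I 0 = 0 := by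
    rw [((((id 0).fun_mul (df 0 z)).const_mul 3).fun_add
      (((id 0).fun_pow 2).fun_mul (df1 0 z))).derivWithin (uniqueDiffOn_I 0 z)]
    simp [h0]
  have e12 : EqOn (derivWithin (derivWithin (K (K f)) I) I)
      (fun ρ : ℝ => K f ρ + (ρ : ℂ) ^ 2 * f ρ) I := fun ρ hρ => by
    rw [derivWithin_congr e1 (e1 hρ), e2 hρ]
  have e123 : EqOn (derivWithin (derivWithin (derivWithin (K (K f)) I) I) I)
      (fun ρ : ℝ => 3 * (ρ * f ρ) + (ρ : ℂ) ^ 2 * f1 ρ) I := fun ρ hρ => by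
    rw [derivWithin_congr e12 (e12 hρ), e3 hρ]
  intro k hk
  interval_cases k
  · simp
  · rw [iteratedDerivWithin_one, e1 z]; simp
  · rw [iteratedDerivWithin_succ', iteratedDerivWithin_one, e12 z]
    simp
  · rw [iteratedDerivWithin_succ', iteratedDerivWithin_succ', iteratedDerivWithin_one, e123 z]
    simp
  · rw [iteratedDerivWithin_succ', iteratedDerivWithin_succ', iteratedDerivWithin_succ',
      iteratedDerivWithin_one, derivWithin_congr e123 (e123 z), e4]

theorem Rep.mem_domain {x : H} {f g : ℝ → ℂ} (h : Rep x f g) (hf : ContDiffOn ℝ ∞ f I)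
    (hg : ContDiffOn ℝ ∞ g I) (h0 : f 0 = 0) : x ∈ freeTilde.domain :=
  smoothDomain_congr h.eqI ⟨contDiffOn_K_infty (contDiffOn_K_infty hf), contDiffOn_J_infty hg,
    iteratedDerivWithin_K_K hf h0, by simp⟩

/-- Hadamard's lemma applied to `h'` shows that `D h` is smooth up to `0`. The condition `h''(0) =
0` matches the mean with the default value `D h (0) = 0`. -/
theorem D_eq_M {h : ℝ → ℂ} (hh : ContDiffOn ℝ ∞ h I) (h0 : derivWithin h I 0 = 0)
    (h1 : derivWithin (derivWithin h I) I 0 = 0) :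
    EqOn (D h) (M 0 (derivWithin (derivWithin h I) I)) I := by
  intro ρ hρ
  have := eq_mul_M_zero (smooth_one (contDiffOn_derivWithin_infty hh)) h0 hρ
  rcases eq_or_lt_of_le hρ.1 with h | h
  · subst h; rw [M_apply_zero_of_eq_zero h1]; simp [D]
  · have hne : (ρ : ℂ) ≠ 0 := by exact_mod_cast h.ne'
    rw [D, this]
    field_simp

/-- The smooth functions that represent an element of the domain of `freeTilde`. -/
theorem exists_rep_of_mem_domain {x : H} (hx : x ∈ freeTilde.domain) :
    ∃ f g : ℝ → ℂ, ContDiffOn ℝ ∞ f I ∧ ContDiffOn ℝ ∞ g I ∧ f 0 = 0 ∧ Rep x f g := by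
  obtain ⟨h1, h2, h3, h4⟩ := hx
  have z : (0 : ℝ) ∈ I := by simp
  set u := (funcs x).1 with hu
  have s2 := contDiffOn_derivWithin_infty (contDiffOn_derivWithin_infty h1)
  set k := M 0 (derivWithin (derivWithin u I) I) with hk
  have sk : ContDiffOn ℝ ∞ k I := contDiffOn_M_infty (by simp) s2
  have d1 : derivWithin u I 0 = 0 := by rw [← iteratedDerivWithin_one]; exact h3 1 (by norm_num)
  have d2 : derivWithin (derivWithin u I) I 0 = 0 := by
    rw [← iteratedDerivWithin_one, ← iteratedDerivWithin_succ']; exact h3 2 (by norm_num)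
  have e1 : EqOn (D u) k I := D_eq_M h1 d1 d2
  -- Since `k` is a mean of `u''`, its `n`-th derivative at `0` is a multiple of the `(n+2)`-nd
  -- derivative of `u`. The boundary conditions up to order 4 thus leave orders 0 to 2 for `k`, just
  -- what a second application of `D_eq_M` and the final value at `0` need.
  have kd : ∀ n ≤ 2, iteratedDerivWithin n k I 0 = 0 := fun n hn => by
    rw [hk, iteratedDerivWithin_M n (by simp) s2 z]
    refine M_apply_zero_of_eq_zero ?_
    rw [← iteratedDerivWithin_succ', ← iteratedDerivWithin_succ']
    exact h3 _ (by omega)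
  have k1 : derivWithin k I 0 = 0 := by rw [← iteratedDerivWithin_one]; exact kd 1 (by norm_num)
  have k2 : derivWithin (derivWithin k I) I 0 = 0 := by
    rw [← iteratedDerivWithin_one, ← iteratedDerivWithin_succ']; exact kd 2 (by norm_num)
  have e2 : EqOn (D (D u)) (M 0 (derivWithin (derivWithin k I) I)) I :=
    (D_congr e1).trans (D_eq_M sk k1 k2)
  refine ⟨_, _, contDiffOn_M_infty (ν := 0) (by simp)
    (contDiffOn_derivWithin_infty (contDiffOn_derivWithin_infty sk)),
    contDiffOn_derivWithin_infty h2, M_apply_zero_of_eq_zero k2, ?_, ?_⟩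
  · exact (D_D_funcs x).symm.trans (ae_of_eqOn e2)
  · exact (derivWithin_funcs x).symm

/-- The free operator in coordinates. -/
theorem rep_freeTilde {x : freeTilde.domain} {f g : ℝ → ℂ} (h : Rep x f g)
    (hf : ContDiffOn ℝ ∞ f I) (hg : ContDiffOn ℝ ∞ g I) (h0 : f 0 = 0) :
    Rep (freeTilde x)
      (fun ρ => -(ρ : ℂ) * derivWithin f I ρ - 2 * f ρ + derivWithin g I ρ)
      (fun ρ => derivWithin f I ρ - ρ * derivWithin g I ρ - 2 * g ρ) := by
  have hu := h.eqI
  have cf := hf.continuousOn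
  have cg := hg.continuousOn
  have cf1 := (contDiffOn_derivWithin_infty hf).continuousOn
  have cg1 := (contDiffOn_derivWithin_infty hg).continuousOn
  have cKf := continuousOn_K (ContinuousOn.ii cf)
  have cKKf := continuousOn_K (ContinuousOn.ii cKf)
  have cJ := continuousOn_J (ContinuousOn.ii cg)
  have cKJ := continuousOn_K (ContinuousOn.ii cJ)
  obtain ⟨y, hy⟩ := exists_rep (f := fun ρ => -(ρ : ℂ) * derivWithin f I ρ - 2 * f ρ +
    derivWithin g I ρ) (g := fun ρ => derivWithin f I ρ - ρ * derivWithin g I ρ - 2 * g ρ)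
    (by fun_prop) (by fun_prop)
  have df : ∀ ρ ∈ Ioo (0 : ℝ) 1, HasDerivAt f (derivWithin f I ρ) ρ := fun ρ hρ =>
    hasDerivAt_of_contDiffOn (smooth_one hf) hρ
  have dg : ∀ ρ ∈ Ioo (0 : ℝ) 1, HasDerivAt g (derivWithin g I ρ) ρ := fun ρ hρ =>
    hasDerivAt_of_contDiffOn (smooth_one hg) hρ
  have e1 : EqOn (freeOp (K (K f), J g)).1
      (fun ρ => -(ρ : ℂ) ^ 2 * K f ρ + 2 * K (K f) ρ + (ρ : ℂ) ^ 2 * J g ρ - 3 * K (J g) ρ) I :=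
    fun ρ hρ => by
      simp only [freeOp]
      rw [derivWithin_K_eq cKf hρ]
      ring
  have e2 : EqOn (freeOp (K (K f), J g)).2 (fun ρ => f ρ - ρ * g ρ - J g ρ) I := fun ρ hρ => by
    simp only [freeOp]
    rw [D_D_K_K_eq cf h0 hρ, derivWithin_J_eq cg hρ]
  -- An element of `𝓗` is determined by its functions, so the claimed coordinates are integrated
  -- back: `k1` and `k2` apply `K` twice to the first one, `k3` applies `J` to the second. The
  -- condition `f(0) = 0` enters as the initial value in `k3`.
  have k1 : EqOn (K fun ρ => -(ρ : ℂ) * derivWithin f I ρ - 2 * f ρ + derivWithin g I ρ)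
      (fun ρ => -(ρ : ℂ) ^ 2 * f ρ + ρ * g ρ - J g ρ) I := by
    refine J_eq_of_hasDerivAt (by fun_prop) (by simp) (fun ρ hρ => ?_)
      (intervalIntegrable_mul (ContinuousOn.ii (by fun_prop)))
    have id := hasDerivAt_ofReal ρ
    have := (((id.fun_pow 2).fun_neg.fun_mul (df ρ hρ)).fun_add (id.fun_mul (dg ρ hρ))).fun_sub
      (hasDerivAt_J cg hρ)
    refine this.congr_deriv ?_
    push_cast; ring
  have k2 : EqOn (K (fun ρ => -(ρ : ℂ) ^ 2 * f ρ + ρ * g ρ - J g ρ))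
      (fun ρ => -(ρ : ℂ) ^ 2 * K f ρ + 2 * K (K f) ρ + (ρ : ℂ) ^ 2 * J g ρ - 3 * K (J g) ρ) I := by
    refine J_eq_of_hasDerivAt (by fun_prop) (by simp) (fun ρ hρ => ?_)
      (intervalIntegrable_mul (ContinuousOn.ii (by fun_prop)))
    have id := hasDerivAt_ofReal ρ
    have := ((((id.fun_pow 2).fun_neg.fun_mul (hasDerivAt_K cf hρ)).fun_add
      ((hasDerivAt_K cKf hρ).const_mul 2)).fun_add
      ((id.fun_pow 2).fun_mul (hasDerivAt_J cg hρ))).fun_sub ((hasDerivAt_K cJ hρ).const_mul 3)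
    refine this.congr_deriv ?_
    push_cast; ring
  have k3 : EqOn (J fun ρ => derivWithin f I ρ - ρ * derivWithin g I ρ - 2 * g ρ)
      (fun ρ => f ρ - ρ * g ρ - J g ρ) I := by
    refine J_eq_of_hasDerivAt (by fun_prop) (by simp [h0]) (fun ρ hρ => ?_)
      (ContinuousOn.ii (by fun_prop))
    have id := hasDerivAt_ofReal ρ
    refine (((df ρ hρ).fun_sub (id.fun_mul (dg ρ hρ))).fun_sub
      (hasDerivAt_J cg hρ)).congr_deriv ?_
    ring
  have : freeTilde x = y := by
    refine funcs_injective ((freeTilde_spec x).trans ((freeOp_congr hu).trans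
      (EqI.symm (hy.eqI.trans ⟨?_, ?_⟩))))
    · exact ((K_congr (ae_of_eqOn k1)).trans k2).trans e1.symm
    · exact k3.trans e2.symm
  rw [this]
  exact hy

/-! ### Dissipative operators -/

section Dissipative

variable {E : Type*} [NormedAddCommGroup E] [InnerProductSpace ℂ E]

/-- The numerical range of `A` lies in the half-plane `Re z ≤ c`. -/
def Dissipative (A : E →ₗ.[ℂ] E) (c : ℝ) : Prop :=
  ∀ x : A.domain, (inner ℂ (x : E) (A x)).re ≤ c * ‖(x : E)‖ ^ 2

/-- The inequality is a closed condition on pairs. Working with the closure of the graph makes the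
bound available before closability is known. -/
theorem Dissipative.closure_graph {A : E →ₗ.[ℂ] E} {c : ℝ} (h : Dissipative A c) {p : E × E}
    (hp : p ∈ A.graph.topologicalClosure) : (inner ℂ p.1 p.2).re ≤ c * ‖p.1‖ ^ 2 := by
  have hc : IsClosed {p : E × E | (inner ℂ p.1 p.2).re ≤ c * ‖p.1‖ ^ 2} :=
    isClosed_le (by fun_prop) (by fun_prop)
  refine closure_minimal (fun q hq => ?_) hc hp
  obtain ⟨x, h1, h2⟩ := (LinearPMap.mem_graph_iff A).1 hq
  change (inner ℂ q.1 q.2).re ≤ c * ‖q.1‖ ^ 2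
  rw [← h1, ← h2]
  exact h x

/-- Let `(0, y)` be in the closure of the graph. Testing the bound on `(t z, y + t A z)`, dividing
by `t > 0` and letting `t → 0` gives `Re ⟨z, y⟩ ≤ 0` for all `z` in the domain. By density `z = y`
is allowed, so `y = 0`. -/
theorem Dissipative.isClosable {A : E →ₗ.[ℂ] E} {c : ℝ} (h : Dissipative A c)
    (hd : Dense (A.domain : Set E)) : A.IsClosable := by
  refine ⟨_, (Submodule.toLinearPMap_graph_eq _ ?_).symm⟩
  rintro ⟨p, y⟩ hp (rfl : p = 0)
  have key : ∀ z ∈ (A.domain : Set E), (inner ℂ z y).re ≤ 0 := fun z hz => by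
    have ht : ∀ t : ℝ, 0 < t →
        (inner ℂ z y).re ≤ t * (c * ‖z‖ ^ 2 - (inner ℂ z (A ⟨z, hz⟩)).re) := fun t ht => by
      have hm : ((t : ℂ) • z, (t : ℂ) • A ⟨z, hz⟩) ∈ A.graph.topologicalClosure :=
        A.graph.le_topologicalClosure (A.graph.smul_mem (t : ℂ) (A.mem_graph ⟨z, hz⟩))
      have := h.closure_graph (Submodule.add_mem _ hp hm)
      simp only [Prod.mk_add_mk, zero_add, inner_add_right, inner_smul_left, inner_smul_right,
        Complex.conj_ofReal, norm_smul, Complex.norm_real, Real.norm_of_nonneg ht.le,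
        Complex.add_re, Complex.re_ofReal_mul] at this
      refine le_of_mul_le_mul_left ?_ ht
      linarith
    refine le_of_forall_pos_le_add fun ε hε => ?_
    set B := c * ‖z‖ ^ 2 - (inner ℂ z (A ⟨z, hz⟩)).re
    -- This `t` makes `t B ≤ ε` whatever the sign of `B`, and stays positive when `B = 0`.
    have h1 := ht (ε / (|B| + 1)) (by positivity)
    have h2 : ε / (|B| + 1) * B ≤ ε := by
      rw [div_mul_eq_mul_div, div_le_iff₀ (by positivity)]
      nlinarith [le_abs_self B]
    linarith
  have hy : (inner ℂ y y).re ≤ 0 := by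
    have hc : IsClosed {z : E | (inner ℂ z y).re ≤ 0} := isClosed_le (by fun_prop) (by fun_prop)
    exact closure_minimal key hc (hd y)
  have hy' : ‖y‖ ^ 2 ≤ 0 := by rwa [← inner_self_eq_norm_sq (𝕜 := ℂ)]
  simpa using hy'

/-- Pair `λ p.1 - p.2` with `p.1`: the real part is at least `(Re λ - c) ‖p.1‖²`, and Cauchy–Schwarz
bounds it from above. -/
theorem Dissipative.norm_le {A : E →ₗ.[ℂ] E} {c : ℝ} (h : Dissipative A c) (lam : ℂ) {p : E × E}
    (hp : p ∈ A.graph.topologicalClosure) : (lam.re - c) * ‖p.1‖ ≤ ‖lam • p.1 - p.2‖ := by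
  rcases eq_or_ne p.1 0 with h0 | h0
  · simp [h0]
  have h1 := h.closure_graph hp
  have h2 := (Complex.re_le_norm (inner ℂ p.1 (lam • p.1 - p.2))).trans (norm_inner_le_norm _ _)
  have e : inner ℂ p.1 p.1 = ((‖p.1‖ ^ 2 : ℝ) : ℂ) := by
    rw [inner_self_eq_norm_sq_to_K]; norm_cast
  rw [inner_sub_right, inner_smul_right, e, Complex.sub_re, Complex.re_mul_ofReal] at h2
  refine le_of_mul_le_mul_left ?_ (norm_pos_iff.2 h0)
  nlinarith

/-- The resolvent of the closure of a dissipative operator with dense range. -/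
theorem Dissipative.exists_resolvent [CompleteSpace E] {A : E →ₗ.[ℂ] E} {c : ℝ}
    (h : Dissipative A c) (hd : Dense (A.domain : Set E)) {lam : ℂ} (hlam : c < lam.re)
    (hr : Dense {y : E | ∃ x : A.domain, lam • (x : E) - A x = y}) :
    ∃ R : E →L[ℂ] E,
      (∀ f : E, ∃ hf : R f ∈ A.closure.domain, lam • R f - A.closure ⟨R f, hf⟩ = f) ∧
      ∀ x : A.closure.domain, R (lam • (x : E) - A.closure x) = x := by
  have hcl := (h.isClosable hd).graph_closure_eq_closure_graph
  set G := A.graph.topologicalClosure with hG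
  -- `λ - A` becomes a bounded map `Φ` on the closed graph, a complete space. The lower bound makes
  -- `Φ` injective with closed range, the range is dense, so `Φ` is bijective with bounded inverse.
  -- The resolvent is the first coordinate of this inverse.
  set Φ : G →L[ℂ] E :=
    (lam • ContinuousLinearMap.fst ℂ E E - ContinuousLinearMap.snd ℂ E E).comp G.subtypeL with hΦ
  have Φa : ∀ p : G, Φ p = lam • (p : E × E).1 - (p : E × E).2 := fun p => rfl
  set δ := lam.re - c with hδ
  have δ0 : 0 < δ := sub_pos.2 hlam
  have b1 : ∀ p : G, ‖(p : E × E).1‖ ≤ δ⁻¹ * ‖Φ p‖ := fun p => by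
    rw [inv_mul_eq_div, le_div_iff₀ δ0, mul_comm, Φa]
    exact h.norm_le lam p.2
  have b2 : ∀ p : G, ‖(p : E × E).2‖ ≤ (‖lam‖ * δ⁻¹ + 1) * ‖Φ p‖ := fun p => by
    have e : (p : E × E).2 = lam • (p : E × E).1 - Φ p := by rw [Φa]; abel
    rw [e]
    refine (norm_sub_le _ _).trans ?_
    rw [norm_smul]
    nlinarith [mul_le_mul_of_nonneg_left (b1 p) (norm_nonneg lam)]
  have anti : AntilipschitzWith ((δ⁻¹ + (‖lam‖ * δ⁻¹ + 1)).toNNReal) Φ := by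
    refine ContinuousLinearMap.antilipschitz_of_bound Φ fun p => ?_
    rw [Real.coe_toNNReal _ (by positivity)]
    have c1 : 0 ≤ δ⁻¹ * ‖Φ p‖ := by positivity
    have c2 : 0 ≤ (‖lam‖ * δ⁻¹ + 1) * ‖Φ p‖ := by positivity
    -- The norm on the product is the maximum norm, so both coordinates are bounded separately.
    refine (max_le (a := ‖(p : E × E).1‖) ((b1 p).trans ?_) ((b2 p).trans ?_))
    · rw [add_mul]; linarith
    · rw [add_mul]; linarith
  have hclosed : IsClosed (Set.range Φ) := anti.isClosed_range Φ.uniformContinuous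
  have hrange : Set.range Φ = Set.univ := by
    rw [← hclosed.closure_eq, Set.eq_univ_iff_forall]
    refine fun y => closure_mono ?_ (hr y)
    rintro _ ⟨x, rfl⟩
    exact ⟨⟨(x, A x), A.graph.le_topologicalClosure (A.mem_graph x)⟩, rfl⟩
  have hker : Φ.ker = ⊥ := LinearMap.ker_eq_bot.2 anti.injective
  have hran : Φ.range = ⊤ := LinearMap.range_eq_top.2 (Set.range_eq_univ.1 hrange)
  set e := ContinuousLinearEquiv.ofBijective Φ hker hran with he
  refine ⟨(ContinuousLinearMap.fst ℂ E E).comp (G.subtypeL.comp (e.symm : E →L[ℂ] G)),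
    fun f => ?_, fun x => ?_⟩
  · have hm : ((e.symm f : G) : E × E) ∈ A.closure.graph :=
      (SetLike.ext_iff.1 hcl _).1 (e.symm f).2
    obtain ⟨x, h1, h2⟩ := (LinearPMap.mem_graph_iff _).1 hm
    refine ⟨?_, ?_⟩
    · change ((e.symm f : G) : E × E).1 ∈ _
      rw [← h1]; exact x.2
    · have hx : A.closure ⟨((e.symm f : G) : E × E).1, by rw [← h1]; exact x.2⟩ =
          ((e.symm f : G) : E × E).2 := by
        rw [← h2]; congr 1; exact Subtype.ext h1.symm
      change lam • ((e.symm f : G) : E × E).1 - A.closure ⟨((e.symm f : G) : E × E).1, _⟩ = f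
      rw [hx, ← Φa]
      exact ContinuousLinearEquiv.ofBijective_apply_symm_apply Φ hker hran f
  · have hm : ((x : E), A.closure x) ∈ G :=
      (SetLike.ext_iff.1 hcl _).2 (A.closure.mem_graph x)
    have := ContinuousLinearEquiv.ofBijective_symm_apply_apply Φ hker hran ⟨_, hm⟩
    rw [Φa] at this
    change ((e.symm (lam • (x : E) - A.closure x) : G) : E × E).1 = x
    rw [he, this]

end Dissipative

/-! ### The free operator is dissipative and densely defined -/

theorem inner_rep {x y : H} {f g f' g' : ℝ → ℂ} (hx : Rep x f g) (hy : Rep y f' g') :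
    inner ℂ x y = (∫ ρ, f' ρ * conj (f ρ) ∂μ) + ∫ ρ, g' ρ * conj (g ρ) ∂μ := by
  rw [WithLp.prod_inner_apply]
  congr 1
  · rw [L2.inner_def]
    refine integral_congr_ae ?_
    filter_upwards [hx.1, hy.1] with ρ h1 h2
    rw [← h1, ← h2, RCLike.inner_apply]; rfl
  · rw [L2.inner_def]
    refine integral_congr_ae ?_
    filter_upwards [hx.2, hy.2] with ρ h1 h2
    rw [← h1, ← h2, RCLike.inner_apply]; rfl

theorem inner_rep_interval {x y : H} {f g f' g' : ℝ → ℂ} (hx : Rep x f g) (hy : Rep y f' g')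
    (hf : ContinuousOn f I) (hg : ContinuousOn g I) (hf' : ContinuousOn f' I)
    (hg' : ContinuousOn g' I) :
    inner ℂ x y = ∫ ρ in (0 : ℝ)..1, (f' ρ * conj (f ρ) + g' ρ * conj (g ρ)) := by
  have c : ∀ {h k : ℝ → ℂ}, ContinuousOn h I → ContinuousOn k I →
      IntervalIntegrable (fun ρ => k ρ * conj (h ρ)) volume 0 1 := fun hh hk =>
    ContinuousOn.ii (hk.mul (Complex.continuous_conj.comp_continuousOn hh))
  rw [inner_rep hx hy, integral_μ, integral_μ, ← intervalIntegral.integral_add (c hf hf') (c hg hg')]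

/-- The transport terms are the derivative of the flux `Φ = -(ρ/2)(|f|² + |g|²) + Re (f ḡ)` up to
zeroth order terms: differentiating the weight `ρ/2` returns `1/2` of the damping `2`, which leaves
`3/2`. The flux vanishes at `0` because `f(0) = 0`, and at `1` it is `-|f - g|²/2 ≤ 0`. -/
theorem dissipative_freeTilde : Dissipative freeTilde (-(3 / 2)) := by
  intro x
  obtain ⟨f, g, hf, hg, h0, hx⟩ := exists_rep_of_mem_domain x.2
  have hA := rep_freeTilde hx hf hg h0
  have cf := hf.continuousOn
  have cg := hg.continuousOn
  have cf1 := (contDiffOn_derivWithin_infty hf).continuousOn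
  have cg1 := (contDiffOn_derivWithin_infty hg).continuousOn
  have df : ∀ ρ ∈ Ioo (0 : ℝ) 1, HasDerivAt f (derivWithin f I ρ) ρ := fun ρ hρ =>
    hasDerivAt_of_contDiffOn (smooth_one hf) hρ
  have dg : ∀ ρ ∈ Ioo (0 : ℝ) 1, HasDerivAt g (derivWithin g I ρ) ρ := fun ρ hρ =>
    hasDerivAt_of_contDiffOn (smooth_one hg) hρ
  set f1 := derivWithin f I
  set g1 := derivWithin g I
  have ccf : ContinuousOn (fun ρ => conj (f ρ)) I := Complex.continuous_conj.comp_continuousOn cf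
  have ccg : ContinuousOn (fun ρ => conj (g ρ)) I := Complex.continuous_conj.comp_continuousOn cg
  have e2 : ‖(x : H)‖ ^ 2 = ∫ ρ in (0 : ℝ)..1, (‖f ρ‖ ^ 2 + ‖g ρ‖ ^ 2) := by
    have := inner_rep_interval hx hx cf cg cf cg
    have h3 : inner ℂ (x : H) (x : H) = ((‖(x : H)‖ ^ 2 : ℝ) : ℂ) := by
      rw [inner_self_eq_norm_sq_to_K]; norm_cast
    rw [h3] at this
    have h4 : ∀ ρ, f ρ * conj (f ρ) + g ρ * conj (g ρ) = ((‖f ρ‖ ^ 2 + ‖g ρ‖ ^ 2 : ℝ) : ℂ) := by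
      intro ρ
      rw [Complex.mul_conj, Complex.mul_conj, Complex.normSq_eq_norm_sq, Complex.normSq_eq_norm_sq]
      push_cast; rfl
    simp only [h4] at this
    rw [intervalIntegral.integral_ofReal] at this
    exact_mod_cast this
  rw [inner_rep_interval hx hA cf cg (by fun_prop) (by fun_prop), e2]
  set N : ℝ → ℝ := fun ρ => ‖f ρ‖ ^ 2 + ‖g ρ‖ ^ 2 with hN
  set q : ℝ → ℂ := fun ρ => (-(ρ : ℂ) * f1 ρ - 2 * f ρ + g1 ρ) * conj (f ρ) +
    (f1 ρ - ρ * g1 ρ - 2 * g ρ) * conj (g ρ) with hq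
  have cN : ContinuousOn N I := by fun_prop
  have cq : ContinuousOn q I := by fun_prop
  have iN : IntervalIntegrable N volume 0 1 :=
    ContinuousOn.intervalIntegrable (by rwa [uIcc_of_le zero_le_one])
  have iq : IntervalIntegrable q volume 0 1 := ContinuousOn.ii cq
  have e1 : (∫ ρ in (0 : ℝ)..1, q ρ).re = ∫ ρ in (0 : ℝ)..1, (q ρ).re := by
    rw [intervalIntegral.integral_of_le zero_le_one, intervalIntegral.integral_of_le zero_le_one]
    exact (integral_re iq.1).symm
  have iqr : IntervalIntegrable (fun ρ => (q ρ).re) volume 0 1 :=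
    ContinuousOn.intervalIntegrable (by
      rw [uIcc_of_le zero_le_one]; exact Complex.continuous_re.comp_continuousOn cq)
  set Φ : ℝ → ℝ := fun ρ => -(ρ / 2) * (‖f ρ‖ ^ 2 + ‖g ρ‖ ^ 2) + inner ℝ (f ρ) (g ρ) with hΦ
  have key := intervalIntegral.integral_eq_sub_of_hasDerivAt_of_le zero_le_one
    (f := Φ) (f' := fun ρ => (q ρ).re + 3 / 2 * N ρ) (by fun_prop) (fun ρ hρ => by
      have k := (((hasDerivAt_id ρ).div_const 2).fun_neg.fun_mul
        ((df ρ hρ).norm_sq.fun_add (dg ρ hρ).norm_sq)).fun_add ((df ρ hρ).inner ℝ (dg ρ hρ))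
      refine k.congr_deriv ?_
      simp only [hq, hN, Complex.inner, ← Complex.normSq_eq_norm_sq, Complex.normSq_apply]
      simp
      ring) (iqr.add (iN.const_mul _))
  rw [intervalIntegral.integral_add iqr (iN.const_mul _), intervalIntegral.integral_const_mul] at key
  rw [e1]
  have z0 : Φ 0 = 0 := by simp [hΦ, h0]
  have z1 : Φ 1 ≤ 0 := by
    have h1 := norm_sub_sq_real (f 1) (g 1)
    have h2 : Φ 1 = -(‖f 1 - g 1‖ ^ 2) / 2 := by rw [h1]; simp only [hΦ]; ring
    rw [h2]
    have := sq_nonneg ‖f 1 - g 1‖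
    linarith
  rw [z0] at key
  linarith

theorem dense_smooth_L2 : Dense {y : L2 | ∃ f : ℝ → ℂ, ContDiffOn ℝ ∞ f I ∧ y =ᵐ[μ] f} := by
  refine (Lp.dense_hasCompactSupport_contDiff (E := ℝ) (F := ℂ) (μ := μ) (p := 2)
    (by norm_num)).mono ?_
  rintro y ⟨f, hf, -, hs⟩
  exact ⟨f, hs.contDiffOn, hf⟩

theorem dense_smooth : Dense {x : H | ∃ f g : ℝ → ℂ, ContDiffOn ℝ ∞ f I ∧ ContDiffOn ℝ ∞ g I ∧
    Rep x f g} := by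
  refine ((dense_smooth_L2.prod dense_smooth_L2).preimage
    (WithLp.homeomorphProd 2 L2 L2).isOpenMap).mono ?_
  rintro x ⟨⟨f, hf, h1⟩, ⟨g, hg, h2⟩⟩
  exact ⟨f, g, hf, hg, h1, h2⟩

/-- The condition `f(0) = 0` is invisible in `L²`. A vector orthogonal to the domain is orthogonal
to all pairs `(0, g)` and `(ρ f, 0)` with smooth `f`, `g`; hence its second coordinate and `ρ` times
its first vanish almost everywhere. -/
theorem dense_freeTilde_domain : Dense (freeTilde.domain : Set H) := by
  rw [Submodule.dense_iff_topologicalClosure_eq_top, Submodule.topologicalClosure_eq_top_iff,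
    Submodule.eq_bot_iff]
  intro v hv
  rw [Submodule.mem_orthogonal] at hv
  have hvr : Rep v v.fst v.snd := ⟨Filter.EventuallyEq.rfl, Filter.EventuallyEq.rfl⟩
  have hs : v.snd = 0 := by
    refine dense_smooth_L2.eq_zero_of_inner_right (𝕜 := ℂ) fun y ⟨g, hg, hy⟩ => ?_
    have hx : Rep (WithLp.toLp 2 ((0 : L2), y)) (fun _ => 0) g := ⟨Lp.coeFn_zero ℂ 2 μ, hy⟩
    have := hv _ (hx.mem_domain contDiffOn_const hg rfl)
    simpa [WithLp.prod_inner_apply] using this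
  have hm : MemLp (fun ρ : ℝ => (ρ : ℂ) * v.fst ρ) 2 μ := by
    refine (Lp.memLp v.fst).of_le
      ((by fun_prop : Continuous fun ρ : ℝ => (ρ : ℂ)).aestronglyMeasurable.mul
        (Lp.aestronglyMeasurable _)) ?_
    filter_upwards [ae_restrict_mem measurableSet_Ioo] with ρ hρ
    rw [norm_mul, Complex.norm_real, Real.norm_of_nonneg hρ.1.le]
    exact mul_le_of_le_one_left (norm_nonneg _) hρ.2.le
  have hw : hm.toLp = 0 := by
    refine dense_smooth_L2.eq_zero_of_inner_right (𝕜 := ℂ) fun y ⟨f, hf, hy⟩ => ?_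
    have sf : ContDiffOn ℝ ∞ (fun ρ : ℝ => (ρ : ℂ) * f ρ) I := contDiff_coe.contDiffOn.mul hf
    obtain ⟨x, hx⟩ := exists_rep sf.continuousOn (continuousOn_const (c := (0 : ℂ)))
    have := hv _ (hx.mem_domain sf contDiffOn_const (by simp))
    rw [inner_rep hx hvr] at this
    simp only [map_zero, mul_zero, integral_zero, add_zero] at this
    rw [L2.inner_def, ← this]
    refine integral_congr_ae ?_
    filter_upwards [hm.coeFn_toLp, hy] with ρ h1 h2
    rw [h1, h2, RCLike.inner_apply, map_mul, Complex.conj_ofReal]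
    change _ * conj (f ρ) = _
    ring
  have hf : v.fst = 0 := by
    refine Lp.ext ?_
    have h0 : (fun ρ : ℝ => (ρ : ℂ) * v.fst ρ) =ᵐ[μ] 0 := by
      refine hm.coeFn_toLp.symm.trans ?_
      rw [hw]; exact Lp.coeFn_zero ℂ 2 μ
    filter_upwards [h0, Lp.coeFn_zero ℂ 2 μ, ae_restrict_mem measurableSet_Ioo] with ρ h1 h2 h3
    rw [h2]
    have : (ρ : ℂ) ≠ 0 := by exact_mod_cast h3.1.ne'
    simpa [this] using h1
  exact WithLp.ofLp_injective 2 (Prod.ext hf hs)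

/-! ### Explicit solutions of the resolvent equation -/

/-- The power `(1 + ρ)^z`. -/
def onePow (z : ℂ) (ρ : ℝ) : ℂ := Complex.exp (z * (Real.log (1 + ρ) : ℂ))

theorem contDiffOn_onePow (z : ℂ) {n : WithTop ℕ∞} : ContDiffOn ℝ n (onePow z) I := by
  have h1 : ContDiffOn ℝ n (fun ρ : ℝ => Real.log (1 + ρ)) I :=
    ContDiffOn.log (by fun_prop) fun ρ hρ => by have := hρ.1; positivity
  have h2 : ContDiffOn ℝ n (fun ρ : ℝ => z * (Real.log (1 + ρ) : ℂ)) I :=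
    contDiffOn_const.mul (contDiff_coe.comp_contDiffOn h1)
  exact h2.cexp

theorem one_add_ne_zero {ρ : ℝ} (hρ : ρ ∈ I) : (1 + ρ : ℂ) ≠ 0 := by
  have : (1 + ρ : ℝ) ≠ 0 := by have := hρ.1; positivity
  exact_mod_cast this

theorem hasDerivWithinAt_onePow (z : ℂ) {ρ : ℝ} (hρ : ρ ∈ I) :
    HasDerivWithinAt (onePow z) (z / (1 + ρ) * onePow z ρ) I ρ := by
  have h0 : (1 + ρ : ℝ) ≠ 0 := by have := hρ.1; positivity
  have h1 : HasDerivAt (fun r : ℝ => Real.log (1 + r)) (1 / (1 + ρ)) ρ :=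
    ((hasDerivAt_id ρ).const_add 1).log h0
  have h2 := (h1.ofReal_comp.const_mul z).cexp.hasDerivWithinAt (s := I)
  refine h2.congr_deriv ?_
  rw [onePow]
  push_cast
  ring

/-- With `z = λ + 1`, the integrating factor of the equation for `b` and its source weight cancel up
to the leading coefficient `1 + ρ`. -/
theorem onePow_mul {z : ℂ} {ρ : ℝ} (hρ : ρ ∈ I) :
    onePow (-(z + 1)) ρ * onePow z ρ = 1 / (1 + ρ) := by
  have h0 : (0 : ℝ) < 1 + ρ := by have := hρ.1; positivity
  rw [onePow, onePow, ← Complex.exp_add]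
  have : -(z + 1) * (Real.log (1 + ρ) : ℂ) + z * (Real.log (1 + ρ) : ℂ) =
      ((-Real.log (1 + ρ) : ℝ) : ℂ) := by push_cast; ring
  rw [this, ← Complex.ofReal_exp, Real.exp_neg, Real.exp_log h0]
  push_cast
  rw [one_div]

theorem onePow_zero_right (z : ℂ) : onePow z 0 = 1 := by simp [onePow]

theorem one_sub_mem_I {ρ : ℝ} (hρ : ρ ∈ I) : 1 - ρ ∈ I :=
  ⟨by linarith [hρ.2], by linarith [hρ.1]⟩

theorem contDiffOn_reflect {n : WithTop ℕ∞} {h : ℝ → ℂ} (hh : ContDiffOn ℝ n h I) :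
    ContDiffOn ℝ n (fun ρ => h (1 - ρ)) I :=
  hh.comp (by fun_prop) fun _ hρ => one_sub_mem_I hρ

theorem continuousOn_reflect {h : ℝ → ℂ} (hh : ContinuousOn h I) :
    ContinuousOn (fun ρ => h (1 - ρ)) I :=
  hh.comp (by fun_prop) fun _ hρ => one_sub_mem_I hρ

/-- The solution of `(lam + 2) a - (1 - ρ) a' = h` that is regular at `1`. -/
def inSol (lam : ℂ) (h : ℝ → ℂ) (ρ : ℝ) : ℂ := M (lam + 1) (fun s => h (1 - s)) (1 - ρ)

/-- The solution of `(lam + 2) b + (1 + ρ) b' = h` with `b(0) = c`. -/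
def outSol (lam c : ℂ) (h : ℝ → ℂ) (ρ : ℝ) : ℂ :=
  onePow (-(lam + 1 + 1)) ρ * (c + J (fun s => onePow (lam + 1) s * h s) ρ)

theorem contDiffOn_inSol {lam : ℂ} (hlam : -(3 / 2) < lam.re) {n : ℕ} {h : ℝ → ℂ}
    (hh : ContDiffOn ℝ n h I) : ContDiffOn ℝ n (inSol lam h) I :=
  contDiffOn_reflect (contDiffOn_M n (by simp; linarith) (contDiffOn_reflect hh))

theorem contDiffOn_outSol (lam c : ℂ) {n : ℕ} {h : ℝ → ℂ}
    (hh : ContDiffOn ℝ n h I) : ContDiffOn ℝ n (outSol lam c h) I :=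
  (contDiffOn_onePow _).mul (contDiffOn_const.add
    ((contDiffOn_J ((contDiffOn_onePow _).mul hh)).of_le (by norm_cast; omega)))

theorem outSol_zero (lam c : ℂ) (h : ℝ → ℂ) : outSol lam c h 0 = c := by
  simp [outSol, onePow_zero_right]

/-- In the variable `1 - ρ` this is `M_ode` with `ν = λ + 1`. Using the mean excludes the singular
homogeneous solution `(1 - ρ)^(-(λ+2))`. -/
theorem inSol_ode {lam : ℂ} (hlam : -(3 / 2) < lam.re) {h : ℝ → ℂ} (hh : ContDiffOn ℝ 1 h I)
    {ρ : ℝ} (hρ : ρ ∈ I) :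
    (lam + 2) * inSol lam h ρ - (1 - ρ) * derivWithin (inSol lam h) I ρ = h ρ := by
  have hν : -1 < (lam + 1).re := by simp; linarith
  have hr := one_sub_mem_I hρ
  have hd : HasDerivWithinAt (inSol lam h)
      (-(M (lam + 1 + 1) (derivWithin (fun s => h (1 - s)) I) (1 - ρ))) I ρ := by
    have h1 := hasDerivWithinAt_M hν (contDiffOn_reflect hh) hr
    have h2 : HasDerivWithinAt (fun r : ℝ => 1 - r) (-1) I ρ :=
      ((hasDerivAt_id ρ).const_sub 1).hasDerivWithinAt
    refine (h1.scomp ρ h2 fun r hr' => one_sub_mem_I hr').congr_deriv ?_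
    simp
  have := M_ode hν (contDiffOn_reflect hh) hr
  rw [hd.derivWithin (uniqueDiffOn_I ρ hρ), inSol]
  rw [sub_sub_cancel] at this
  rw [← this]
  push_cast
  ring

/-- Variation of constants: the equation says that `(1 + ρ)^(λ+2) b` has derivative `(1 + ρ)^(λ+1)
h`. There is no singular point in `[0,1]`, so the initial value is free. -/
theorem outSol_ode (lam c : ℂ) {h : ℝ → ℂ} (hh : ContinuousOn h I) {ρ : ℝ} (hρ : ρ ∈ I) :
    (lam + 2) * outSol lam c h ρ + (1 + ρ) * derivWithin (outSol lam c h) I ρ = h ρ := by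
  have hc : ContinuousOn (fun s => onePow (lam + 1) s * h s) I :=
    (contDiffOn_onePow (n := 0) _).continuousOn.mul hh
  have hd := (hasDerivWithinAt_onePow (-(lam + 1 + 1)) hρ).fun_mul
    ((hasDerivWithinAt_J hc hρ).const_add c)
  have e := onePow_mul (z := lam + 1) hρ
  have hne := one_add_ne_zero hρ
  have hd' : derivWithin (outSol lam c h) I ρ = _ := hd.derivWithin (uniqueDiffOn_I ρ hρ)
  rw [hd', ← mul_assoc, e, outSol]
  field_simp
  ring

/-- The component `D² u₁` of the solution of the resolvent equation of the free operator with right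
side represented by `(p, q)`. -/
def solFst (lam : ℂ) (p q : ℝ → ℂ) (ρ : ℝ) : ℂ :=
  (inSol lam (p + q) ρ + outSol lam (-inSol lam (p + q) 0) (p - q) ρ) / 2

/-- The component `u₂'` of the solution of the resolvent equation of the free operator with right
side represented by `(p, q)`. -/
def solSnd (lam : ℂ) (p q : ℝ → ℂ) (ρ : ℝ) : ℂ :=
  (inSol lam (p + q) ρ - outSol lam (-inSol lam (p + q) 0) (p - q) ρ) / 2

theorem contDiffOn_sol {lam : ℂ} (hlam : -(3 / 2) < lam.re) {n : ℕ} {p q : ℝ → ℂ}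
    (hp : ContDiffOn ℝ n p I) (hq : ContDiffOn ℝ n q I) :
    ContDiffOn ℝ n (solFst lam p q) I ∧ ContDiffOn ℝ n (solSnd lam p q) I :=
  ⟨((contDiffOn_inSol hlam (hp.add hq)).add (contDiffOn_outSol _ _ (hp.sub hq))).div_const 2,
    ((contDiffOn_inSol hlam (hp.add hq)).sub (contDiffOn_outSol _ _ (hp.sub hq))).div_const 2⟩

/-- This boundary condition dictates the initial value `-a(0)` of the outgoing part. -/
theorem solFst_zero (lam : ℂ) (p q : ℝ → ℂ) : solFst lam p q 0 = 0 := by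
  simp [solFst, outSol_zero]

/-- Adding and subtracting the two components of the resolvent equation decouples it: `a = f + g`
satisfies the equation of `inSol` with source `p + q`, and `b = f - g` that of `outSol` with source
`p - q`. -/
theorem exists_solution {lam : ℂ} (hlam : -(3 / 2) < lam.re) {p q : ℝ → ℂ}
    (hp : ContDiffOn ℝ ∞ p I) (hq : ContDiffOn ℝ ∞ q I) :
    ∃ x : freeTilde.domain, Rep x (solFst lam p q) (solSnd lam p q) ∧
      Rep (lam • (x : H) - freeTilde x) p q := by
  have sF : ContDiffOn ℝ ∞ (solFst lam p q) I := contDiffOn_top_of_nat fun n =>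
    (contDiffOn_sol hlam (contDiffOn_nat hp n) (contDiffOn_nat hq n)).1
  have sG : ContDiffOn ℝ ∞ (solSnd lam p q) I := contDiffOn_top_of_nat fun n =>
    (contDiffOn_sol hlam (contDiffOn_nat hp n) (contDiffOn_nat hq n)).2
  obtain ⟨x, hx⟩ := exists_rep sF.continuousOn sG.continuousOn
  refine ⟨⟨x, hx.mem_domain sF sG (solFst_zero lam p q)⟩, hx, ?_⟩
  have hA := rep_freeTilde (x := ⟨x, hx.mem_domain sF sG (solFst_zero lam p q)⟩) hx sF sG
    (solFst_zero lam p q)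
  set a := inSol lam (p + q) with ha
  set b := outSol lam (-a 0) (p - q) with hb
  have sa : ContDiffOn ℝ 1 a I := by
    exact_mod_cast contDiffOn_inSol (n := 1) hlam (contDiffOn_nat (hp.add hq) 1)
  have sb : ContDiffOn ℝ 1 b I := by
    exact_mod_cast contDiffOn_outSol (n := 1) lam (-a 0) (contDiffOn_nat (hp.sub hq) 1)
  have oa : ∀ ρ ∈ I, (lam + 2) * a ρ - (1 - ρ) * derivWithin a I ρ = (p + q) ρ := fun ρ hρ =>
    inSol_ode hlam (smooth_one (hp.add hq)) hρ
  have ob : ∀ ρ ∈ I, (lam + 2) * b ρ + (1 + ρ) * derivWithin b I ρ = (p - q) ρ := fun ρ hρ =>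
    outSol_ode lam _ (hp.sub hq).continuousOn hρ
  have da : ∀ ρ ∈ I, HasDerivWithinAt a (derivWithin a I ρ) I ρ := fun ρ hρ =>
    hasDerivWithinAt_of_contDiffOn sa hρ
  have db : ∀ ρ ∈ I, HasDerivWithinAt b (derivWithin b I ρ) I ρ := fun ρ hρ =>
    hasDerivWithinAt_of_contDiffOn sb hρ
  have dF : ∀ ρ ∈ I, derivWithin (solFst lam p q) I ρ =
      (derivWithin a I ρ + derivWithin b I ρ) / 2 := fun ρ hρ =>
    (((da ρ hρ).fun_add (db ρ hρ)).div_const 2).derivWithin (uniqueDiffOn_I ρ hρ)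
  have dG : ∀ ρ ∈ I, derivWithin (solSnd lam p q) I ρ =
      (derivWithin a I ρ - derivWithin b I ρ) / 2 := fun ρ hρ =>
    (((da ρ hρ).fun_sub (db ρ hρ)).div_const 2).derivWithin (uniqueDiffOn_I ρ hρ)
  refine ((hx.smul lam).sub hA).congr (fun ρ hρ => ?_) fun ρ hρ => ?_
  · have hm : ρ ∈ I := Ioo_subset_Icc_self hρ
    simp only [Pi.sub_apply, Pi.smul_apply, smul_eq_mul, dF ρ hm, dG ρ hm, solFst, ← ha, ← hb]
    linear_combination (oa ρ hm + ob ρ hm) / 2 + (1 / 2) * (Pi.add_apply p q ρ) +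
      (1 / 2) * (Pi.sub_apply p q ρ)
  · have hm : ρ ∈ I := Ioo_subset_Icc_self hρ
    simp only [Pi.sub_apply, Pi.smul_apply, smul_eq_mul, dF ρ hm, dG ρ hm, solSnd, ← ha, ← hb]
    linear_combination (oa ρ hm - ob ρ hm) / 2 + (1 / 2) * (Pi.add_apply p q ρ) -
      (1 / 2) * (Pi.sub_apply p q ρ)

theorem dense_range_freeTilde {lam : ℂ} (hlam : -(3 / 2) < lam.re) :
    Dense {y : H | ∃ x : freeTilde.domain, lam • (x : H) - freeTilde x = y} := by
  refine dense_smooth.mono ?_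
  rintro y ⟨p, q, hp, hq, hy⟩
  obtain ⟨x, -, hx⟩ := exists_solution hlam hp hq
  exact ⟨x, hx.ext hy⟩

/-! ### Continuous right sides -/

theorem norm_L2_le {y : L2} {w : ℝ → ℂ} (hy : y =ᵐ[μ] w) {C : ℝ} (hC0 : 0 ≤ C)
    (hC : ∀ ρ ∈ I, ‖w ρ‖ ≤ C) : ‖y‖ ≤ C := by
  have := Lp.norm_le_of_ae_bound (f := y) hC0 (by
    filter_upwards [hy, ae_restrict_mem measurableSet_Ioo] with ρ h1 h2
    rw [h1]; exact hC ρ (Ioo_subset_Icc_self h2))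
  -- The interval has total mass one, so the `L²` norm is at most the supremum.
  have hm : (measureUnivNNReal μ : ℝ) = 1 := by simp [measureUnivNNReal]
  simpa [hm] using this

theorem Rep.norm_le {x : H} {f g : ℝ → ℂ} (hx : Rep x f g) {C : ℝ} (hC0 : 0 ≤ C)
    (hf : ∀ ρ ∈ I, ‖f ρ‖ ≤ C) (hg : ∀ ρ ∈ I, ‖g ρ‖ ≤ C) : ‖x‖ ≤ 2 * C := by
  have h1 := norm_L2_le hx.1 hC0 hf
  have h2 := norm_L2_le hx.2 hC0 hg
  rw [WithLp.prod_norm_eq_of_L2]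
  refine Real.sqrt_le_iff.2 ⟨by positivity, ?_⟩
  have h1' : ‖x.fst‖ ^ 2 ≤ C ^ 2 := pow_le_pow_left₀ (norm_nonneg _) h1 2
  have h2' : ‖x.snd‖ ^ 2 ≤ C ^ 2 := pow_le_pow_left₀ (norm_nonneg _) h2 2
  have h3 : ‖x.fst‖ ^ 2 + ‖x.snd‖ ^ 2 ≤ (2 * C) ^ 2 := by nlinarith
  exact h3

theorem norm_J_le {f : ℝ → ℂ} {C : ℝ} (hC : ∀ ρ ∈ I, ‖f ρ‖ ≤ C) {ρ : ℝ} (hρ : ρ ∈ I) :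
    ‖J f ρ‖ ≤ C := by
  have := intervalIntegral.norm_integral_le_of_norm_le_const (a := 0) (b := ρ) (f := f) (C := C)
    fun s hs => by
      rw [uIoc_of_le hρ.1] at hs
      exact hC s ⟨hs.1.le, hs.2.trans hρ.2⟩
  refine this.trans ?_
  have hC0 : 0 ≤ C := (norm_nonneg _).trans (hC 0 (by simp))
  rw [sub_zero, abs_of_nonneg hρ.1]
  exact mul_le_of_le_one_right hC0 hρ.2

/-- A bound uniform in the data lets the explicit formula pass to uniform limits. Only sources `(h,
0)` are needed, because the second component of `L'` is zero. -/
theorem exists_norm_sol_le {lam : ℂ} (hlam : -(3 / 2) < lam.re) : ∃ B : ℝ, 0 ≤ B ∧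
    ∀ (h : ℝ → ℂ) (C : ℝ), (∀ ρ ∈ I, ‖h ρ‖ ≤ C) → ∀ ρ ∈ I,
      ‖solFst lam h 0 ρ‖ ≤ B * C ∧ ‖solSnd lam h 0 ρ‖ ≤ B * C := by
  obtain ⟨P, hP⟩ := isCompact_Icc.exists_bound_of_continuousOn
    (contDiffOn_onePow (n := 0) (-(lam + 1 + 1))).continuousOn
  obtain ⟨Q, hQ⟩ := isCompact_Icc.exists_bound_of_continuousOn
    (contDiffOn_onePow (n := 0) (lam + 1)).continuousOn
  have z : (0 : ℝ) ∈ I := by simp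
  have P0 : 0 ≤ P := (norm_nonneg _).trans (hP 0 z)
  have Q0 : 0 ≤ Q := (norm_nonneg _).trans (hQ 0 z)
  have W0 := weight_nonneg (lam + 1)
  set W := weight (lam + 1)
  refine ⟨W + P * (W + Q), by positivity, fun h C hC ρ hρ => ?_⟩
  have C0 : 0 ≤ C := (norm_nonneg _).trans (hC 0 z)
  have ba : ∀ r ∈ I, ‖inSol lam h r‖ ≤ W * C := fun r hr =>
    norm_M_le (by simp; linarith) (fun s hs => hC _ (one_sub_mem_I hs)) (one_sub_mem_I hr)
  have bb : ‖outSol lam (-inSol lam h 0) h ρ‖ ≤ P * (W * C + Q * C) := by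
    rw [outSol, norm_mul]
    refine mul_le_mul (hP ρ hρ) ((norm_add_le _ _).trans (add_le_add ?_ ?_)) (norm_nonneg _) P0
    · rw [norm_neg]; exact ba 0 z
    · refine norm_J_le (fun s hs => ?_) hρ
      rw [norm_mul]
      exact mul_le_mul (hQ s hs) (hC s hs) (norm_nonneg _) Q0
  have bs : (W * C + P * (W * C + Q * C)) / 2 ≤ (W + P * (W + Q)) * C := by
    have : 0 ≤ (W + P * (W + Q)) * C := by positivity
    linarith
  constructor
  · rw [solFst, add_zero, sub_zero, norm_div, Complex.norm_ofNat]
    exact (div_le_div_of_nonneg_right ((norm_add_le _ _).trans (add_le_add (ba ρ hρ) bb))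
      zero_le_two).trans bs
  · rw [solSnd, add_zero, sub_zero, norm_div, Complex.norm_ofNat]
    exact (div_le_div_of_nonneg_right ((norm_sub_le _ _).trans (add_le_add (ba ρ hρ) bb))
      zero_le_two).trans bs

theorem inSol_sub {lam : ℂ} (hlam : -(3 / 2) < lam.re) {h k : ℝ → ℂ} (hh : ContinuousOn h I)
    (hk : ContinuousOn k I) {ρ : ℝ} (hρ : ρ ∈ I) :
    inSol lam (h - k) ρ = inSol lam h ρ - inSol lam k ρ :=
  M_sub (by simp; linarith) (continuousOn_reflect hh) (continuousOn_reflect hk) (one_sub_mem_I hρ)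

theorem outSol_sub {lam : ℂ} (c d : ℂ) {h k : ℝ → ℂ} (hh : ContinuousOn h I)
    (hk : ContinuousOn k I) {ρ : ℝ} (hρ : ρ ∈ I) :
    outSol lam (c - d) (h - k) ρ = outSol lam c h ρ - outSol lam d k ρ := by
  have hp := (contDiffOn_onePow (n := 0) (lam + 1)).continuousOn
  have e : J (fun s => onePow (lam + 1) s * (h - k) s) ρ =
      J (fun s => onePow (lam + 1) s * h s) ρ - J (fun s => onePow (lam + 1) s * k s) ρ := by
    simp only [J]
    refine Eq.trans ?_ (intervalIntegral.integral_sub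
      (intervalIntegrable_sub (ContinuousOn.ii (hp.mul hh)) hρ)
      (intervalIntegrable_sub (ContinuousOn.ii (hp.mul hk)) hρ))
    simp only [Pi.sub_apply, mul_sub]
  rw [outSol, outSol, outSol, e]
  ring

theorem sol_sub {lam : ℂ} (hlam : -(3 / 2) < lam.re) {h k : ℝ → ℂ} (hh : ContinuousOn h I)
    (hk : ContinuousOn k I) : EqOn (solFst lam (h - k) 0) (solFst lam h 0 - solFst lam k 0) I ∧
      EqOn (solSnd lam (h - k) 0) (solSnd lam h 0 - solSnd lam k 0) I := by
  have e : -inSol lam (h - k) 0 = -inSol lam h 0 - -inSol lam k 0 := by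
    rw [inSol_sub hlam hh hk (by simp)]; ring
  constructor <;> intro ρ hρ
  · simp only [solFst, Pi.sub_apply, add_zero, sub_zero]
    rw [e, inSol_sub hlam hh hk hρ, outSol_sub _ _ hh hk hρ]
    ring
  · simp only [solSnd, Pi.sub_apply, add_zero, sub_zero]
    rw [e, inSol_sub hlam hh hk hρ, outSol_sub _ _ hh hk hρ]
    ring

theorem contDiff_eval (p : Polynomial ℝ) : ContDiff ℝ ∞ (fun ρ : ℝ => p.eval ρ) := by
  simpa using p.contDiff_aeval (𝕜 := ℝ) ∞

/-- Weierstrass approximation of the real and imaginary parts, each to accuracy `ε/2`. -/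
theorem exists_smooth_near {h : ℝ → ℂ} (hh : ContinuousOn h I) {ε : ℝ} (hε : 0 < ε) :
    ∃ k : ℝ → ℂ, ContDiffOn ℝ ∞ k I ∧ ∀ ρ ∈ I, ‖(h - k) ρ‖ ≤ ε := by
  obtain ⟨p, hp⟩ := exists_polynomial_near_of_continuousOn 0 1 (fun ρ => (h ρ).re)
    (Complex.continuous_re.comp_continuousOn hh) (ε / 2) (by positivity)
  obtain ⟨q, hq⟩ := exists_polynomial_near_of_continuousOn 0 1 (fun ρ => (h ρ).im)
    (Complex.continuous_im.comp_continuousOn hh) (ε / 2) (by positivity)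
  refine ⟨fun ρ => ((p.eval ρ : ℝ) : ℂ) + ((q.eval ρ : ℝ) : ℂ) * Complex.I, ?_, fun ρ hρ => ?_⟩
  · exact ((contDiff_coe.comp (contDiff_eval p)).add
      ((contDiff_coe.comp (contDiff_eval q)).mul contDiff_const)).contDiffOn
  · refine (Complex.norm_le_abs_re_add_abs_im _).trans ?_
    have h1 := hp ρ hρ
    have h2 := hq ρ hρ
    rw [abs_sub_comm] at h1 h2
    simp only [Pi.sub_apply, Complex.sub_re, Complex.sub_im, Complex.add_re, Complex.add_im,
      Complex.mul_re, Complex.mul_im, Complex.ofReal_re, Complex.ofReal_im, Complex.I_re,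
      Complex.I_im]
    simp only [mul_zero, mul_one, sub_zero, add_zero, zero_add]
    linarith

/-- On continuous data, the resolvent of the free generator is given by the explicit solution. -/
theorem resolvent_eq_sol {lam : ℂ} (hlam : -(3 / 2) < lam.re) {R : H →L[ℂ] H}
    (hR : ∀ x : L₀.domain, R (lam • (x : H) - L₀ x) = x) {h : ℝ → ℂ} (hh : ContinuousOn h I)
    {x y : H} (hx : Rep x h 0) (hy : Rep y (solFst lam h 0) (solSnd lam h 0)) : R x = y := by
  obtain ⟨B, B0, hB⟩ := exists_norm_sol_le hlam
  rw [← sub_eq_zero, ← norm_le_zero_iff]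
  refine le_of_forall_pos_le_add fun ε hε => ?_
  rw [zero_add]
  -- Replacing `h` by a smooth `k` within `δ` costs `2 ‖R‖ δ` in the abstract resolvent and `2 B δ`
  -- in the formula; the `1` keeps the denominator positive.
  set δ := ε / (2 * ‖R‖ + 2 * B + 1) with hδ
  have δ0 : 0 < δ := by positivity
  obtain ⟨k, hk, hhk⟩ := exists_smooth_near hh δ0
  obtain ⟨z, hz1, hz2⟩ := exists_solution hlam hk (q := 0) contDiffOn_const
  -- For smooth data the explicit solution lies in the domain of `freeTilde`, hence in that of its
  -- closure, so `R` must return it.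
  have hzR : R (lam • (z : H) - freeTilde z) = z := by
    have hle := freeTilde.le_closure
    have e : L₀ ⟨z, hle.1 z.2⟩ = freeTilde z := (hle.2 rfl).symm
    have := hR ⟨z, hle.1 z.2⟩
    rwa [e] at this
  have s := sol_sub hlam hh hk.continuousOn
  have n1 : ‖x - (lam • (z : H) - freeTilde z)‖ ≤ 2 * δ :=
    (hx.sub hz2).norm_le δ0.le hhk fun ρ _ => by simpa using δ0.le
  have n2 : ‖y - z‖ ≤ 2 * (B * δ) := by
    refine (hy.sub hz1).norm_le (by positivity) (fun ρ hρ => ?_) fun ρ hρ => ?_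
    · rw [← s.1 hρ]; exact (hB _ _ hhk ρ hρ).1
    · rw [← s.2 hρ]; exact (hB _ _ hhk ρ hρ).2
  have e : R x - y = R (x - (lam • (z : H) - freeTilde z)) - (y - z) := by
    rw [map_sub, hzR]; abel
  rw [e]
  refine (norm_sub_le _ _).trans ((add_le_add ((R.le_opNorm _).trans
    (mul_le_mul_of_nonneg_left n1 (norm_nonneg _))) n2).trans ?_)
  have : (2 * ‖R‖ + 2 * B + 1) * δ = ε := by rw [hδ]; field_simp
  nlinarith

/-! ### The perturbation in coordinates, and its compactness -/

/-- The denominator `5 + 3 ρ²` of the potential. -/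
def potDen (ρ : ℝ) : ℂ := 5 + 3 * (ρ : ℂ) ^ 2

/-- The potential `V`. -/
def pot (ρ : ℝ) : ℂ := -144 * (5 - (ρ : ℂ) ^ 2) / potDen ρ ^ 2

/-- `D V`. -/
def potD (ρ : ℝ) : ℂ := 288 * (35 - 3 * (ρ : ℂ) ^ 2) / potDen ρ ^ 3

/-- `D² V`. -/
def potDD (ρ : ℝ) : ℂ := 576 * (18 * (ρ : ℂ) ^ 2 - 330) / potDen ρ ^ 4

theorem potDen_ne_zero (ρ : ℝ) : potDen ρ ≠ 0 := by
  have : (5 + 3 * ρ ^ 2 : ℝ) ≠ 0 := by positivity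
  have e : potDen ρ = ((5 + 3 * ρ ^ 2 : ℝ) : ℂ) := by simp [potDen]
  rw [e]; exact_mod_cast this

theorem V_eq_pot (ρ : ℝ) : (V ρ : ℂ) = pot ρ := by
  simp only [V, pot, potDen]; push_cast; ring

theorem contDiff_potDen {n : WithTop ℕ∞} : ContDiff ℝ n potDen :=
  contDiff_const.add (contDiff_const.mul (contDiff_coe.pow 2))

theorem contDiff_div_potDen {n : WithTop ℕ∞} {f : ℝ → ℂ} (hf : ContDiff ℝ n f) (k : ℕ) :
    ContDiff ℝ n fun ρ => f ρ / potDen ρ ^ k := by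
  simp only [div_eq_mul_inv]
  exact hf.mul ((contDiff_potDen.pow k).inv fun ρ => pow_ne_zero k (potDen_ne_zero ρ))

theorem contDiff_pot {n : WithTop ℕ∞} : ContDiff ℝ n pot :=
  contDiff_div_potDen (contDiff_const.mul (contDiff_const.sub (contDiff_coe.pow 2))) 2

theorem contDiff_potD {n : WithTop ℕ∞} : ContDiff ℝ n potD :=
  contDiff_div_potDen
    (contDiff_const.mul (contDiff_const.sub (contDiff_const.mul (contDiff_coe.pow 2)))) 3

theorem contDiff_potDD {n : WithTop ℕ∞} : ContDiff ℝ n potDD :=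
  contDiff_div_potDen
    (contDiff_const.mul ((contDiff_const.mul (contDiff_coe.pow 2)).sub contDiff_const)) 4

theorem hasDerivAt_potDen (ρ : ℝ) : HasDerivAt potDen (6 * ρ) ρ := by
  refine ((((hasDerivAt_ofReal ρ).fun_pow 2).const_mul 3).const_add 5).congr_deriv ?_
  push_cast; ring

theorem hasDerivAt_pot (ρ : ℝ) : HasDerivAt pot (ρ * potD ρ) ρ := by
  have k := ((((hasDerivAt_ofReal ρ).fun_pow 2).const_sub 5).const_mul (-144)).fun_div
    ((hasDerivAt_potDen ρ).fun_pow 2) (pow_ne_zero 2 (potDen_ne_zero ρ))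
  refine k.congr_deriv ?_
  have := potDen_ne_zero ρ
  simp only [potD]
  field_simp
  simp only [potDen]
  push_cast; ring

theorem hasDerivAt_potD (ρ : ℝ) : HasDerivAt potD (ρ * potDD ρ) ρ := by
  have k := (((((hasDerivAt_ofReal ρ).fun_pow 2).const_mul 3).const_sub 35).const_mul 288).fun_div
    ((hasDerivAt_potDen ρ).fun_pow 3) (pow_ne_zero 3 (potDen_ne_zero ρ))
  refine k.congr_deriv ?_
  have := potDen_ne_zero ρ
  simp only [potDD]
  field_simp
  simp only [potDen]
  push_cast; ring

/-- The function `D² (-V K² v)`. -/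
def potTerm (v : ℝ → ℂ) (ρ : ℝ) : ℂ :=
  -(potDD ρ * K (K v) ρ + 2 * (potD ρ * K v ρ) + pot ρ * v ρ)

/-- Both derivatives `D` are absorbed by `K²`, so no regularity is lost; the bootstrap for
eigenfunctions relies on this. -/
theorem contDiffOn_potTerm {n : ℕ} {v : ℝ → ℂ} (hv : ContDiffOn ℝ n v I) :
    ContDiffOn ℝ n (potTerm v) I := by
  have h1 : ContDiffOn ℝ n (K v) I := (contDiffOn_K hv).of_le (by norm_cast; omega)
  have h2 : ContDiffOn ℝ n (K (K v)) I := (contDiffOn_K h1).of_le (by norm_cast; omega)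
  exact (((contDiff_potDD.contDiffOn.mul h2).add
    (contDiffOn_const.mul (contDiff_potD.contDiffOn.mul h1))).add
    (contDiff_pot.contDiffOn.mul hv)).neg

theorem continuousOn_potTerm {v : ℝ → ℂ} (hv : ContinuousOn v I) : ContinuousOn (potTerm v) I := by
  have : ContDiffOn ℝ (0 : ℕ) v I := by exact_mod_cast contDiffOn_zero.2 hv
  exact (contDiffOn_potTerm this).continuousOn

theorem potTerm_congr {v w : ℝ → ℂ} (h : EqOn v w I) : EqOn (potTerm v) (potTerm w) I := by
  intro ρ hρ
  rw [potTerm, potTerm, KK_congr (ae_of_eqOn h) hρ, K_congr (ae_of_eqOn h) hρ, h hρ]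

/-- `D` is a derivation inverse to `K`, so `potTerm v` is the Leibniz expansion of `D²(-V K² v)`.
Integrating back twice produces no constants because `K v` and `K² v` vanish at `0`. -/
theorem K_K_potTerm {v : ℝ → ℂ} (hv : ContinuousOn v I) :
    EqOn (K (K (potTerm v))) (fun ρ => -(V ρ : ℂ) * K (K v) ρ) I := by
  have c1 := continuousOn_K (ContinuousOn.ii hv)
  have c2 := continuousOn_K (ContinuousOn.ii c1)
  have p0 : Continuous pot := (contDiff_pot (n := 0)).continuous
  have p1 : Continuous potD := (contDiff_potD (n := 0)).continuous
  have e1 : EqOn (K (potTerm v)) (fun ρ => -(potD ρ * K (K v) ρ + pot ρ * K v ρ)) I := by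
    refine J_eq_of_hasDerivAt (by fun_prop) (by simp) (fun ρ hρ => ?_)
      (intervalIntegrable_mul (ContinuousOn.ii (continuousOn_potTerm hv)))
    refine (((hasDerivAt_potD ρ).fun_mul (hasDerivAt_K c1 hρ)).fun_add
      ((hasDerivAt_pot ρ).fun_mul (hasDerivAt_K hv hρ))).fun_neg.congr_deriv ?_
    rw [potTerm]; ring
  have e2 : EqOn (K fun ρ => -(potD ρ * K (K v) ρ + pot ρ * K v ρ))
      (fun ρ => -pot ρ * K (K v) ρ) I := by
    refine J_eq_of_hasDerivAt (by fun_prop) (by simp) (fun ρ hρ => ?_)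
      (intervalIntegrable_mul (ContinuousOn.ii (by fun_prop)))
    refine ((hasDerivAt_pot ρ).fun_neg.fun_mul (hasDerivAt_K c1 hρ)).congr_deriv ?_
    ring
  intro ρ hρ
  simp only [K_congr (ae_of_eqOn e1) hρ, e2 hρ, V_eq_pot]

theorem continuousOn_funcs_snd (x : H) : ContinuousOn (J x.snd) I :=
  continuousOn_J (L2.intervalIntegrable _)

/-- The perturbation in coordinates. -/
theorem rep_L' (x : H) : Rep (L' x) (potTerm (J x.snd)) 0 := by
  have hv := continuousOn_funcs_snd x
  obtain ⟨y, hy⟩ := exists_rep (continuousOn_potTerm hv) (g := 0) continuousOn_const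
  have : L' x = y := by
    refine funcs_injective ((L'_spec x).trans (EqI.symm (hy.eqI.trans ⟨?_, ?_⟩)))
    · exact K_K_potTerm hv
    · intro ρ _; simp [J, potOp]
  rw [this]; exact hy

theorem norm_K_le {f : ℝ → ℂ} {C : ℝ} (hC : ∀ ρ ∈ I, ‖f ρ‖ ≤ C) {ρ : ℝ} (hρ : ρ ∈ I) :
    ‖K f ρ‖ ≤ C := by
  refine norm_J_le (f := fun s => (s : ℂ) * f s) (fun s hs => ?_) hρ
  rw [norm_mul, Complex.norm_real, Real.norm_of_nonneg hs.1]
  exact (mul_le_of_le_one_left (norm_nonneg _) hs.2).trans (hC s hs)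

theorem exists_norm_potTerm_le : ∃ B : ℝ, 0 ≤ B ∧ ∀ (v : ℝ → ℂ) (C : ℝ),
    (∀ ρ ∈ I, ‖v ρ‖ ≤ C) → ∀ ρ ∈ I, ‖potTerm v ρ‖ ≤ B * C := by
  have z : (0 : ℝ) ∈ I := by simp
  obtain ⟨B0, h0⟩ := isCompact_Icc.exists_bound_of_continuousOn
    ((contDiff_pot (n := 0)).continuous.continuousOn (s := I))
  obtain ⟨B1, h1⟩ := isCompact_Icc.exists_bound_of_continuousOn
    ((contDiff_potD (n := 0)).continuous.continuousOn (s := I))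
  obtain ⟨B2, h2⟩ := isCompact_Icc.exists_bound_of_continuousOn
    ((contDiff_potDD (n := 0)).continuous.continuousOn (s := I))
  have n0 := (norm_nonneg _).trans (h0 0 z)
  have n1 := (norm_nonneg _).trans (h1 0 z)
  have n2 := (norm_nonneg _).trans (h2 0 z)
  refine ⟨B2 + 2 * B1 + B0, by positivity, fun v C hC ρ hρ => ?_⟩
  have k1 : ∀ r ∈ I, ‖K v r‖ ≤ C := fun r hr => norm_K_le hC hr
  rw [potTerm, norm_neg, add_mul, add_mul, mul_assoc]
  refine (norm_add_le _ _).trans (add_le_add ((norm_add_le _ _).trans (add_le_add ?_ ?_)) ?_)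
  · rw [norm_mul]
    exact mul_le_mul (h2 ρ hρ) (norm_K_le k1 hρ) (norm_nonneg _) n2
  · rw [norm_mul, norm_mul, Complex.norm_ofNat]
    exact mul_le_mul_of_nonneg_left (mul_le_mul (h1 ρ hρ) (k1 ρ hρ) (norm_nonneg _) n1) zero_le_two
  · rw [norm_mul]
    exact mul_le_mul (h0 ρ hρ) (hC ρ hρ) (norm_nonneg _) n0

theorem potTerm_sub {v w : ℝ → ℂ} (hv : ContinuousOn v I) (hw : ContinuousOn w I) :
    EqOn (potTerm (v - w)) (potTerm v - potTerm w) I := by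
  intro ρ hρ
  have e : v - w = v + (-1 : ℂ) • w := by simp [sub_eq_add_neg]
  have cw : ContinuousOn ((-1 : ℂ) • w) I := hw.const_smul _
  have e1 : K (v - w) ρ = K v ρ - K w ρ := by
    rw [e, K_add (ContinuousOn.ii hv) (ContinuousOn.ii cw) hρ, Pi.add_apply, K_smul]
    simp [sub_eq_add_neg]
  have e2 : K (K (v - w)) ρ = K (K v) ρ - K (K w) ρ := by
    rw [e, KK_add (ContinuousOn.ii hv) (ContinuousOn.ii cw) hρ, Pi.add_apply, K_smul, K_smul]
    simp [sub_eq_add_neg]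
  simp only [potTerm, Pi.sub_apply]
  rw [e1, e2]
  ring

/-- Hölder continuity of primitives of square integrable functions. -/
theorem norm_J_sub_le (y : L2) {a b : ℝ} (ha : a ∈ I) (hb : b ∈ I) (hab : a ≤ b) :
    ‖J y b - J y a‖ ≤ √(b - a) * ‖y‖ := by
  have hs : Ioo a b ⊆ Ioo 0 1 := Ioo_subset_Ioo ha.1 hb.2
  have hm : MeasurableSet (Ioo a b) := measurableSet_Ioo
  have e0 : μ.restrict (Ioo a b) = volume.restrict (Ioo a b) := by
    rw [Measure.restrict_restrict hm, inter_eq_left.2 hs]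
  have hfin : μ (Ioo a b) ≠ ⊤ := measure_ne_top _ _
  -- The increment is the inner product of `y` with the indicator of `(a, b)`, whose norm is `√(b -
  -- a)`; Cauchy–Schwarz finishes.
  have e1 : J y b - J y a = inner ℂ (indicatorConstLp 2 hm hfin (1 : ℂ)) y := by
    rw [L2.inner_indicatorConstLp_one, e0, ← integral_Ioc_eq_integral_Ioo,
      ← intervalIntegral.integral_of_le hab]
    exact intervalIntegral.integral_interval_sub_left
      (intervalIntegrable_sub (L2.intervalIntegrable y) hb)
      (intervalIntegrable_sub (L2.intervalIntegrable y) ha)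
  have e2 : μ.real (Ioo a b) = b - a := by
    rw [measureReal_def, ← Measure.restrict_apply_univ, e0, Measure.restrict_apply_univ,
      Real.volume_Ioo, ENNReal.toReal_ofReal (sub_nonneg.2 hab)]
  rw [e1]
  refine (norm_inner_le_norm _ _).trans (mul_le_mul_of_nonneg_right ?_ (norm_nonneg _))
  refine norm_indicatorConstLp_le.trans_eq ?_
  rw [e2, Real.sqrt_eq_rpow]
  simp

theorem dist_J_le (y : L2) {a b : ℝ} (ha : a ∈ I) (hb : b ∈ I) :
    dist (J y a) (J y b) ≤ √(dist a b) * ‖y‖ := by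
  rcases le_total a b with h | h
  · rw [dist_comm, dist_eq_norm, Real.dist_eq, abs_sub_comm, abs_of_nonneg (sub_nonneg.2 h)]
    exact norm_J_sub_le y ha hb h
  · rw [dist_eq_norm, Real.dist_eq, abs_of_nonneg (sub_nonneg.2 h)]
    exact norm_J_sub_le y hb ha h

theorem norm_snd_le (x : H) : ‖x.snd‖ ≤ ‖x‖ := by
  rw [WithLp.prod_norm_eq_of_L2 x]
  refine Real.le_sqrt_of_sq_le ?_
  have := sq_nonneg ‖x.fst‖
  linarith

-- `L'` factors through `x ↦ u₂ ∈ C[0,1]`. The Hölder estimate makes the image of the unit ball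
-- bounded and equicontinuous, so its closure `closure A` is compact by Arzelà–Ascoli. The remaining
-- map `B` from `C[0,1]` to `𝓗` is Lipschitz by the supremum bound on `potTerm`.
open BoundedContinuousFunction in
theorem isCompactOperator_L' : IsCompactOperator L' := by
  rw [isCompactOperator_iff_exists_mem_nhds_image_subset_compact]
  -- Functions on the subtype are extended by constants so that `potTerm` applies; only their values
  -- on `[0,1]` matter.
  set ext : (I →ᵇ ℂ) → ℝ → ℂ := fun φ => IccExtend zero_le_one φ with hext
  have ext_apply : ∀ (φ : I →ᵇ ℂ) (ρ : ℝ) (hρ : ρ ∈ I), ext φ ρ = φ ⟨ρ, hρ⟩ := fun φ ρ hρ =>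
    IccExtend_of_mem _ _ hρ
  have cext : ∀ φ, ContinuousOn (ext φ) I := fun φ => φ.continuous.Icc_extend'.continuousOn
  have hB : ∀ φ : I →ᵇ ℂ, ∃ y : H, Rep y (potTerm (ext φ)) 0 := fun φ =>
    exists_rep (continuousOn_potTerm (cext φ)) continuousOn_const
  choose B hB using hB
  obtain ⟨C, C0, hC⟩ := exists_norm_potTerm_le
  have cB : Continuous B := by
    refine LipschitzWith.continuous (K := (2 * C).toNNReal) (LipschitzWith.of_dist_le_mul
      fun φ ψ => ?_)
    rw [Real.coe_toNNReal _ (by positivity), dist_eq_norm, mul_assoc]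
    refine ((hB φ).sub (hB ψ)).norm_le (by positivity) (fun ρ hρ => ?_) fun ρ _ => ?_
    · rw [← potTerm_sub (cext φ) (cext ψ) hρ]
      refine hC _ _ (fun r hr => ?_) ρ hρ
      rw [Pi.sub_apply, ext_apply _ _ hr, ext_apply _ _ hr, ← dist_eq_norm]
      exact dist_coe_le_dist _
    · simp only [sub_self, Pi.zero_apply, norm_zero]
      positivity
  set A : Set (I →ᵇ ℂ) := {φ | ∃ x : H, ‖x‖ ≤ 1 ∧ ∀ ρ : I, φ ρ = J x.snd ρ} with hA
  have hAc : IsCompact (closure A) := by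
    refine arzela_ascoli (Metric.closedBall 0 1) (isCompact_closedBall _ _) A ?_ ?_
    · rintro φ ρ ⟨x, hx, hφ⟩
      rw [hφ, mem_closedBall_zero_iff]
      have := norm_J_sub_le x.snd (left_mem_Icc.2 zero_le_one) ρ.2 ρ.2.1
      rw [J_zero, sub_zero, sub_zero] at this
      refine this.trans (mul_le_one₀ ?_ (norm_nonneg _) ((norm_snd_le x).trans hx))
      rw [Real.sqrt_le_one]; exact ρ.2.2
    · refine Metric.equicontinuous_of_continuity_modulus Real.sqrt ?_ _ ?_
      · simpa using Real.continuous_sqrt.tendsto 0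
      · rintro a b ⟨φ, x, hx, hφ⟩
        change dist (φ a) (φ b) ≤ _
        rw [hφ, hφ]
        exact (dist_J_le x.snd a.2 b.2).trans
          (mul_le_of_le_one_right (Real.sqrt_nonneg _) ((norm_snd_le x).trans hx))
  refine ⟨Metric.closedBall 0 1, Metric.closedBall_mem_nhds _ one_pos, B '' closure A,
    hAc.image cB, ?_⟩
  rintro _ ⟨x, hx, rfl⟩
  have cx := continuousOn_funcs_snd x
  set φ : I →ᵇ ℂ := mkOfCompact ⟨I.domRestrict (J x.snd), cx.domRestrict⟩ with hφ
  refine ⟨φ, subset_closure ⟨x, mem_closedBall_zero_iff.1 hx, fun ρ => rfl⟩, ?_⟩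
  refine (hB φ).ext ((rep_L' x).congr (fun ρ hρ => ?_) fun _ _ => rfl)
  refine potTerm_congr (fun r hr => ?_) (Ioo_subset_Icc_self hρ)
  rw [ext_apply _ _ hr]; rfl

/-! ### Spectral points are eigenvalues -/

theorem exists_resolvent_L₀ {lam : ℂ} (hlam : -(3 / 2) < lam.re) : ∃ R : H →L[ℂ] H,
    (∀ f : H, ∃ hf : R f ∈ L₀.domain, lam • R f - L₀ ⟨R f, hf⟩ = f) ∧
      ∀ x : L₀.domain, R (lam • (x : H) - L₀ x) = x :=
  dissipative_freeTilde.exists_resolvent dense_freeTilde_domain hlam (dense_range_freeTilde hlam)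

/-- Write `λ - L = (1 - T)(λ - L₀)` with the compact operator `T = L' R`. By the Fredholm
alternative either `T z = z` for some `z ≠ 0`, and `R z` is an eigenvector, or `1 - T` is invertible
and `R (1 - T)⁻¹` is a resolvent of `L`, contrary to assumption. -/
theorem exists_eigenvector {lam : ℂ} (hlam : -(3 / 2) < lam.re)
    (hs : lam ∈ unboundedSpectrum L) :
    ∃ x : L₀.domain, (x : H) ≠ 0 ∧ lam • (x : H) - L₀ x = L' x := by
  obtain ⟨R, hR1, hR2⟩ := exists_resolvent_L₀ hlam
  -- A compact linear map is continuous, which makes `L' R` a bounded operator.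
  set T : H →L[ℂ] H := (ContinuousLinearMap.mkOfIsCompactOperator isCompactOperator_L').comp R
    with hT
  have Ta : ∀ z, T z = L' (R z) := fun z => rfl
  have hTc : IsCompactOperator T := isCompactOperator_L'.comp_clm R
  rcases hTc.hasEigenvalue_or_mem_resolventSet one_ne_zero with h | h
  · obtain ⟨z, hz⟩ := h.exists_hasEigenvector
    have hz1 : T z = z := by simpa using hz.apply_eq_smul
    obtain ⟨hm, e⟩ := hR1 z
    refine ⟨⟨R z, hm⟩, fun h0 => hz.2 ?_, ?_⟩
    -- If `R z` vanished, then so would `z = L' (R z)`.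
    · rw [← hz1, Ta, show R z = 0 from h0, map_zero]
    · exact e.trans hz1.symm
  · refine absurd ?_ hs
    rw [spectrum.mem_resolventSet_iff, map_one] at h
    obtain ⟨U, hU⟩ := h
    set S : H →L[ℂ] H := ↑U⁻¹ with hS
    have r1 : ∀ f, S f - T (S f) = f := fun f => by
      have : ((U : H →L[ℂ] H) * S) f = f := by rw [hS, Units.mul_inv]; rfl
      rwa [hU] at this
    have r2 : ∀ z, S (z - T z) = z := fun z => by
      have : (S * (U : H →L[ℂ] H)) z = z := by rw [hS, Units.inv_mul]; rfl
      rwa [hU] at this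
    refine ⟨R.comp S, fun f => ?_, fun x => ?_⟩
    · obtain ⟨hm, e⟩ := hR1 (S f)
      refine ⟨hm, ?_⟩
      change lam • R (S f) - (L' (R (S f)) + L₀ ⟨R (S f), hm⟩) = f
      rw [sub_eq_iff_eq_add.1 e, ← Ta, add_sub_add_right_eq_sub]
      exact r1 f
    · change R (S (lam • (x : H) - (L' x + L₀ x))) = x
      have hx := hR2 x
      set z := lam • (x : H) - L₀ x with hz
      have e : lam • (x : H) - (L' x + L₀ x) = z - T z := by
        rw [Ta, hx, hz]; abel
      rw [e, r2, hx]

/-! ### Regularity of eigenfunctions -/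

/-- The identity `x = R L' x` and the explicit resolvent formula give `u₂ = J (solSnd λ (potTerm u₂)
0)`. Here `potTerm` and `solSnd` preserve `Cⁿ` while `J` gains a derivative, so continuity of `u₂`
bootstraps to smoothness. -/
theorem exists_smooth_eigenfunction {lam : ℂ} (hlam : -(3 / 2) < lam.re) {x : L₀.domain}
    (hx : lam • (x : H) - L₀ x = L' x) :
    ∃ f g : ℝ → ℂ, ContDiffOn ℝ ∞ f I ∧ ContDiffOn ℝ ∞ g I ∧ f 0 = 0 ∧ Rep x f g := by
  obtain ⟨R, -, hR⟩ := exists_resolvent_L₀ hlam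
  set h := potTerm (J (x : H).snd) with hh
  have cv := continuousOn_funcs_snd (x : H)
  have ch : ContinuousOn h I := continuousOn_potTerm cv
  have hrep : Rep (x : H) (solFst lam h 0) (solSnd lam h 0) := by
    have s := contDiffOn_sol (n := 0) hlam (p := h) (q := 0)
      (by exact_mod_cast contDiffOn_zero.2 ch) contDiffOn_const
    obtain ⟨y, hy⟩ := exists_rep s.1.continuousOn s.2.continuousOn
    have e := resolvent_eq_sol hlam hR ch (rep_L' x) hy
    rw [← hx, hR] at e
    rw [e]; exact hy
  have reg : ∀ n : ℕ, ContDiffOn ℝ n (J (x : H).snd) I := by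
    intro n
    induction n with
    | zero => exact_mod_cast contDiffOn_zero.2 cv
    | succ n ih =>
      exact (contDiffOn_J (contDiffOn_sol hlam (contDiffOn_potTerm ih)
        (q := 0) contDiffOn_const).2).congr (J_congr hrep.2)
  have s := fun n => contDiffOn_sol hlam (contDiffOn_potTerm (reg n)) (q := 0) contDiffOn_const
  exact ⟨_, _, contDiffOn_top_of_nat fun n => (s n).1, contDiffOn_top_of_nat fun n => (s n).2,
    solFst_zero lam h 0, hrep⟩

/-! ### From eigenfunctions to the mode stability equation -/

theorem derivWithin_eq_of_eqOn_Ioc {p q : ℝ → ℂ} {q' : ℂ} (h : EqOn p q (Ioc 0 1)) {ρ : ℝ}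
    (hρ : ρ ∈ Ioc (0 : ℝ) 1) (hq : HasDerivWithinAt q q' I ρ) : derivWithin p I ρ = q' := by
  have he : p =ᶠ[nhdsWithin ρ I] q := by
    filter_upwards [self_mem_nhdsWithin, mem_nhdsWithin_of_mem_nhds (Ioi_mem_nhds hρ.1)]
      with r h1 h2 using h ⟨h2, h1.2⟩
  rw [he.derivWithin_eq (h hρ)]
  exact hq.derivWithin (uniqueDiffOn_I ρ ⟨hρ.1.le, hρ.2⟩)


/-- The relations between an eigenfunction `(u₁, u₂)` and the primitives of `v = u₂`. -/
theorem eigenfunction_relations {lam : ℂ} {x : L₀.domain}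
    (hx : lam • (x : H) - L₀ x = L' x) {f g : ℝ → ℂ} (hf : ContDiffOn ℝ ∞ f I)
    (hg : ContDiffOn ℝ ∞ g I) (h0 : f 0 = 0) (hr : Rep (x : H) f g) :
    (∀ ρ ∈ I, K (K f) ρ = (ρ : ℂ) ^ 2 * K (J g) ρ + (lam - 3) * K (K (J g)) ρ) ∧
      ∀ ρ ∈ I, (ρ : ℂ) ^ 2 * (1 - (ρ : ℂ) ^ 2) * J g ρ +
        (-3 + 3 * (ρ : ℂ) ^ 2 - 2 * lam * (ρ : ℂ) ^ 2) * K (J g) ρ -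
        (lam - 2) * (lam - 3) * K (K (J g)) ρ - V ρ * K (K (J g)) ρ = 0 := by
  set v := J g with hv
  have cf := hf.continuousOn
  have cg := hg.continuousOn
  have cv : ContinuousOn v I := continuousOn_J (ContinuousOn.ii cg)
  have cKv := continuousOn_K (ContinuousOn.ii cv)
  have cKKv := continuousOn_K (ContinuousOn.ii cKv)
  have cKf := continuousOn_K (ContinuousOn.ii cf)
  -- Smooth coordinates place `x` in the original domain, where the closure acts by the differential
  -- expression.
  have hm : (x : H) ∈ freeTilde.domain := hr.mem_domain hf hg h0
  have hle := freeTilde.le_closure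
  have e : L₀ x = freeTilde ⟨x, hm⟩ := (hle.2 rfl).symm
  have hu := hr.eqI
  have eq : EqI (lam • (K (K f), v)) (freeOp (K (K f), v) + potOp (K (K f), v)) := by
    have e1 : lam • (x : H) = freeTilde ⟨x, hm⟩ + L' x := by rw [← hx, e]; abel
    refine (hu.smul lam).symm.trans ((funcs_smul lam _).symm.trans ?_)
    rw [e1]
    refine (funcs_add _ _).trans (EqI.add ((freeTilde_spec _).trans (freeOp_congr hu))
      ((L'_spec _).trans (potOp_congr hu)))
  have eq1 : ∀ ρ ∈ I, lam * K (K f) ρ = -(ρ : ℂ) * (ρ * K f ρ) + 2 * K (K f) ρ +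
      (ρ : ℂ) ^ 2 * v ρ - 3 * K v ρ + -(V ρ : ℂ) * K (K v) ρ := fun ρ hρ => by
    have := eq.1 hρ
    simp only [freeOp, potOp, Prod.smul_fst, Prod.fst_add, Pi.add_apply, Pi.smul_apply,
      smul_eq_mul] at this
    rwa [derivWithin_K_eq cKf hρ] at this
  have eq2 : ∀ ρ ∈ I, f ρ = ρ * g ρ + (lam + 1) * v ρ := fun ρ hρ => by
    have := eq.2 hρ
    simp only [freeOp, potOp, Prod.smul_snd, Prod.snd_add, Pi.add_apply, Pi.smul_apply,
      smul_eq_mul, add_zero] at this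
    rw [D_D_K_K_eq cf h0 hρ, derivWithin_J_eq cg hρ] at this
    linear_combination -this
  -- Integrate `f = ρ v' + (λ + 1) v` twice; each integration by parts lowers the constant by two,
  -- from `λ + 1` to `λ - 1` and then `λ - 3`.
  have k1 : EqOn (K f) (fun ρ => (ρ : ℂ) ^ 2 * v ρ + (lam - 1) * K v ρ) I := by
    refine J_eq_of_hasDerivAt (by fun_prop) (by simp) (fun ρ hρ => ?_)
      (intervalIntegrable_mul (ContinuousOn.ii cf))
    refine ((((hasDerivAt_ofReal ρ).fun_pow 2).fun_mul (hasDerivAt_J cg hρ)).fun_add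
      ((hasDerivAt_K cv hρ).const_mul (lam - 1))).congr_deriv ?_
    rw [eq2 ρ (Ioo_subset_Icc_self hρ)]
    push_cast; ring
  have k2 : EqOn (K (K f)) (fun ρ => (ρ : ℂ) ^ 2 * K v ρ + (lam - 3) * K (K v) ρ) I := by
    refine J_eq_of_hasDerivAt (by fun_prop) (by simp) (fun ρ hρ => ?_)
      (intervalIntegrable_mul (ContinuousOn.ii cKf))
    refine ((((hasDerivAt_ofReal ρ).fun_pow 2).fun_mul (hasDerivAt_K cv hρ)).fun_add
      ((hasDerivAt_K cKv hρ).const_mul (lam - 3))).congr_deriv ?_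
    rw [k1 (Ioo_subset_Icc_self hρ)]
    push_cast; ring
  refine ⟨fun ρ hρ => k2 hρ, fun ρ hρ => ?_⟩
  have a := eq1 ρ hρ
  rw [k1 hρ, k2 hρ] at a
  linear_combination -a

/-- If `v` is smooth and vanishes at `0`, then `K² v` is `ρ³` times a smooth function. -/
theorem exists_K_K_eq_pow_mul {v : ℝ → ℂ} (hv : ContDiffOn ℝ ∞ v I) (h0 : v 0 = 0) :
    ∃ u : ℝ → ℂ, ContDiffOn ℝ ∞ u I ∧ ∀ ρ ∈ I, K (K v) ρ = (ρ : ℂ) ^ 3 * u ρ := by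
  set k := M 0 (derivWithin v I) with hk
  have sk : ContDiffOn ℝ ∞ k I := contDiffOn_M_infty (by simp) (contDiffOn_derivWithin_infty hv)
  have e0 : EqOn v (fun ρ => (ρ : ℂ) ^ 1 * k ρ) I := fun ρ hρ => by
    simp only [pow_one]; exact eq_mul_M_zero (smooth_one hv) h0 hρ
  set k1 := M ((1 : ℕ) + 1) k with hk1
  have sk1 : ContDiffOn ℝ ∞ k1 I := contDiffOn_M_infty (by norm_num) sk
  have e1 : EqOn (K v) (fun ρ => (ρ : ℂ) ^ 3 * k1 ρ) I := fun ρ hρ => by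
    rw [K_congr (ae_of_eqOn e0) hρ, K_pow_mul]
  have sk2 : ContDiffOn ℝ ∞ (M ((3 : ℕ) + 1) k1) I := contDiffOn_M_infty (by norm_num) sk1
  -- Since `v = ρ k`, the two integrations give `ρ⁵` times a smooth function; the two spare powers
  -- stay in `u`.
  refine ⟨fun ρ => (ρ : ℂ) ^ 2 * M ((3 : ℕ) + 1) k1 ρ,
    ((contDiff_coe.pow 2).contDiffOn).mul sk2, fun ρ hρ => ?_⟩
  rw [K_congr (ae_of_eqOn e1) hρ, K_pow_mul]
  ring

/-- With `w = K² v` one has `K v = D w` and `v = D² w`, so the relation is a second order equation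
for `w`. The substitution `w = ρ³ u` turns it into the mode equation, the derivatives of `u` being
computed by the quotient rule away from `0`. -/
theorem solvesModeEq_of_relation {lam : ℂ} {v u : ℝ → ℂ} (hv : ContinuousOn v I)
    (hu : ∀ ρ ∈ I, K (K v) ρ = (ρ : ℂ) ^ 3 * u ρ)
    (hrel : ∀ ρ ∈ I, (ρ : ℂ) ^ 2 * (1 - (ρ : ℂ) ^ 2) * v ρ +
        (-3 + 3 * (ρ : ℂ) ^ 2 - 2 * lam * (ρ : ℂ) ^ 2) * K v ρ -
        (lam - 2) * (lam - 3) * K (K v) ρ - V ρ * K (K v) ρ = 0) : SolvesModeEq lam u := by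
  have cKv := continuousOn_K (ContinuousOn.ii hv)
  have hI : ∀ {ρ : ℝ}, ρ ∈ Ioc (0 : ℝ) 1 → ρ ∈ I := fun h => Ioc_subset_Icc_self h
  have id : ∀ ρ : ℝ, HasDerivWithinAt (fun s : ℝ => (s : ℂ)) 1 I ρ := fun ρ =>
    (hasDerivAt_ofReal ρ).hasDerivWithinAt
  have e0 : EqOn u (fun ρ => K (K v) ρ / (ρ : ℂ) ^ 3) (Ioc 0 1) := fun ρ hρ => by
    have := ofReal_ne_zero_of_mem hρ
    simp only [hu ρ (hI hρ)]
    field_simp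
  have e1 : EqOn (derivWithin u I)
      (fun ρ => K v ρ / (ρ : ℂ) ^ 2 - 3 * K (K v) ρ / (ρ : ℂ) ^ 4) (Ioc 0 1) := fun ρ hρ => by
    have h0 := ofReal_ne_zero_of_mem hρ
    refine derivWithin_eq_of_eqOn_Ioc e0 hρ (((hasDerivWithinAt_K cKv (hI hρ)).fun_div
      ((id ρ).fun_pow 3) (pow_ne_zero 3 h0)).congr_deriv ?_)
    field_simp
    push_cast; ring
  have e2 : EqOn (derivWithin (derivWithin u I) I)
      (fun ρ => v ρ / ρ - 5 * K v ρ / (ρ : ℂ) ^ 3 + 12 * K (K v) ρ / (ρ : ℂ) ^ 5)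
      (Ioc 0 1) := fun ρ hρ => by
    have h0 := ofReal_ne_zero_of_mem hρ
    refine derivWithin_eq_of_eqOn_Ioc e1 hρ ((((hasDerivWithinAt_K hv (hI hρ)).fun_div
      ((id ρ).fun_pow 2) (pow_ne_zero 2 h0)).fun_sub
      (((hasDerivWithinAt_K cKv (hI hρ)).const_mul 3).fun_div
      ((id ρ).fun_pow 4) (pow_ne_zero 4 h0))).congr_deriv ?_)
    field_simp
    push_cast; ring
  intro ρ hρ
  have h0 := ofReal_ne_zero_of_mem hρ
  -- The singular part `6/ρ²` of the potential, removed in `V`, comes back through the factor `ρ³`.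
  have hV : 3 * ((deriv F (W₀ ρ - 1) : ℝ) : ℂ) / (ρ : ℂ) ^ 2 = V ρ + 6 / (ρ : ℂ) ^ 2 := by
    rw [V_eq hρ.1.ne']
    push_cast
    ring
  have r := hrel ρ (hI hρ)
  rw [hV, e1 hρ, e2 hρ, e0 hρ]
  field_simp
  linear_combination -(ρ : ℂ) ^ 2 * r

/-- Nontriviality: if `u` vanished, then `K² v = 0`, hence `v = 0` by injectivity of `K`. The first
relation then forces `u₁ = K² f = 0` as well, so `x = 0`. -/
theorem exists_mode_solution {lam : ℂ} {x : L₀.domain} (hx0 : (x : H) ≠ 0)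
    (hx : lam • (x : H) - L₀ x = L' x) {f g : ℝ → ℂ} (hf : ContDiffOn ℝ ∞ f I)
    (hg : ContDiffOn ℝ ∞ g I) (h0 : f 0 = 0) (hr : Rep (x : H) f g) :
    ∃ u : ℝ → ℂ, ContDiffOn ℝ ∞ u I ∧ (∃ ρ ∈ I, u ρ ≠ 0) ∧ SolvesModeEq lam u := by
  obtain ⟨r1, r2⟩ := eigenfunction_relations hx hf hg h0 hr
  have sv : ContDiffOn ℝ ∞ (J g) I := contDiffOn_J_infty hg
  have cv := sv.continuousOn
  have cKv := continuousOn_K (ContinuousOn.ii cv)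
  obtain ⟨u, su, hu⟩ := exists_K_K_eq_pow_mul sv (J_zero g)
  refine ⟨u, su, ?_, solvesModeEq_of_relation cv hu r2⟩
  by_contra! hz
  have w0 : EqOn (K (K (J g))) (K (K fun _ => 0)) I := fun ρ hρ => by
    rw [hu ρ hρ, hz ρ hρ]; simp [K]
  have c0 : ContinuousOn (fun _ : ℝ => (0 : ℂ)) I := continuousOn_const
  have v0 : EqOn (J g) (fun _ => 0) I := eqOn_of_ae cv c0
    (ae_eq_of_KK (ContinuousOn.ii cv) (ContinuousOn.ii c0) w0)
  refine hx0 (funcs_injective (hr.eqI.trans (EqI.trans ⟨fun ρ hρ => ?_, v0⟩ funcs_zero.symm)))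
  simp only [r1 ρ hρ, hu ρ hρ, hz ρ hρ, K_congr (ae_of_eqOn v0) hρ]
  simp [K]

end

end YangMills

/-! ### Spectral points to the right of `-3/2` -/

theorem lemma3p5 (lam : ℂ) (hlam : lam ∈ YangMills.unboundedSpectrum YangMills.L)
    (hre : -(3 / 2 : ℝ) < lam.re) :
    lam ∈ YangMills.unboundedPointSpectrum YangMills.L ∧
      ∃ u : ℝ → ℂ, ContDiffOn ℝ ∞ u (Icc 0 1) ∧ (∃ ρ ∈ Icc (0 : ℝ) 1, u ρ ≠ 0) ∧
        YangMills.SolvesModeEq lam u := by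
  obtain ⟨x, hx0, hx⟩ := YangMills.exists_eigenvector hre hlam
  refine ⟨⟨x, hx0, ?_⟩, ?_⟩
  · change YangMills.L' x + YangMills.L₀ x = lam • (x : YangMills.H)
    rw [← hx, sub_add_cancel]
  · obtain ⟨f, g, hf, hg, h0, hr⟩ := YangMills.exists_smooth_eigenfunction hre hx
    exact YangMills.exists_mode_solution hx0 hx hf hg h0 hr
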